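/- **Setting.** Let $r\ge 3$ be odd, $\hbar=2\pi\sqrt{-1}/r$, $q=e^{\hbar}$ and $q^z=e^{\hbar z}$ for $z\in\mathbb C$. Let $U=U_q^E(\mathfrak{gl}(1|1))$ be the Hopf superalgebra with even generators $E,G,K^{\pm1}$ and odd generators $X,Y$, where $K^{\pm 1}$ are mutually inverse and central, $E$ commutes with all generators, $[G,X]=X$, $[G,Y]=-Y$, $XY+YX=\frac{K-K^{-1}}{q-q^{-1}}$, $X^2=Y^2=0$, with coproduct $\Delta E=E\otimes1+1\otimes E$, $\Delta G=G\otimes 1+1\otimes G$, $\Delta K=K\otimes K$, $\Delta X=X\otimes K^{-1}+1\otimes X$, $\Delta Y=Y\otimes1+K\otimes Y$, counit $\epsilon(E)=\epsilon(G)=\epsilon(X)=\epsilon(Y)=0$, $\epsilon(K)=1$, and antipode $S(E)=-E$, $S(G)=-G$, $S(K)=K^{-1}$, $S(X)=-XK$, $S(Y)=-YK^{-1}$. Let $\mathcal D^q$ be the category of finite-dimensional $\mathbb Z_2$-graded $U$-modules which are spanned by simultaneous eigenvectors of $E$ and $G$ and on which $K$ acts by $q^{\lambda_E}$ on vectors of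 weight $(\lambda_E,\lambda_G)$; morphisms are the even $U$-linear maps. It is a $\mathbb C$-linear ribbon category with the duals $(xf)(v)=(-1)^{|f||x|}f(S(x)v)$, with $\overleftarrow{\mathrm{ev}}(f\otimes v)=f(v)$, $\overleftarrow{\mathrm{coev}}(1)=\sum_i v_i\otimes v_i^*$ and $\overrightarrow{\mathrm{ev}}(v\otimes f)=(-1)^{|f||v|}f(Kv)$, with the braiding $c_{V,W}=\tau\circ\big(1+(q-q^{-1})(X\otimes Y)(K\otimes K^{-1})\big)\circ\Upsilon$, where $\Upsilon(v\otimes w)=q^{-\lambda_E\mu_G-\lambda_G\mu_E}v\otimes w$ for $v,w$ of weights $\lambda,\mu$ and $\tau$ is the super flip, and with the twist $\theta_V=\operatorname{ptr}_V(c_{V,V})$, which is the action of $q^{-2EG}(K-(q-q^{-1})YX)$. Here $\operatorname{ptr}_W(f)=(\mathrm{Id}_V\otimes\overrightarrow{\mathrm{ev}}_W)(f\otimes\mathrm{Id}_{W^*})(\mathrm{Id}_V\otimes\overleftarrow{\mathrm{coev}}_W)$ for $f\in\operatorname{End}(V\otimes W)$. For $\alpha,a\in\mathbb C$ and $\bar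 p\in\mathbb Z_2$ let $V(\alpha,a)_{\bar p}$ be the module with basis $v,v'$ of degrees $\bar p,\bar p+\bar1$ and weights $(\alpha,a),(\alpha,a-1)$ and with $Yv=v'$, $Xv=0$, $Yv'=0$, $Xv'=\frac{q^\alpha-q^{-\alpha}}{q-q^{-1}}v$. For $2e\in r\mathbb Z$ and $b\in\mathbb C$ let $\varepsilon(e,b)_{\bar p}$ be the one-dimensional module of degree $\bar p$ and weight $(e,b)$, on which $X$ and $Y$ act by zero. **Data.** * $\mathsf G=\mathbb C/\mathbb Z\times\mathbb C/\mathbb Z$; $\mathcal D^q_{(\bar\alpha,\bar a)}$ is the full subcategory of modules all of whose weights are congruent to $(\bar\alpha,\bar a)$. * $\mathsf Z=\mathbb Z\times\mathbb Z\times\mathbb Z_2$ and $\sigma(n,n',\bar p)=\varepsilon(nr,n'r)_{\bar p}$. * $\mathsf X=\{(\bar\alpha,\bar a)\in\mathsf G\mid \bar\alpha\in\tfrac12\mathbb Z/\mathbb Z\}=\tfrac12\mathbb Z/\mathbb Z\times\mathbb C/\mathbb Z$. * $\mathsf t$ is a modified trace on the ideal of projective objects: linear maps $\mathsf t_V:\operatorname{End}(V)\to\mathbb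 C$ for $V$ projective, with $\mathsf t_V(fg)=\mathsf t_W(gf)$ and $\mathsf t_{V\otimes W}(f)=\mathsf t_V(\operatorname{ptr}_W f)$. Put $\mathsf d(V)=\mathsf t_V(\mathrm{Id}_V)$; the normalization is $\mathsf d(V(1,0)_{\bar 0})=(q-q^{-1})^{-1}$, where $V(1,0)_{\bar0}$ is projective. * For $g=(\bar\alpha,\bar a)\in\mathsf G\setminus\mathsf X$ with any chosen lift $(\alpha_0,a_0)\in\mathbb C^2$, $\Theta(g)=\{V(\alpha_0+i,a_0+j)_{\bar0}\mid 0\le i,j\le r-1\}$, and $\Omega_g=\sum_{V\in\Theta(g)}\mathsf d(V)\,V$. **Theorem.** For every choice of lifts, $\sigma$ has a monoidal structure and there is a modified trace $\mathsf t$, normalized as above, such that $\mathcal D^q$ is a modular $\mathsf G$-category relative to $(\mathsf Z,\mathsf X)$ with relative modularity parameter $\zeta=-r^2$ and stabilization coefficients $\Delta_\pm=\pm r$, and it is TQFT finite. Explicitly: 1. *Pre-modularity.* * The unit object $\mathbb I$ is simple with $\operatorname{End}(\mathbb I)=\mathbb C$. $\mathsf X$ is symmetric ($\mathsf X=-\mathsf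 X$) and small (no finite union of translates of $\mathsf X$ is $\mathsf G$). * $\mathcal D^q=\bigoplus_{g\in\mathsf G}\mathcal D^q_g$ as linear categories, with $\mathbb I\in\mathcal D^q_0$, $(\mathcal D^q_g)^*\subset\mathcal D^q_{-g}$ and $\mathcal D^q_g\otimes\mathcal D^q_{g'}\subset\mathcal D^q_{g+g'}$. * $\sigma$ is a free realisation of $\mathsf Z$ in $\mathcal D^q_0$: $\sigma(0)=\mathbb I$, $\operatorname{qdim}\sigma(k)\in\{\pm1\}$, $\theta_{\sigma(k)}=\mathrm{Id}$, and for $V$ simple $V\otimes\sigma(k)\simeq V$ if and only if $k=0$. * The projective objects form an ideal (closed under retracts and under tensoring with arbitrary objects), and $\mathsf t\neq0$. * For every $g\in\mathsf G\setminus\mathsf X$ the objects of $\Theta(g)$ are simple, projective and regular ($\overleftarrow{\mathrm{ev}}$ is epi), and $\{V\otimes\sigma(k)\mid V\in\Theta(g),k\in\mathsf Z\}$ is a dominating set of $\mathcal D^q_g$ (every identity $\mathrm{Id}_W$, $W\in\mathcal D^q_g$, is a finite sum of morphisms that factor through members of the set) which is completely reduced (the Hom-space between the members with indices $s,s'$ has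 dimension $\delta_{s,s'}$). * There is a bilinear map $\psi:\mathsf G\times\mathsf Z\to\mathbb C^\times$ with $c_{\sigma(k),V}\circ c_{V,\sigma(k)}=\psi(g,k)\,\mathrm{Id}$ for $V\in\mathcal D^q_g$. 2. *Modularity.* For $g,h\in\mathsf G\setminus\mathsf X$ and $V_i,V_j\in\Theta(g)$, $$\mathsf d(V_i)\sum_{W\in\Theta(h)}\mathsf d(W)\operatorname{ptr}_W\!\big(c_{W,V_i\otimes V_j^*}\circ c_{V_i\otimes V_j^*,W}\big)=\delta_{ij}\,\zeta\;\overleftarrow{\mathrm{coev}}_{V_i}\circ\overrightarrow{\mathrm{ev}}_{V_i},\qquad \zeta=-r^2 .$$ 3. *Stabilization.* For $g\in\mathsf G\setminus\mathsf X$ and $V\in\mathcal D^q_g$, $$\theta_V^{-1}\circ\sum_{W\in\Theta(g)}\mathsf d(W)\operatorname{ptr}_W\!\big(c_{W,V}\circ c_{V,W}\circ(\mathrm{Id}_V\otimes\theta_W^{-1})\big)=\Delta_-\mathrm{Id}_V,$$ $$\theta_V\circ\sum_{W\in\Theta(g)}\mathsf d(W)\operatorname{ptr}_W\!\big(c_{V,W}^{-1}\circ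 c_{W,V}^{-1}\circ(\mathrm{Id}_V\otimes\theta_W)\big)=\Delta_+\mathrm{Id}_V,$$ with $\Delta_-=-r$ and $\Delta_+=r$. 4. *TQFT finiteness.* * For each $g\in\mathsf G$ there are finitely many projective indecomposables $P_1,\dots,P_n$ of $\mathcal D^q_g$ such that every projective indecomposable of $\mathcal D^q_g$ is isomorphic to some $P_j\otimes\sigma(k)$. * For each projective $P$, $\operatorname{Hom}(\sigma(k),P)$ is finite-dimensional for all $k\in\mathsf Z$ and non-zero for only finitely many $k$. * The category of projective objects is dominated by the projective indecomposables. -/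

import Mathlib

set_option linter.unusedVariables false
set_option linter.unusedSectionVars false
set_option linter.unnecessarySeqFocus false
set_option linter.unusedSimpArgs false

namespace RelMod

open CategoryTheory MonoidalCategory
universe v u

/-- A compatible twist on a rigid braided category. -/
class RibbonCategory (C : Type u) [Category.{v} C] [MonoidalCategory C] [BraidedCategory C]
    [RightRigidCategory C] where
  twist (X : C) : X ≅ X
  twist_naturality {X Y : C} (f : X ⟶ Y) : f ≫ (twist Y).hom = (twist X).hom ≫ f
  twist_tensor (X Y : C) : (twist (X ⊗ Y)).hom =
    ((twist X).hom ⊗ₘ (twist Y).hom) ≫ (β_ X Y).hom ≫ (β_ Y X).hom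
  twist_dual (X : C) : (twist Xᘁ).hom = rightAdjointMate (twist X).hom

section
variable {C : Type u} [Category.{v} C] [MonoidalCategory C] [BraidedCategory C]
    [RightRigidCategory C] [RibbonCategory C]

/-- The twist of `X`. -/
abbrev θ_ (X : C) : X ≅ X := RibbonCategory.twist X

/-- The left evaluation `X* ⊗ X → 𝟙`. -/
def evL (X : C) : Xᘁ ⊗ X ⟶ 𝟙_ C := ε_ X Xᘁ

/-- The left coevaluation `𝟙 → X ⊗ X*`. -/
def coevL (X : C) : 𝟙_ C ⟶ X ⊗ Xᘁ := η_ X Xᘁ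

/-- The right evaluation `X ⊗ X* → 𝟙`, built from the twist and the braiding. -/
def evR (X : C) : X ⊗ Xᘁ ⟶ 𝟙_ C := (θ_ X).hom ▷ Xᘁ ≫ (β_ X Xᘁ).hom ≫ evL X
end

section general

variable {C : Type u} [Category.{v} C] [MonoidalCategory C] [BraidedCategory C]
  [RightRigidCategory C] [RibbonCategory C]

/-- The quantum dimension, as an endomorphism of the unit object. -/
def qdim (V : C) : 𝟙_ C ⟶ 𝟙_ C := coevL V ≫ evR V

/-- The right partial trace `End (V ⊗ W) → End V`. -/
def ptr {V : C} (W : C) (f : V ⊗ W ⟶ V ⊗ W) : V ⟶ V :=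
  (ρ_ V).inv ≫ V ◁ coevL W ≫ (α_ V W Wᘁ).inv ≫ f ▷ Wᘁ ≫ (α_ V W Wᘁ).hom ≫ V ◁ evR W ≫ (ρ_ V).hom

/-- The value of the `(1,1)`-tangle in which a closed loop coloured by `W`, and carrying a coupon
`f`, encircles a strand coloured by `V`; loop and strand are linked by two positive crossings. -/
def posLoop (W V : C) (f : W ⟶ W) : V ⟶ V :=
  ptr W (V ◁ f ≫ (β_ V W).hom ≫ (β_ W V).hom)

/-- The same tangle with two negative crossings. -/
def negLoop (W V : C) (f : W ⟶ W) : V ⟶ V :=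
  ptr W (V ◁ f ≫ (β_ W V).inv ≫ (β_ V W).inv)

/-- An object is regular if its left evaluation is an epimorphism. -/
def IsRegular (V : C) : Prop := Epi (evL V)

/-- An object is projective if every epimorphism onto it admits a section. -/
def projectives (C : Type u) [Category.{v} C] : ObjectProperty C :=
  fun P => ∀ (V : C) (f : V ⟶ P), Epi f → ∃ g : P ⟶ V, g ≫ f = 𝟙 P

/-- A full subcategory stable under retracts which absorbs tensor products on the right. -/
structure IsIdeal (S : ObjectProperty C) : Prop where
  retract : ∀ (V W : C) (f : V ⟶ W) (g : W ⟶ V), S W → f ≫ g = 𝟙 V → S V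
  tensor : ∀ U V : C, S U → S (U ⊗ V)

end general

section preadditive

variable {C : Type u} [Category.{v} C] [Preadditive C]

/-- `V` is a direct sum of the finite family `W`. -/
def IsDirectSum (V : C) {n : ℕ} (W : Fin n → C) : Prop :=
  ∃ (ι : ∀ i, W i ⟶ V) (s : ∀ i, V ⟶ W i), 𝟙 V = ∑ i, s i ≫ ι i ∧
    (∀ i, ι i ≫ s i = 𝟙 (W i)) ∧ ∀ i j, i ≠ j → ι i ≫ s j = 0

/-- In every finite direct sum decomposition of `V` exactly one summand is isomorphic to `V`, and
all the others vanish. -/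
def IsIndecomposable (V : C) : Prop :=
  ∀ (n : ℕ) (W : Fin n → C), IsDirectSum V W →
    ∃! i, Nonempty (V ≅ W i) ∧ ∀ j, j ≠ i → Limits.IsZero (W j)

/-- The family `E` of objects of the full subcategory `S` dominates `S`. -/
def IsDominating (S : ObjectProperty C) {J : Type*} (E : J → C) : Prop :=
  (∀ j, S (E j)) ∧ ∀ V : C, S V → ∃ (m : ℕ) (i : Fin m → J) (ι : ∀ k, E (i k) ⟶ V)
    (s : ∀ k, V ⟶ E (i k)), 𝟙 V = ∑ k, s k ≫ ι k

/-- All `Hom`-spaces of the family `E` have dimension `δ`. -/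
def IsCompletelyReduced (k : Type*) [Field k] [Linear k C] {J : Type*} (E : J → C) : Prop :=
  ∀ i j, (i = j → Module.rank k (E i ⟶ E j) = 1) ∧ (i ≠ j → Module.rank k (E i ⟶ E j) = 0)

end preadditive

section linear

variable (k : Type*) [Field k] {C : Type u} [Category.{v} C] [Preadditive C] [Linear k C]
  [MonoidalCategory C] [BraidedCategory C] [RightRigidCategory C] [RibbonCategory C]

/-- The unit object is simple and has no endomorphisms except the scalars. -/
structure IsScalarUnit (C : Type u) [Category.{v} C] [Preadditive C] [Linear k C]
    [MonoidalCategory C] : Prop where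
  simple : Simple (𝟙_ C)
  bijective : Function.Bijective fun a : k => a • 𝟙 (𝟙_ C)

/-- A modified trace on the full subcategory `S`. The maps `tr V` for `V` outside of `S` carry no
information. -/
structure ModifiedTrace (S : ObjectProperty C) where
  tr (V : C) : (V ⟶ V) →ₗ[k] k
  cyclic (V W : C) (_ : S V) (_ : S W) (f : W ⟶ V) (g : V ⟶ W) : tr V (g ≫ f) = tr W (f ≫ g)
  partial_trace (V W : C) (_ : S V) (f : V ⊗ W ⟶ V ⊗ W) : tr (V ⊗ W) f = tr V (ptr W f)

variable {k}

/-- The modified dimension. -/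
def ModifiedTrace.dim {S : ObjectProperty C} (t : ModifiedTrace k S) (V : C) : k := t.tr V (𝟙 V)

def ModifiedTrace.IsNonzero {S : ObjectProperty C} (t : ModifiedTrace k S) : Prop :=
  ∃ V, S V ∧ t.tr V ≠ 0

variable {G Z : Type*} [AddCommGroup G] [AddCommGroup Z]

/-- The full subcategories `deg g` define a `G`-grading: `C` is the direct sum of the linear
categories `deg g`, compatibly with unit object, duals and tensor products. -/
structure IsGrading (deg : G → ObjectProperty C) : Prop where
  of_iso : ∀ (g : G) (V W : C), deg g V → (V ≅ W) → deg g W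
  hom_eq_zero : ∀ (g g' : G) (V W : C), deg g V → deg g' W → g ≠ g' → ∀ f : V ⟶ W, f = 0
  exists_decomposition : ∀ V : C, ∃ (n : ℕ) (g : Fin n → G) (W : Fin n → C),
    Function.Injective g ∧ (∀ i, deg (g i) (W i)) ∧ IsDirectSum V W
  exists_sum : ∀ (n : ℕ) (g : Fin n → G) (W : Fin n → C), Function.Injective g →
    (∀ i, deg (g i) (W i)) → ∃ V : C, IsDirectSum V W
  unit : deg 0 (𝟙_ C)
  dual : ∀ (g : G) (V : C), deg g V → deg (-g) Vᘁ
  tensor : ∀ (g g' : G) (V W : C), deg g V → deg g' W → deg (g + g') (V ⊗ W)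

/-- The monoidal functor `σ` on the discrete monoidal category `Z` is a free realisation of `Z`. -/
structure IsFreeRealisation (σ : Discrete Z ⥤ C) : Prop where
  obj_zero : σ.obj ⟨0⟩ = 𝟙_ C
  qdim_obj : ∀ z : Z, qdim (σ.obj ⟨z⟩) = 𝟙 (𝟙_ C) ∨ qdim (σ.obj ⟨z⟩) = -𝟙 (𝟙_ C)
  twist_obj : ∀ z : Z, (θ_ (σ.obj ⟨z⟩)).hom = 𝟙 (σ.obj ⟨z⟩)
  free : ∀ (V : C) (z : Z), Simple V → (Nonempty (V ⊗ σ.obj ⟨z⟩ ≅ V) ↔ z = 0)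

/-- `X = -X`. -/
def IsSymmetric (X : Set G) : Prop := ∀ g, g ∈ X ↔ -g ∈ X

/-- No finite union of translates of `X` is all of `G`. -/
def IsSmall (X : Set G) : Prop := ∀ (n : ℕ) (s : Fin n → G), ⋃ i, (fun x => s i + x) '' X ≠ Set.univ

variable (k C G Z)

/-- The data of a relative (pre-)modular category. -/
structure RelData where
  /-- the homogeneous objects of each degree -/
  deg : G → ObjectProperty C
  /-- the realisation of `Z` -/
  σ : Discrete Z ⥤ C
  /-- its monoidal structure -/
  monoidal : σ.Monoidal
  /-- the modified trace on the projective objects -/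
  t : ModifiedTrace k (projectives C)
  /-- the finite index set of generic simple objects of each degree -/
  I : G → Type
  fintype (g : G) : Fintype (I g)
  /-- the generic simple objects of each degree -/
  Θ (g : G) : I g → C

attribute [instance] RelData.fintype

variable {k C G Z}

namespace RelData

variable (D : RelData k C G Z) (X : Set G)

/-- `D` makes `C` a pre-modular `G`-category relative to `(Z, X)`. -/
structure IsPremodular : Prop where
  unit : IsScalarUnit k C
  small : IsSmall X
  symmetric : IsSymmetric X
  grading : IsGrading D.deg
  realisation : IsFreeRealisation D.σ
  realisation_deg : ∀ z : Z, D.deg 0 (D.σ.obj ⟨z⟩)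
  ideal : IsIdeal (projectives C)
  trace_nonzero : D.t.IsNonzero
  simple : ∀ g ∉ X, ∀ i, Simple (D.Θ g i)
  regular : ∀ g ∉ X, ∀ i, IsRegular (D.Θ g i)
  /-- so that modified dimensions of the generic simple objects are meaningful -/
  projective : ∀ g ∉ X, ∀ i, projectives C (D.Θ g i)
  dominating : ∀ g ∉ X, IsDominating (D.deg g)
    fun p : D.I g × Z => D.Θ g p.1 ⊗ D.σ.obj ⟨p.2⟩
  completely_reduced : ∀ g ∉ X, IsCompletelyReduced k
    fun p : D.I g × Z => D.Θ g p.1 ⊗ D.σ.obj ⟨p.2⟩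
  compatible : ∃ ψ : G →+ Z →+ Additive kˣ, ∀ (g : G) (V : C), D.deg g V → ∀ z : Z,
    (β_ V (D.σ.obj ⟨z⟩)).hom ≫ (β_ (D.σ.obj ⟨z⟩) V).hom =
      ((ψ g z).toMul : k) • 𝟙 (V ⊗ D.σ.obj ⟨z⟩)

/-- `D` is a relative modular category with relative modularity parameter `ζ`: sliding the Kirby
colour of index `h` around `V_i ⊗ V_j*` gives `δ_ij ζ` times the cup-cap. -/
structure IsModular (ζ : k) : Prop where
  premodular : D.IsPremodular X
  ne_zero : ζ ≠ 0
  diag : ∀ g ∉ X, ∀ h ∉ X, ∀ i : D.I g,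
    D.t.dim (D.Θ g i) • ∑ l : D.I h, D.t.dim (D.Θ h l) •
      posLoop (D.Θ h l) (D.Θ g i ⊗ (D.Θ g i)ᘁ) (𝟙 (D.Θ h l)) =
    ζ • (evR (D.Θ g i) ≫ coevL (D.Θ g i))
  off_diag : ∀ g ∉ X, ∀ h ∉ X, ∀ i j : D.I g, i ≠ j →
    D.t.dim (D.Θ g i) • ∑ l : D.I h, D.t.dim (D.Θ h l) •
      posLoop (D.Θ h l) (D.Θ g i ⊗ (D.Θ g j)ᘁ) (𝟙 (D.Θ h l)) = 0

/-- `Δm` and `Δp` are the stabilisation coefficients. -/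
structure IsStabilisation (Δm Δp : k) : Prop where
  minus : ∀ g ∉ X, ∀ V : C, D.deg g V →
    (∑ i : D.I g, D.t.dim (D.Θ g i) • posLoop (D.Θ g i) V (θ_ (D.Θ g i)).inv) ≫ (θ_ V).inv =
      Δm • 𝟙 V
  plus : ∀ g ∉ X, ∀ V : C, D.deg g V →
    (∑ i : D.I g, D.t.dim (D.Θ g i) • negLoop (D.Θ g i) V (θ_ (D.Θ g i)).hom) ≫ (θ_ V).hom =
      Δp • 𝟙 V

/-- The finiteness conditions under which the state spaces of the associated field theory are
finite-dimensional. -/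
structure IsTQFTFinite : Prop where
  finite_indecomposables : ∀ g : G, ∃ (n : ℕ) (P : Fin n → C),
    (∀ j, D.deg g (P j) ∧ projectives C (P j) ∧ IsIndecomposable (P j)) ∧
    ∀ Q : C, D.deg g Q → projectives C Q → IsIndecomposable Q →
      ∃ (j : Fin n) (z : Z), Nonempty (Q ≅ P j ⊗ D.σ.obj ⟨z⟩)
  finite_hom : ∀ P : C, projectives C P → (∀ z : Z, Module.Finite k (D.σ.obj ⟨z⟩ ⟶ P)) ∧
    {z : Z | ∃ f : D.σ.obj ⟨z⟩ ⟶ P, f ≠ 0}.Finite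
  dominated : IsDominating (projectives C)
    fun P : {P : C // projectives C P ∧ IsIndecomposable P} => P.1

end RelData

end linear

end RelMod

namespace GL11

open CategoryTheory MonoidalCategory TensorProduct RelMod

/-- A complex number `ħ` with `exp ħ ≠ ±1`. -/
structure QParam where
  hbar : ℂ
  ne_one : Complex.exp hbar ≠ 1
  ne_neg_one : Complex.exp hbar ≠ -1

namespace QParam

/-- `q ^ z = exp (ħ z)`. -/
noncomputable def pow (h : QParam) (z : ℂ) : ℂ := Complex.exp (h.hbar * z)

/-- `q = exp ħ`. -/
noncomputable def q (h : QParam) : ℂ := Complex.exp h.hbar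

/-- `q - q⁻¹`. -/
noncomputable def diff (h : QParam) : ℂ := h.q - h.q⁻¹

theorem diff_ne_zero (h : QParam) : h.diff ≠ 0 := by
  have hq : h.q ≠ 0 := Complex.exp_ne_zero _
  intro h0
  have h1 : h.q * h.q = 1 := by
    have : h.q = h.q⁻¹ := sub_eq_zero.1 h0
    nth_rewrite 2 [this]
    exact mul_inv_cancel₀ hq
  rcases mul_self_eq_one_iff.1 h1 with h2 | h2
  · exact h.ne_one h2
  · exact h.ne_neg_one h2

theorem pow_add (h : QParam) (a b : ℂ) : h.pow (a + b) = h.pow a * h.pow b := by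
  simp [pow, mul_add, Complex.exp_add]

theorem pow_zero (h : QParam) : h.pow 0 = 1 := by simp [pow]

theorem pow_ne_zero (h : QParam) (a : ℂ) : h.pow a ≠ 0 := Complex.exp_ne_zero _

theorem pow_neg (h : QParam) (a : ℂ) : h.pow (-a) = (h.pow a)⁻¹ := by
  simp [pow, Complex.exp_neg]

end QParam

/-- The sign `(-1) ^ p`. -/
noncomputable def parSign (p : ZMod 2) : ℂ := if p = 0 then 1 else -1

theorem parSign_cases (p : ZMod 2) : parSign p = 1 ∨ parSign p = -1 := by
  unfold parSign; split <;> simp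

theorem parSign_mul_self (p : ZMod 2) : parSign p * parSign p = 1 := by
  rcases parSign_cases p with h | h <;> simp [h]

/-- The generators of the unrolled quantum group of `gl(1|1)`. -/
inductive Gen
  | E | G | K | Kinv | X | Y

/-- The degrees of the generators. -/
def Gen.parity : Gen → ZMod 2
  | .X => 1
  | .Y => 1
  | _ => 0

section
open FreeAlgebra

/-- The defining relations of the unrolled quantum group of `gl(1|1)`. -/
inductive Rel (h : QParam) : FreeAlgebra ℂ Gen → FreeAlgebra ℂ Gen → Prop
  | K_Kinv : Rel h (ι ℂ .K * ι ℂ .Kinv) 1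
  | Kinv_K : Rel h (ι ℂ .Kinv * ι ℂ .K) 1
  | K_comm (x : Gen) : Rel h (ι ℂ .K * ι ℂ x) (ι ℂ x * ι ℂ .K)
  | Kinv_comm (x : Gen) : Rel h (ι ℂ .Kinv * ι ℂ x) (ι ℂ x * ι ℂ .Kinv)
  | E_X : Rel h (ι ℂ .E * ι ℂ .X) (ι ℂ .X * ι ℂ .E)
  | E_Y : Rel h (ι ℂ .E * ι ℂ .Y) (ι ℂ .Y * ι ℂ .E)
  | E_G : Rel h (ι ℂ .E * ι ℂ .G) (ι ℂ .G * ι ℂ .E)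
  | G_X : Rel h (ι ℂ .G * ι ℂ .X - ι ℂ .X * ι ℂ .G) (ι ℂ .X)
  | G_Y : Rel h (ι ℂ .G * ι ℂ .Y - ι ℂ .Y * ι ℂ .G) (-ι ℂ .Y)
  | X_Y : Rel h (ι ℂ .X * ι ℂ .Y + ι ℂ .Y * ι ℂ .X)
      ((h.q - h.q⁻¹)⁻¹ • (ι ℂ .K - ι ℂ .Kinv))
  | X_X : Rel h (ι ℂ .X * ι ℂ .X) 0
  | Y_Y : Rel h (ι ℂ .Y * ι ℂ .Y) 0

end

/-- The unrolled quantum group of `gl(1|1)`, as an algebra. Its super structure is given by the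
degrees of the generators. -/
abbrev U (h : QParam) : Type := RingQuot (Rel h)

noncomputable def U.gen (h : QParam) (x : Gen) : U h :=
  RingQuot.mkAlgHom ℂ (Rel h) (FreeAlgebra.ι ℂ x)

/-- The operators `ρ` on `V` satisfy the defining relations of `U h` (the relations between `K⁻¹`
and the remaining generators follow), they are homogeneous of the degree of the generator with
respect to the `ℤ/2`-grading of `V` by the eigenspaces of the involution `Γ` (eigenvalue `1` for
even and `-1` for odd vectors), and `V` is spanned by simultaneous eigenvectors of `E` and `G` on
which `K` acts by `q ^ e`, where `e` is the eigenvalue of `E`. -/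
structure IsOps (h : QParam) {V : Type} [AddCommGroup V] [Module ℂ V]
    (ρ : Gen → Module.End ℂ V) (Γ : Module.End ℂ V) : Prop where
  K_Kinv : ρ .K * ρ .Kinv = 1
  Kinv_K : ρ .Kinv * ρ .K = 1
  K_E : ρ .K * ρ .E = ρ .E * ρ .K
  K_G : ρ .K * ρ .G = ρ .G * ρ .K
  K_X : ρ .K * ρ .X = ρ .X * ρ .K
  K_Y : ρ .K * ρ .Y = ρ .Y * ρ .K
  E_X : ρ .E * ρ .X = ρ .X * ρ .E
  E_Y : ρ .E * ρ .Y = ρ .Y * ρ .E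
  E_G : ρ .E * ρ .G = ρ .G * ρ .E
  G_X : ρ .G * ρ .X = ρ .X * ρ .G + ρ .X
  G_Y : ρ .G * ρ .Y = ρ .Y * ρ .G - ρ .Y
  X_Y : ρ .X * ρ .Y + ρ .Y * ρ .X = h.diff⁻¹ • (ρ .K - ρ .Kinv)
  X_X : ρ .X * ρ .X = 0
  Y_Y : ρ .Y * ρ .Y = 0
  Γ_Γ : Γ * Γ = 1
  Γ_E : Γ * ρ .E = ρ .E * Γ
  Γ_G : Γ * ρ .G = ρ .G * Γ
  Γ_K : Γ * ρ .K = ρ .K * Γ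
  Γ_X : Γ * ρ .X = -(ρ .X * Γ)
  Γ_Y : Γ * ρ .Y = -(ρ .Y * Γ)
  span : Submodule.span ℂ {v | ∃ e g : ℂ, ρ .E v = e • v ∧ ρ .G v = g • v ∧
    ρ .K v = h.pow e • v} = ⊤

namespace IsOps

variable {h : QParam} {V : Type} [AddCommGroup V] [Module ℂ V]
  {ρ : Gen → Module.End ℂ V} {Γ : Module.End ℂ V}

theorem comm_Kinv (o : IsOps h ρ Γ) {T : Module.End ℂ V} (hT : ρ .K * T = T * ρ .K) :
    ρ .Kinv * T = T * ρ .Kinv := by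
  calc ρ .Kinv * T = ρ .Kinv * (T * ρ .K) * ρ .Kinv := by
        rw [mul_assoc, mul_assoc, o.K_Kinv, mul_one]
    _ = ρ .Kinv * (ρ .K * T) * ρ .Kinv := by rw [hT]
    _ = T * ρ .Kinv := by rw [← mul_assoc, o.Kinv_K, one_mul]

theorem rel (o : IsOps h ρ Γ) : ∀ ⦃a b⦄, Rel h a b → FreeAlgebra.lift ℂ ρ a = FreeAlgebra.lift ℂ ρ b := by
  intro a b r
  cases r with
  | K_Kinv => simp [o.K_Kinv]
  | Kinv_K => simp [o.Kinv_K]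
  | K_comm x =>
    cases x <;> simp [o.K_E, o.K_G, o.K_X, o.K_Y, o.K_Kinv, o.Kinv_K]
  | Kinv_comm x =>
    cases x <;> simp [o.comm_Kinv o.K_E, o.comm_Kinv o.K_G, o.comm_Kinv o.K_X,
      o.comm_Kinv o.K_Y, o.K_Kinv, o.Kinv_K]
  | E_X => simp [o.E_X]
  | E_Y => simp [o.E_Y]
  | E_G => simp [o.E_G]
  | G_X => simp [o.G_X]
  | G_Y => simp [o.G_Y]
  | X_Y => simpa [QParam.diff] using o.X_Y
  | X_X => simp [o.X_X]
  | Y_Y => simp [o.Y_Y]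

/-- The action of the whole algebra `U h`. -/
noncomputable def toAct (o : IsOps h ρ Γ) : U h →ₐ[ℂ] Module.End ℂ V :=
  RingQuot.liftAlgHom ℂ ⟨FreeAlgebra.lift ℂ ρ, o.rel⟩

@[simp] theorem toAct_gen (o : IsOps h ρ Γ) (x : Gen) : o.toAct (U.gen h x) = ρ x := by
  simp [toAct, U.gen]

end IsOps

/-- The operator which acts by `q ^ z` on the eigenspace of `T` of eigenvalue `z`, for
diagonalisable `T`; see `qpow_apply`. -/
noncomputable def qpow (h : QParam) {V : Type} [AddCommGroup V] [Module ℂ V]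
    (T : Module.End ℂ V) : Module.End ℂ V :=
  Polynomial.aeval T (Lagrange.interpolate (minpoly ℂ T).roots.toFinset id h.pow)

theorem qpow_apply (h : QParam) {V : Type} [AddCommGroup V] [Module ℂ V] [FiniteDimensional ℂ V]
    {T : Module.End ℂ V} {z : ℂ} {v : V} (hv : T v = z • v) : qpow h T v = h.pow z • v := by
  rcases eq_or_ne v 0 with rfl | hne
  · simp
  · have hev : T.HasEigenvector z v := ⟨Module.End.mem_eigenspace_iff.mpr hv, hne⟩
    have hz : z ∈ (minpoly ℂ T).roots.toFinset := by
      rw [Multiset.mem_toFinset, Polynomial.mem_roots (minpoly.ne_zero (Algebra.IsIntegral.isIntegral T))]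
      exact Module.End.isRoot_of_hasEigenvalue (Module.End.hasEigenvalue_of_hasEigenvector hev)
    rw [qpow, Module.End.aeval_apply_of_mem_apply_eq_smul hv]
    congr 1
    exact Lagrange.eval_interpolate_at_node _ Function.injective_id.injOn hz

theorem U.commute_all (h : QParam) {V W : Type} [AddCommGroup V] [Module ℂ V]
    [AddCommGroup W] [Module ℂ W] (φ : U h →ₐ[ℂ] Module.End ℂ V)
    (ψ : U h →ₐ[ℂ] Module.End ℂ W) (f : V →ₗ[ℂ] W)
    (hf : ∀ x, f ∘ₗ φ (U.gen h x) = ψ (U.gen h x) ∘ₗ f) (u : U h) :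
    f ∘ₗ φ u = ψ u ∘ₗ f := by
  obtain ⟨a, rfl⟩ := RingQuot.mkAlgHom_surjective ℂ (Rel h) u
  induction a using FreeAlgebra.induction with
  | grade0 r =>
    ext v
    simp [Algebra.algebraMap_eq_smul_one]
  | grade1 x => exact hf x
  | mul a b ha hb =>
    ext v
    have ha' := fun v => LinearMap.congr_fun ha v
    have hb' := fun v => LinearMap.congr_fun hb v
    simp only [LinearMap.comp_apply] at ha' hb'
    simp [ha', hb']
  | add a b ha hb =>
    simp [LinearMap.comp_add, LinearMap.add_comp, ha, hb]

theorem IsOps.K_weight {h : QParam} {V : Type} [AddCommGroup V] [Module ℂ V]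
    [FiniteDimensional ℂ V] {ρ : Gen → Module.End ℂ V} {Γ : Module.End ℂ V} (o : IsOps h ρ Γ)
    {e : ℂ} {v : V} (he : ρ .E v = e • v) : ρ .K v = h.pow e • v := by
  have hK : ρ .K = qpow h (ρ .E) := by
    refine LinearMap.ext_on o.span ?_
    rintro v ⟨e, g, h1, -, h3⟩
    rw [h3, qpow_apply h h1]
  rw [hK, qpow_apply h he]

/-- A weight module over `U h`: a finite-dimensional super vector space (with parity involution
`Γ`) with an action of the algebra, given by the operators of the generators. -/
structure WtMod (h : QParam) where
  carrier : Type
  [addCommGroup : AddCommGroup carrier]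
  [module : Module ℂ carrier]
  [finiteDimensional : FiniteDimensional ℂ carrier]
  op : Gen → Module.End ℂ carrier
  Γ : Module.End ℂ carrier
  isOps : IsOps h op Γ

attribute [instance] WtMod.addCommGroup WtMod.module WtMod.finiteDimensional

/-- The module structure over `U h`. -/
noncomputable def WtMod.act {h : QParam} (V : WtMod h) : U h →ₐ[ℂ] Module.End ℂ V.carrier :=
  V.isOps.toAct

namespace IsOps

variable {h : QParam} {V : Type} [AddCommGroup V] [Module ℂ V]
  {ρ : Gen → Module.End ℂ V} {Γ : Module.End ℂ V}

theorem pw (o : IsOps h ρ Γ) : (∀ v, ρ .K (ρ .Kinv v) = v) ∧ (∀ v, ρ .Kinv (ρ .K v) = v) ∧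
    (∀ v, ρ .K (ρ .E v) = ρ .E (ρ .K v)) ∧ (∀ v, ρ .K (ρ .G v) = ρ .G (ρ .K v)) ∧
    (∀ v, ρ .K (ρ .X v) = ρ .X (ρ .K v)) ∧ (∀ v, ρ .K (ρ .Y v) = ρ .Y (ρ .K v)) ∧
    (∀ v, ρ .Kinv (ρ .E v) = ρ .E (ρ .Kinv v)) ∧ (∀ v, ρ .Kinv (ρ .G v) = ρ .G (ρ .Kinv v)) ∧
    (∀ v, ρ .Kinv (ρ .X v) = ρ .X (ρ .Kinv v)) ∧ (∀ v, ρ .Kinv (ρ .Y v) = ρ .Y (ρ .Kinv v)) ∧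
    (∀ v, ρ .E (ρ .X v) = ρ .X (ρ .E v)) ∧ (∀ v, ρ .E (ρ .Y v) = ρ .Y (ρ .E v)) ∧
    (∀ v, ρ .E (ρ .G v) = ρ .G (ρ .E v)) ∧
    (∀ v, ρ .G (ρ .X v) = ρ .X (ρ .G v) + ρ .X v) ∧
    (∀ v, ρ .G (ρ .Y v) = ρ .Y (ρ .G v) - ρ .Y v) ∧
    (∀ v, ρ .X (ρ .Y v) = h.diff⁻¹ • (ρ .K v - ρ .Kinv v) - ρ .Y (ρ .X v)) ∧
    (∀ v, ρ .X (ρ .X v) = 0) ∧ (∀ v, ρ .Y (ρ .Y v) = 0) ∧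
    (∀ v, Γ (Γ v) = v) ∧ (∀ v, Γ (ρ .E v) = ρ .E (Γ v)) ∧ (∀ v, Γ (ρ .G v) = ρ .G (Γ v)) ∧
    (∀ v, Γ (ρ .K v) = ρ .K (Γ v)) ∧ (∀ v, Γ (ρ .Kinv v) = ρ .Kinv (Γ v)) ∧
    (∀ v, Γ (ρ .X v) = -ρ .X (Γ v)) ∧ (∀ v, Γ (ρ .Y v) = -ρ .Y (Γ v)) := by
  refine ⟨LinearMap.congr_fun o.K_Kinv, LinearMap.congr_fun o.Kinv_K, LinearMap.congr_fun o.K_E,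
    LinearMap.congr_fun o.K_G, LinearMap.congr_fun o.K_X, LinearMap.congr_fun o.K_Y,
    LinearMap.congr_fun (o.comm_Kinv o.K_E), LinearMap.congr_fun (o.comm_Kinv o.K_G),
    LinearMap.congr_fun (o.comm_Kinv o.K_X), LinearMap.congr_fun (o.comm_Kinv o.K_Y),
    LinearMap.congr_fun o.E_X, LinearMap.congr_fun o.E_Y, LinearMap.congr_fun o.E_G,
    LinearMap.congr_fun o.G_X, LinearMap.congr_fun o.G_Y,
    fun v => eq_sub_of_add_eq (LinearMap.congr_fun o.X_Y v), LinearMap.congr_fun o.X_X,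
    LinearMap.congr_fun o.Y_Y, LinearMap.congr_fun o.Γ_Γ, LinearMap.congr_fun o.Γ_E,
    LinearMap.congr_fun o.Γ_G, LinearMap.congr_fun o.Γ_K,
    fun v => (LinearMap.congr_fun (o.comm_Kinv o.Γ_K.symm) v).symm,
    LinearMap.congr_fun o.Γ_X, LinearMap.congr_fun o.Γ_Y⟩

theorem Kinv_apply (o : IsOps h ρ Γ) {e : ℂ} {v : V} (hv : ρ .K v = h.pow e • v) : ρ .Kinv v = h.pow (-e) • v := by
  have h1 := congrArg (ρ .Kinv) hv
  rw [o.pw.2.1, map_smul] at h1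
  rw [h.pow_neg]
  exact ((inv_smul_eq_iff₀ (h.pow_ne_zero e)).2 h1).symm

theorem exists_basis [FiniteDimensional ℂ V] (o : IsOps h ρ Γ) : ∃ (ι : Type) (_ : Fintype ι) (_ : DecidableEq ι)
    (b : Module.Basis ι ℂ V), ∀ i, ∃ e g : ℂ, ρ .E (b i) = e • b i ∧ ρ .G (b i) = g • b i ∧
      ρ .K (b i) = h.pow e • b i := by
  classical
  let b := Module.Basis.ofSpan o.span.ge
  have hf := Module.Finite.finite_basis b
  exact ⟨_, Fintype.ofFinite _, Classical.decEq _, b, fun i =>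
    Module.Basis.ofSpan_subset o.span.ge ⟨i, rfl⟩⟩

end IsOps

section tensor

variable {h : QParam} {V W : Type} [AddCommGroup V] [Module ℂ V] [AddCommGroup W] [Module ℂ W]

/-- The action on a tensor product through the coproduct `ΔX = X ⊗ K⁻¹ + 1 ⊗ X`,
`ΔY = Y ⊗ 1 + K ⊗ Y`, with `E`, `G` primitive and `K` group-like. The involution `Γ` produces the
Koszul signs `(1 ⊗ X)(v ⊗ w) = (-1) ^ |v| v ⊗ X w`. -/
noncomputable def tensorOps (ρ : Gen → Module.End ℂ V) (Γ : Module.End ℂ V)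
    (ρ' : Gen → Module.End ℂ W) : Gen → Module.End ℂ (V ⊗[ℂ] W)
  | .E => map (ρ .E) 1 + map 1 (ρ' .E)
  | .G => map (ρ .G) 1 + map 1 (ρ' .G)
  | .K => map (ρ .K) (ρ' .K)
  | .Kinv => map (ρ .Kinv) (ρ' .Kinv)
  | .X => map (ρ .X) (ρ' .Kinv) + map Γ (ρ' .X)
  | .Y => map (ρ .Y) 1 + map (ρ .K * Γ) (ρ' .Y)

theorem isOps_tensor {ρ : Gen → Module.End ℂ V} {Γ : Module.End ℂ V} (o : IsOps h ρ Γ)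
    {ρ' : Gen → Module.End ℂ W} {Γ' : Module.End ℂ W} (o' : IsOps h ρ' Γ') :
    IsOps h (tensorOps ρ Γ ρ') (map Γ Γ') where
  K_Kinv := TensorProduct.ext' fun v w => by simp [tensorOps, o.pw, o'.pw]
  Kinv_K := TensorProduct.ext' fun v w => by simp [tensorOps, o.pw, o'.pw]
  K_E := TensorProduct.ext' fun v w => by simp [tensorOps, o.pw, o'.pw]
  K_G := TensorProduct.ext' fun v w => by simp [tensorOps, o.pw, o'.pw]
  K_X := TensorProduct.ext' fun v w => by simp [tensorOps, o.pw, o'.pw]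
  K_Y := TensorProduct.ext' fun v w => by simp [tensorOps, o.pw, o'.pw]
  E_X := TensorProduct.ext' fun v w => by simp [tensorOps, o.pw, o'.pw]; abel
  E_Y := TensorProduct.ext' fun v w => by simp [tensorOps, o.pw, o'.pw]; abel
  E_G := TensorProduct.ext' fun v w => by simp [tensorOps, o.pw, o'.pw]; abel
  G_X := TensorProduct.ext' fun v w => by
    simp [tensorOps, o.pw, o'.pw, add_tmul, tmul_add]; abel
  G_Y := TensorProduct.ext' fun v w => by
    simp [tensorOps, o.pw, o'.pw, sub_tmul, tmul_sub]; abel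
  X_Y := TensorProduct.ext' fun v w => by
    simp [tensorOps, o.pw, o'.pw, add_tmul, tmul_add, sub_tmul, tmul_sub, neg_tmul, tmul_neg,
      smul_sub, ← smul_tmul']
    abel
  X_X := TensorProduct.ext' fun v w => by
    simp [tensorOps, o.pw, o'.pw, add_tmul, tmul_add, sub_tmul, tmul_sub, neg_tmul, tmul_neg]
  Y_Y := TensorProduct.ext' fun v w => by
    simp [tensorOps, o.pw, o'.pw, add_tmul, tmul_add, sub_tmul, tmul_sub, neg_tmul, tmul_neg]
  Γ_Γ := TensorProduct.ext' fun v w => by simp [o.pw, o'.pw]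
  Γ_E := TensorProduct.ext' fun v w => by simp [tensorOps, o.pw, o'.pw]
  Γ_G := TensorProduct.ext' fun v w => by simp [tensorOps, o.pw, o'.pw]
  Γ_K := TensorProduct.ext' fun v w => by simp [tensorOps, o.pw, o'.pw]
  Γ_X := TensorProduct.ext' fun v w => by
    simp [tensorOps, o.pw, o'.pw, neg_tmul, tmul_neg]; abel
  Γ_Y := TensorProduct.ext' fun v w => by
    simp [tensorOps, o.pw, o'.pw, neg_tmul, tmul_neg]; abel
  span := by
    rw [eq_top_iff, ← TensorProduct.span_tmul_eq_top, Submodule.span_le]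
    rintro _ ⟨v, w, rfl⟩
    have hv : v ∈ (⊤ : Submodule ℂ V) := trivial
    have hw : w ∈ (⊤ : Submodule ℂ W) := trivial
    rw [← o.span] at hv
    rw [← o'.span] at hw
    induction hv using Submodule.span_induction with
    | zero => simp
    | add x y _ _ hx hy => rw [add_tmul]; exact add_mem hx hy
    | smul a x _ hx => rw [← smul_tmul']; exact Submodule.smul_mem _ _ hx
    | mem v hv =>
      induction hw using Submodule.span_induction with
      | zero => simp
      | add x y _ _ hx hy => rw [tmul_add]; exact add_mem hx hy
      | smul a x _ hx => rw [tmul_smul]; exact Submodule.smul_mem _ _ hx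
      | mem w hw =>
        obtain ⟨e, g, h1, h2, h3⟩ := hv
        obtain ⟨e', g', h1', h2', h3'⟩ := hw
        refine Submodule.subset_span ⟨e + e', g + g', ?_, ?_, ?_⟩
        · simp [tensorOps, h1, h1', add_smul, smul_tmul']
        · simp [tensorOps, h2, h2', add_smul, smul_tmul']
        · simp [tensorOps, h3, h3', h.pow_add, mul_smul, smul_tmul']
          rw [smul_comm]

/-- The action `(x f) v = (-1) ^ (|f| |x|) f (S(x) v)` on the dual, with `S X = -X K`,
`S Y = -Y K⁻¹`, `S E = -E`, `S G = -G`, `S K = K⁻¹`. -/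
noncomputable def dualOps (ρ : Gen → Module.End ℂ V) (Γ : Module.End ℂ V) :
    Gen → Module.End ℂ (Module.Dual ℂ V)
  | .E => -(ρ .E).dualMap
  | .G => -(ρ .G).dualMap
  | .K => (ρ .Kinv).dualMap
  | .Kinv => (ρ .K).dualMap
  | .X => -(Γ * ρ .X * ρ .K : Module.End ℂ V).dualMap
  | .Y => -(Γ * ρ .Y * ρ .Kinv : Module.End ℂ V).dualMap

theorem isOps_dual [FiniteDimensional ℂ V] {ρ : Gen → Module.End ℂ V} {Γ : Module.End ℂ V}
    (o : IsOps h ρ Γ) : IsOps h (dualOps ρ Γ) (LinearMap.dualMap Γ) where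
  K_Kinv := by ext f v; simp [dualOps, o.pw]
  Kinv_K := by ext f v; simp [dualOps, o.pw]
  K_E := by ext f v; simp [dualOps, o.pw]
  K_G := by ext f v; simp [dualOps, o.pw]
  K_X := by ext f v; simp [dualOps, o.pw]
  K_Y := by ext f v; simp [dualOps, o.pw]
  E_X := by ext f v; simp [dualOps, o.pw]
  E_Y := by ext f v; simp [dualOps, o.pw]
  E_G := by ext f v; simp [dualOps, o.pw]
  G_X := by ext f v; simp [dualOps, o.pw]
  G_Y := by ext f v; simp [dualOps, o.pw]; ring
  X_Y := by ext f v; simp [dualOps, o.pw]; ring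
  X_X := by ext f v; simp [dualOps, o.pw]
  Y_Y := by ext f v; simp [dualOps, o.pw]
  Γ_Γ := by ext f v; simp [dualOps, o.pw]
  Γ_E := by ext f v; simp [dualOps, o.pw]
  Γ_G := by ext f v; simp [dualOps, o.pw]
  Γ_K := by ext f v; simp [dualOps, o.pw]
  Γ_X := by ext f v; simp [dualOps, o.pw]
  Γ_Y := by ext f v; simp [dualOps, o.pw]
  span := by
    obtain ⟨ι, _, _, b, hb⟩ := o.exists_basis
    rw [eq_top_iff, ← b.dualBasis.span_eq, Submodule.span_le]
    rintro _ ⟨i, rfl⟩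
    obtain ⟨e, g, h1, h2, h3⟩ := hb i
    refine Submodule.subset_span ⟨-e, -g, b.ext fun j => ?_, b.ext fun j => ?_, b.ext fun j => ?_⟩
    · obtain ⟨e', g', h1', h2', h3'⟩ := hb j
      rcases eq_or_ne i j with rfl | hij
      · simp [dualOps, h1]
      · simp [dualOps, h1', Finsupp.single_apply, hij, hij.symm]
    · obtain ⟨e', g', h1', h2', h3'⟩ := hb j
      rcases eq_or_ne i j with rfl | hij
      · simp [dualOps, h2]
      · simp [dualOps, h2', Finsupp.single_apply, hij, hij.symm]
    · obtain ⟨e', g', h1', h2', h3'⟩ := hb j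
      rcases eq_or_ne i j with rfl | hij
      · simp [dualOps, o.Kinv_apply h3]
      · simp [dualOps, o.Kinv_apply h3', Finsupp.single_apply, hij, hij.symm]

end tensor

namespace WtMod

variable {h : QParam}

/-- Even linear maps which commute with the action. -/
@[ext] structure Hom (V W : WtMod h) where
  toLin : V.carrier →ₗ[ℂ] W.carrier
  op_comm : ∀ x, toLin ∘ₗ V.op x = W.op x ∘ₗ toLin
  Γ_comm : toLin ∘ₗ V.Γ = W.Γ ∘ₗ toLin

theorem Hom.op_apply {V W : WtMod h} (f : Hom V W) (x : Gen) (v : V.carrier) :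
    f.toLin (V.op x v) = W.op x (f.toLin v) := LinearMap.congr_fun (f.op_comm _) v

theorem Hom.Γ_apply {V W : WtMod h} (f : Hom V W) (v : V.carrier) :
    f.toLin (V.Γ v) = W.Γ (f.toLin v) := LinearMap.congr_fun f.Γ_comm v

theorem Hom.act_comm {V W : WtMod h} (f : Hom V W) (u : U h) :
    f.toLin ∘ₗ V.act u = W.act u ∘ₗ f.toLin :=
  U.commute_all h V.act W.act f.toLin (fun x => by simpa [act] using f.op_comm x) u

instance : Category (WtMod h) where
  Hom := Hom
  id V := ⟨LinearMap.id, fun _ => rfl, rfl⟩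
  comp f g := ⟨g.toLin ∘ₗ f.toLin,
    fun u => by rw [LinearMap.comp_assoc, f.op_comm, ← LinearMap.comp_assoc, g.op_comm,
      LinearMap.comp_assoc],
    by rw [LinearMap.comp_assoc, f.Γ_comm, ← LinearMap.comp_assoc, g.Γ_comm,
      LinearMap.comp_assoc]⟩

abbrev lin {V W : WtMod h} (f : V ⟶ W) : V.carrier →ₗ[ℂ] W.carrier := Hom.toLin f

@[ext] theorem hom_ext {V W : WtMod h} {f g : V ⟶ W} (hfg : lin f = lin g) : f = g := Hom.ext hfg

@[simp] theorem lin_id (V : WtMod h) : lin (𝟙 V) = LinearMap.id := rfl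
@[simp] theorem lin_comp {V W Z : WtMod h} (f : V ⟶ W) (g : W ⟶ Z) :
    lin (f ≫ g) = lin g ∘ₗ lin f := rfl

section linear

variable (V W : WtMod h)

def homSubmodule : Submodule ℂ (V.carrier →ₗ[ℂ] W.carrier) where
  carrier := {f | (∀ x : Gen, f ∘ₗ V.op x = W.op x ∘ₗ f) ∧ f ∘ₗ V.Γ = W.Γ ∘ₗ f}
  add_mem' {f g} hf hg := ⟨fun u => by rw [LinearMap.add_comp, LinearMap.comp_add, hf.1, hg.1],
    by rw [LinearMap.add_comp, LinearMap.comp_add, hf.2, hg.2]⟩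
  zero_mem' := ⟨fun u => by simp, by simp⟩
  smul_mem' c f hf := ⟨fun u => by rw [LinearMap.smul_comp, LinearMap.comp_smul, hf.1],
    by rw [LinearMap.smul_comp, LinearMap.comp_smul, hf.2]⟩

def homEquiv : (V ⟶ W) ≃ homSubmodule V W where
  toFun f := ⟨lin f, f.op_comm, f.Γ_comm⟩
  invFun f := ⟨f.1, f.2.1, f.2.2⟩
  left_inv _ := rfl
  right_inv _ := rfl

instance : AddCommGroup (V ⟶ W) := (homEquiv V W).addCommGroup

noncomputable instance : Module ℂ (V ⟶ W) := (homEquiv V W).module ℂ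

variable {V W}

@[simp] theorem lin_zero : lin (0 : V ⟶ W) = 0 := rfl
@[simp] theorem lin_add (f g : V ⟶ W) : lin (f + g) = lin f + lin g := rfl
@[simp] theorem lin_smul (c : ℂ) (f : V ⟶ W) : lin (c • f) = c • lin f := rfl

end linear

instance : Preadditive (WtMod h) where
  homGroup V W := inferInstance
  add_comp _ _ _ _ _ _ := by ext1; simp [LinearMap.comp_add]
  comp_add _ _ _ _ _ _ := by ext1; simp [LinearMap.add_comp]

noncomputable instance : Linear ℂ (WtMod h) where
  homModule V W := inferInstance
  smul_comp _ _ _ _ _ _ := by ext1; simp [LinearMap.comp_smul]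
  comp_smul _ _ _ _ _ _ := by ext1; simp [LinearMap.smul_comp]

def isoOfLinearEquiv {V W : WtMod h} (e : V.carrier ≃ₗ[ℂ] W.carrier)
    (he : ∀ x, e.toLinearMap ∘ₗ V.op x = W.op x ∘ₗ e.toLinearMap)
    (hΓ : e.toLinearMap ∘ₗ V.Γ = W.Γ ∘ₗ e.toLinearMap) : V ≅ W where
  hom := ⟨e.toLinearMap, he, hΓ⟩
  inv := .mk e.symm.toLinearMap
    (fun x => by
      ext w
      obtain ⟨v, rfl⟩ := e.surjective w
      have := LinearMap.congr_fun (he x) v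
      simp only [LinearMap.comp_apply, LinearEquiv.coe_coe] at this
      simp [← this])
    (by
      ext w
      obtain ⟨v, rfl⟩ := e.surjective w
      have := LinearMap.congr_fun hΓ v
      simp only [LinearMap.comp_apply, LinearEquiv.coe_coe] at this
      simp [← this])
  hom_inv_id := hom_ext (LinearMap.ext fun v => e.symm_apply_apply v)
  inv_hom_id := hom_ext (LinearMap.ext fun v => e.apply_symm_apply v)

@[simp] theorem lin_iso_hom {V W : WtMod h} (e : V.carrier ≃ₗ[ℂ] W.carrier) (he hΓ) :
    lin (isoOfLinearEquiv (V := V) (W := W) e he hΓ).hom = e.toLinearMap := rfl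
@[simp] theorem lin_iso_inv {V W : WtMod h} (e : V.carrier ≃ₗ[ℂ] W.carrier) (he hΓ) :
    lin (isoOfLinearEquiv (V := V) (W := W) e he hΓ).inv = e.symm.toLinearMap := rfl

/-- The operators of the one-dimensional modules. -/
noncomputable def epsOps (h : QParam) (e b : ℂ) : Gen → Module.End ℂ ℂ
  | .E => e • 1
  | .G => b • 1
  | .K => h.pow e • 1
  | .Kinv => h.pow (-e) • 1
  | .X => 0
  | .Y => 0

theorem isOps_eps (h : QParam) (e b : ℂ) (p : ZMod 2) (he : h.pow e * h.pow e = 1) :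
    IsOps h (epsOps h e b) (parSign p • 1) where
  K_Kinv := by ext; simp [epsOps, h.pow_neg, h.pow_ne_zero]
  Kinv_K := by ext; simp [epsOps, h.pow_neg, h.pow_ne_zero]
  K_E := by ext; simp [epsOps, mul_comm]
  K_G := by ext; simp [epsOps, mul_comm]
  K_X := by simp [epsOps]
  K_Y := by simp [epsOps]
  E_X := by simp [epsOps]
  E_Y := by simp [epsOps]
  E_G := by ext; simp [epsOps, mul_comm]
  G_X := by simp [epsOps]
  G_Y := by simp [epsOps]
  X_Y := by
    have : h.pow e = h.pow (-e) := by
      rw [h.pow_neg]; exact eq_inv_of_mul_eq_one_left he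
    simp [epsOps, this]
  X_X := by simp [epsOps]
  Y_Y := by simp [epsOps]
  Γ_Γ := by ext; simp [parSign_mul_self]
  Γ_E := by ext; simp [epsOps, mul_comm]
  Γ_G := by ext; simp [epsOps, mul_comm]
  Γ_K := by ext; simp [epsOps, mul_comm]
  Γ_X := by simp [epsOps]
  Γ_Y := by simp [epsOps]
  span := by
    rw [eq_top_iff]
    exact fun v _ => Submodule.subset_span ⟨e, b, by simp [epsOps], by simp [epsOps],
      by simp [epsOps]⟩

/-- The one-dimensional module `ε(e, b)_p`, where `q ^ (2 e) = 1`. -/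
noncomputable def eps (h : QParam) (e b : ℂ) (p : ZMod 2) (he : h.pow e * h.pow e = 1) : WtMod h where
  carrier := ℂ
  op := epsOps h e b
  Γ := parSign p • 1
  isOps := isOps_eps h e b p he

/-- The operators of the quantum Kac module, in the basis `v`, `v'`. -/
noncomputable def kacOps (h : QParam) (α a : ℂ) : Gen → Module.End ℂ (ℂ × ℂ)
  | .E => α • 1
  | .G => LinearMap.prodMap (a • 1) ((a - 1) • 1)
  | .K => h.pow α • 1
  | .Kinv => h.pow (-α) • 1
  | .X => (h.diff⁻¹ * (h.pow α - h.pow (-α))) • LinearMap.inl ℂ ℂ ℂ ∘ₗ LinearMap.snd ℂ ℂ ℂ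
  | .Y => LinearMap.inr ℂ ℂ ℂ ∘ₗ LinearMap.fst ℂ ℂ ℂ

theorem isOps_kac (h : QParam) (α a : ℂ) (p : ZMod 2) :
    IsOps h (kacOps h α a) (LinearMap.prodMap (parSign p • 1) (-parSign p • 1)) where
  K_Kinv := by ext <;> simp [kacOps, h.pow_neg, h.pow_ne_zero]
  Kinv_K := by ext <;> simp [kacOps, h.pow_neg, h.pow_ne_zero]
  K_E := by ext <;> simp [kacOps, mul_comm]
  K_G := by ext <;> simp [kacOps, mul_comm]
  K_X := by ext <;> simp [kacOps, mul_comm]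
  K_Y := by ext <;> simp [kacOps, mul_comm]
  E_X := by ext <;> simp [kacOps, mul_comm]
  E_Y := by ext <;> simp [kacOps, mul_comm]
  E_G := by ext <;> simp [kacOps, mul_comm]
  G_X := by ext <;> simp [kacOps]; ring
  G_Y := by ext <;> simp [kacOps]
  X_Y := by ext <;> simp [kacOps]
  X_X := by ext <;> simp [kacOps]
  Y_Y := by ext <;> simp [kacOps]
  Γ_Γ := by ext <;> simp [kacOps, parSign_mul_self]
  Γ_E := by ext <;> simp [kacOps, mul_comm]
  Γ_G := by ext <;> simp [kacOps, mul_comm]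
  Γ_K := by ext <;> simp [kacOps, mul_comm]
  Γ_X := by ext <;> simp [kacOps, mul_comm]
  Γ_Y := by ext <;> simp [kacOps]
  span := by
    rw [eq_top_iff]
    rintro ⟨x, y⟩ -
    have : ((x, y) : ℂ × ℂ) = (x, 0) + (0, y) := by simp
    rw [this]
    refine add_mem (Submodule.subset_span ⟨α, a, ?_, ?_, ?_⟩)
      (Submodule.subset_span ⟨α, a - 1, ?_, ?_, ?_⟩) <;> simp [kacOps]

/-- The quantum Kac module `V(α, a)_p`, with basis `v` of degree `p` and `v'` of degree `p + 1`. -/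
noncomputable def kac (h : QParam) (α a : ℂ) (p : ZMod 2) : WtMod h where
  carrier := ℂ × ℂ
  op := kacOps h α a
  Γ := LinearMap.prodMap (parSign p • 1) (-parSign p • 1)
  isOps := isOps_kac h α a p

section raw

variable {A B A' B' : Type} [AddCommGroup A] [Module ℂ A] [AddCommGroup B] [Module ℂ B]
  [AddCommGroup A'] [Module ℂ A'] [AddCommGroup B'] [Module ℂ B']
  {ρ : Gen → Module.End ℂ A} {Γ : Module.End ℂ A}
  {σ : Gen → Module.End ℂ B} {Δ : Module.End ℂ B}
  {ρ' : Gen → Module.End ℂ A'} {Γ' : Module.End ℂ A'}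
  {σ' : Gen → Module.End ℂ B'}

theorem raw_map {f : A →ₗ[ℂ] A'} (hf : ∀ x, f ∘ₗ ρ x = ρ' x ∘ₗ f) (hΓ : f ∘ₗ Γ = Γ' ∘ₗ f)
    {g : B →ₗ[ℂ] B'} (hg : ∀ x, g ∘ₗ σ x = σ' x ∘ₗ g) (x : Gen) :
    map f g ∘ₗ tensorOps ρ Γ σ x = tensorOps ρ' Γ' σ' x ∘ₗ map f g := by
  have h1 := fun x v => LinearMap.congr_fun (hf x) v
  have h2 := fun v => LinearMap.congr_fun hΓ v
  have h3 := fun x v => LinearMap.congr_fun (hg x) v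
  simp only [LinearMap.comp_apply] at h1 h2 h3
  refine TensorProduct.ext' fun v w => ?_
  cases x <;> simp [tensorOps, h1, h2, h3]

theorem raw_mapΓ {Δ' : Module.End ℂ B'} {f : A →ₗ[ℂ] A'} (hΓ : f ∘ₗ Γ = Γ' ∘ₗ f)
    {g : B →ₗ[ℂ] B'} (hg : g ∘ₗ Δ = Δ' ∘ₗ g) :
    map f g ∘ₗ map Γ Δ = map Γ' Δ' ∘ₗ map f g := by
  rw [← map_comp, ← map_comp, hΓ, hg]

theorem raw_assoc (_o : IsOps h ρ Γ) (x : Gen) :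
    (TensorProduct.assoc ℂ A B A').toLinearMap ∘ₗ tensorOps (tensorOps ρ Γ σ) (map Γ Δ) ρ' x =
    tensorOps ρ Γ (tensorOps σ Δ ρ') x ∘ₗ (TensorProduct.assoc ℂ A B A').toLinearMap := by
  refine TensorProduct.ext_threefold fun v w z => ?_
  cases x <;> simp [tensorOps, tmul_add, add_tmul, add_assoc, _o.pw]

theorem raw_lid (x : Gen) :
    (TensorProduct.lid ℂ A).toLinearMap ∘ₗ tensorOps (epsOps h 0 0) (parSign 0 • 1) ρ x =
    ρ x ∘ₗ (TensorProduct.lid ℂ A).toLinearMap := by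
  refine TensorProduct.ext' fun v w => ?_
  cases x <;> simp [tensorOps, epsOps, parSign, QParam.pow]

theorem raw_rid (x : Gen) :
    (TensorProduct.rid ℂ A).toLinearMap ∘ₗ tensorOps ρ Γ (epsOps h 0 0) x =
    ρ x ∘ₗ (TensorProduct.rid ℂ A).toLinearMap := by
  refine TensorProduct.ext' fun v w => ?_
  cases x <;> simp [tensorOps, epsOps, QParam.pow]

theorem raw_assocΓ : (TensorProduct.assoc ℂ A B A').toLinearMap ∘ₗ map (map Γ Δ) Γ' =
    map Γ (map Δ Γ') ∘ₗ (TensorProduct.assoc ℂ A B A').toLinearMap :=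
  TensorProduct.ext_threefold fun v w z => by simp

theorem raw_lidΓ : (TensorProduct.lid ℂ A).toLinearMap ∘ₗ map (parSign 0 • 1) Γ =
    Γ ∘ₗ (TensorProduct.lid ℂ A).toLinearMap :=
  TensorProduct.ext' fun v w => by simp [parSign]

theorem raw_ridΓ : (TensorProduct.rid ℂ A).toLinearMap ∘ₗ map Γ (parSign 0 • 1) =
    Γ ∘ₗ (TensorProduct.rid ℂ A).toLinearMap :=
  TensorProduct.ext' fun v w => by simp [parSign]

end raw

noncomputable def tens (V W : WtMod h) : WtMod h where
  carrier := V.carrier ⊗[ℂ] W.carrier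
  op := tensorOps V.op V.Γ W.op
  Γ := map V.Γ W.Γ
  isOps := isOps_tensor V.isOps W.isOps

noncomputable def unit (h : QParam) : WtMod h := eps h 0 0 0 (by simp [h.pow_zero])

noncomputable def tensHom {V W V' W' : WtMod h} (f : V ⟶ V') (g : W ⟶ W') :
    tens V W ⟶ tens V' W' where
  toLin := map (lin f) (lin g)
  op_comm := raw_map (f := lin f) (g := lin g) f.op_comm f.Γ_comm g.op_comm
  Γ_comm := raw_mapΓ (f := lin f) (g := lin g) f.Γ_comm g.Γ_comm

noncomputable instance : MonoidalCategoryStruct (WtMod h) where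
  tensorObj V W := tens V W
  tensorUnit := unit h
  whiskerLeft V _ _ f := tensHom (𝟙 V) f
  whiskerRight f W := tensHom f (𝟙 W)
  tensorHom f g := tensHom f g
  associator V W Z := isoOfLinearEquiv (V := tens (tens V W) Z) (W := tens V (tens W Z))
    (TensorProduct.assoc ℂ V.carrier W.carrier Z.carrier)
    (raw_assoc V.isOps) raw_assocΓ
  leftUnitor V := isoOfLinearEquiv (V := tens (unit h) V) (TensorProduct.lid ℂ V.carrier)
    raw_lid raw_lidΓ
  rightUnitor V := isoOfLinearEquiv (V := tens V (unit h)) (TensorProduct.rid ℂ V.carrier)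
    raw_rid raw_ridΓ

section lins
variable {V W V' W' : WtMod h}
@[simp] theorem lin_tensorHom (f : V ⟶ V') (g : W ⟶ W') :
    lin (f ⊗ₘ g) = map (lin f) (lin g) := rfl
@[simp] theorem lin_whiskerLeft (V : WtMod h) (g : W ⟶ W') :
    lin (V ◁ g) = map LinearMap.id (lin g) := rfl
@[simp] theorem lin_whiskerRight (f : V ⟶ V') (W : WtMod h) :
    lin (f ▷ W) = map (lin f) LinearMap.id := rfl
end lins

noncomputable instance : MonoidalCategory (WtMod h) where
  tensorHom_def f g := hom_ext <| TensorProduct.ext' fun v w => rfl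
  id_tensorHom_id V W := hom_ext <| TensorProduct.ext' fun v w => rfl
  tensorHom_comp_tensorHom _ _ _ _ := hom_ext <| TensorProduct.ext' fun v w => rfl
  whiskerLeft_id _ _ := hom_ext <| TensorProduct.ext' fun v w => rfl
  id_whiskerRight _ _ := hom_ext <| TensorProduct.ext' fun v w => rfl
  associator_naturality _ _ _ := hom_ext <| TensorProduct.ext_threefold fun v w z => rfl
  leftUnitor_naturality f := hom_ext <| TensorProduct.ext' fun (v : ℂ) w => (map_smul (lin f) v w).symm
  rightUnitor_naturality f := hom_ext <| TensorProduct.ext' fun v (w : ℂ) => (map_smul (lin f) w v).symm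
  pentagon _ _ _ _ := hom_ext <| TensorProduct.ext_fourfold fun v w z y => rfl
  triangle V W := hom_ext <| TensorProduct.ext_threefold fun v (w : ℂ) z =>
    (TensorProduct.smul_tmul (R := ℂ) w v z).symm

instance : MonoidalPreadditive (WtMod h) where
  whiskerLeft_zero := hom_ext (map_zero_right _)
  zero_whiskerRight := hom_ext (map_zero_left _)
  whiskerLeft_add _ _ := hom_ext (map_add_right _ _ _)
  add_whiskerRight _ _ := hom_ext (map_add_left _ _ _)

instance : MonoidalLinear ℂ (WtMod h) where
  whiskerLeft_smul _ _ _ _ _ := hom_ext (map_smul_right _ _ _)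
  smul_whiskerRight _ _ _ _ _ := hom_ext (map_smul_left _ _ _)

end WtMod

namespace WtMod
variable {h : QParam}

section raw

variable {A : Type} [AddCommGroup A] [Module ℂ A] [FiniteDimensional ℂ A]
  {ρ : Gen → Module.End ℂ A} {Γ : Module.End ℂ A}

theorem raw_ev (o : IsOps h ρ Γ) (x : Gen) :
    contractLeft ℂ A ∘ₗ tensorOps (dualOps ρ Γ) (LinearMap.dualMap Γ) ρ x =
      epsOps h 0 0 x ∘ₗ contractLeft ℂ A := by
  refine TensorProduct.ext' fun f v => ?_
  cases x <;> simp [tensorOps, dualOps, epsOps, o.pw, h.pow_zero]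

theorem raw_evΓ (o : IsOps h ρ Γ) : contractLeft ℂ A ∘ₗ map (LinearMap.dualMap Γ) Γ =
    (parSign 0 • 1) ∘ₗ contractLeft ℂ A :=
  TensorProduct.ext' fun f v => by simp [parSign, o.pw]

theorem dualTensorHom_map_coev (S T : Module.End ℂ A) :
    dualTensorHom ℂ A A (TensorProduct.comm ℂ _ _ (map S (LinearMap.dualMap T)
      (coevaluation ℂ A 1))) = S * T := by
  ext v
  rw [coevaluation_apply_one]
  simp only [map_sum, map_tmul, comm_tmul, LinearMap.sum_apply, dualTensorHom_apply]
  have := (Module.Basis.ofVectorSpace ℂ A).sum_dual_apply_smul_coord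
  conv_rhs => rw [Module.End.mul_apply, ← (Module.Basis.ofVectorSpace ℂ A).sum_repr (T v), map_sum]
  simp

theorem dualTensorHom_coev :
    dualTensorHom ℂ A A (TensorProduct.comm ℂ _ _ (coevaluation ℂ A 1)) = 1 := by
  have h2 := dualTensorHom_map_coev (1 : Module.End ℂ A) 1
  have h1 : map (1 : Module.End ℂ A) (LinearMap.dualMap (1 : Module.End ℂ A)) = 1 :=
    TensorProduct.ext' fun v f => rfl
  rwa [h1, Module.End.one_apply, one_mul] at h2

theorem coev_inj {s t : A ⊗[ℂ] Module.Dual ℂ A}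
    (hst : dualTensorHom ℂ A A (TensorProduct.comm ℂ _ _ s) =
      dualTensorHom ℂ A A (TensorProduct.comm ℂ _ _ t)) : s = t :=
  (TensorProduct.comm ℂ _ _).injective ((dualTensorHomEquiv ℂ A A).injective (by simpa using hst))

theorem raw_coev (o : IsOps h ρ Γ) (x : Gen) :
    coevaluation ℂ A ∘ₗ epsOps h 0 0 x =
      tensorOps ρ Γ (dualOps ρ Γ) x ∘ₗ coevaluation ℂ A := by
  refine LinearMap.ext_ring (coev_inj ?_)
  have h1 : (1 : Module.End ℂ (Module.Dual ℂ A)) = LinearMap.dualMap 1 := rfl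
  have h2 := dualTensorHom_coev (A := A)
  have h3 : ∀ S T : Module.End ℂ A, map S (-LinearMap.dualMap T) =
    - map S (LinearMap.dualMap T) := fun S T =>
      TensorProduct.ext' fun v f => by simp [tmul_neg]
  cases x <;> simp only [LinearMap.comp_apply, tensorOps, dualOps, epsOps, h1, h3,
    LinearMap.add_apply, LinearMap.neg_apply, map_add, map_neg, dualTensorHom_map_coev] <;>
    ext v <;> simp [o.pw, h.pow_zero, h2]

theorem raw_coevΓ (o : IsOps h ρ Γ) : coevaluation ℂ A ∘ₗ (parSign 0 • 1) =
    map Γ (LinearMap.dualMap Γ) ∘ₗ coevaluation ℂ A := by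
  refine LinearMap.ext_ring (coev_inj ?_)
  have h2 := dualTensorHom_coev (A := A)
  have h1 : (1 : Module.End ℂ (Module.Dual ℂ A)) = LinearMap.dualMap 1 := rfl
  simp only [LinearMap.comp_apply, dualTensorHom_map_coev]
  ext v
  simp [o.pw, parSign, h2]

end raw

noncomputable def dual (V : WtMod h) : WtMod h where
  carrier := Module.Dual ℂ V.carrier
  op := dualOps V.op V.Γ
  Γ := LinearMap.dualMap V.Γ
  isOps := isOps_dual V.isOps

noncomputable def evalHom (V : WtMod h) : tens (dual V) V ⟶ unit h where
  toLin := contractLeft ℂ V.carrier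
  op_comm := raw_ev V.isOps
  Γ_comm := raw_evΓ V.isOps

noncomputable def coevHom (V : WtMod h) : unit h ⟶ tens V (dual V) where
  toLin := coevaluation ℂ V.carrier
  op_comm := raw_coev V.isOps
  Γ_comm := raw_coevΓ V.isOps

noncomputable instance (V : WtMod h) : HasRightDual V where
  rightDual := dual V
  exact := {
    coevaluation' := coevHom V
    evaluation' := evalHom V
    coevaluation_evaluation' := hom_ext (contractLeft_assoc_coevaluation ℂ V.carrier)
    evaluation_coevaluation' := hom_ext (contractLeft_assoc_coevaluation' ℂ V.carrier) }

noncomputable instance : RightRigidCategory (WtMod h) where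

end WtMod

/-- `v` is a homogeneous vector of weight `(e, g)` and with parity sign `s`. -/
structure HW (h : QParam) {A : Type} [AddCommGroup A] [Module ℂ A]
    (ρ : Gen → Module.End ℂ A) (Γ : Module.End ℂ A) (v : A) (e g s : ℂ) : Prop where
  E : ρ .E v = e • v
  G : ρ .G v = g • v
  K : ρ .K v = h.pow e • v
  Kinv : ρ .Kinv v = (h.pow e)⁻¹ • v
  Γ : Γ v = s • v
  sq : s = 1 ∨ s = -1

section
variable {h : QParam} {A B D : Type} [AddCommGroup A] [Module ℂ A]
  [AddCommGroup B] [Module ℂ B] [AddCommGroup D] [Module ℂ D]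
  {ρ : Gen → Module.End ℂ A} {Γ : Module.End ℂ A}
  {σ : Gen → Module.End ℂ B} {Δ : Module.End ℂ B}
  {κ : Gen → Module.End ℂ D} {Λ : Module.End ℂ D}

theorem HW.X {v : A} {e g s : ℂ} (hv : HW h ρ Γ v e g s) (o : IsOps h ρ Γ) :
    HW h ρ Γ (ρ .X v) e (g + 1) (-s) where
  E := by rw [o.pw.2.2.2.2.2.2.2.2.2.2.1, hv.E, map_smul]
  G := by simp [o.pw, hv.G, add_smul]
  K := by simp [o.pw, hv.K]
  Kinv := by simp [o.pw, hv.Kinv]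
  Γ := by simp [o.pw, hv.Γ]
  sq := by rcases hv.sq with h | h <;> simp [h]

theorem HW.Y {v : A} {e g s : ℂ} (hv : HW h ρ Γ v e g s) (o : IsOps h ρ Γ) :
    HW h ρ Γ (ρ .Y v) e (g - 1) (-s) where
  E := by simp [o.pw, hv.E]
  G := by simp [o.pw, hv.G, sub_smul]
  K := by simp [o.pw, hv.K]
  Kinv := by simp [o.pw, hv.Kinv]
  Γ := by simp [o.pw, hv.Γ]
  sq := by rcases hv.sq with h | h <;> simp [h]

theorem HW.tmul {v : A} {e g s : ℂ} (hv : HW h ρ Γ v e g s)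
    {w : B} {e' g' s' : ℂ} (hw : HW h σ Δ w e' g' s') :
    HW h (tensorOps ρ Γ σ) (map Γ Δ) (v ⊗ₜ w) (e + e') (g + g') (s * s') where
  E := by simp [tensorOps, hv.E, hw.E, add_smul, smul_tmul']
  G := by simp [tensorOps, hv.G, hw.G, add_smul, smul_tmul']
  K := by simp [tensorOps, hv.K, hw.K, h.pow_add, mul_smul, smul_tmul']; rw [smul_comm]
  Kinv := by simp [tensorOps, hv.Kinv, hw.Kinv, h.pow_add, mul_smul, smul_tmul']
  Γ := by simp [hv.Γ, hw.Γ, mul_smul, smul_tmul']; rw [smul_comm]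
  sq := by rcases hv.sq with h | h <;> rcases hw.sq with h' | h' <;> simp [h, h']

theorem IsOps.span_HW (o : IsOps h ρ Γ) :
    Submodule.span ℂ {v | ∃ e g s, HW h ρ Γ v e g s} = ⊤ := by
  rw [eq_top_iff, ← o.span, Submodule.span_le]
  rintro v ⟨e, g, h1, h2, h3⟩
  have h4 := o.Kinv_apply h3
  rw [h.pow_neg] at h4
  have hv : v = (2 : ℂ)⁻¹ • (v + Γ v) + (2 : ℂ)⁻¹ • (v - Γ v) := by module
  rw [hv]
  refine add_mem (Submodule.smul_mem _ _ (Submodule.subset_span ⟨e, g, 1, ?_⟩))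
    (Submodule.smul_mem _ _ (Submodule.subset_span ⟨e, g, -1, ?_⟩))
  · constructor
    · simp [← o.pw.2.2.2.2.2.2.2.2.2.2.2.2.2.2.2.2.2.2.2.1, h1]
    · simp [← o.pw.2.2.2.2.2.2.2.2.2.2.2.2.2.2.2.2.2.2.2.2.1, h2]
    · simp [← o.pw.2.2.2.2.2.2.2.2.2.2.2.2.2.2.2.2.2.2.2.2.2.1, h3]
    · simp [← o.pw.2.2.2.2.2.2.2.2.2.2.2.2.2.2.2.2.2.2.2.2.2.2.1, h4]
    · simp [o.pw, add_comm]
    · exact Or.inl rfl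
  · constructor
    · simp [← o.pw.2.2.2.2.2.2.2.2.2.2.2.2.2.2.2.2.2.2.2.1, h1, smul_sub]
    · simp [← o.pw.2.2.2.2.2.2.2.2.2.2.2.2.2.2.2.2.2.2.2.2.1, h2, smul_sub]
    · simp [← o.pw.2.2.2.2.2.2.2.2.2.2.2.2.2.2.2.2.2.2.2.2.2.1, h3, smul_sub]
    · simp [← o.pw.2.2.2.2.2.2.2.2.2.2.2.2.2.2.2.2.2.2.2.2.2.2.1, h4, smul_sub]
    · simp [o.pw]
    · exact Or.inr rfl

theorem ext_HW (o : IsOps h ρ Γ) {M : Type} [AddCommGroup M] [Module ℂ M] {F F' : A →ₗ[ℂ] M}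
    (hF : ∀ v e g s, HW h ρ Γ v e g s → F v = F' v) : F = F' :=
  LinearMap.ext_on o.span_HW (by rintro v ⟨e, g, s, hv⟩; exact hF v e g s hv)

theorem ext_HW2 (o : IsOps h ρ Γ) (o' : IsOps h σ Δ) {M : Type} [AddCommGroup M] [Module ℂ M]
    {F F' : A ⊗[ℂ] B →ₗ[ℂ] M}
    (hF : ∀ v e g s, HW h ρ Γ v e g s → ∀ w e' g' s', HW h σ Δ w e' g' s' →
      F (v ⊗ₜ w) = F' (v ⊗ₜ w)) : F = F' := by
  refine TensorProduct.ext (ext_HW o fun v e g s hv => ext_HW o' fun w e' g' s' hw => ?_)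
  exact hF v e g s hv w e' g' s' hw

theorem ext_HW3 (o : IsOps h ρ Γ) (o' : IsOps h σ Δ) (o'' : IsOps h κ Λ)
    {M : Type} [AddCommGroup M] [Module ℂ M] {F F' : (A ⊗[ℂ] B) ⊗[ℂ] D →ₗ[ℂ] M}
    (hF : ∀ v e g s, HW h ρ Γ v e g s → ∀ w e' g' s', HW h σ Δ w e' g' s' →
      ∀ z e'' g'' s'', HW h κ Λ z e'' g'' s'' →
      F (v ⊗ₜ w ⊗ₜ z) = F' (v ⊗ₜ w ⊗ₜ z)) : F = F' := by
  refine TensorProduct.ext (ext_HW2 o o' fun v e g s hv w e' g' s' hw => ext_HW o''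
    fun z e'' g'' s'' hz => ?_)
  exact hF v e g s hv w e' g' s' hw z e'' g'' s'' hz

/-- The symmetry `v ⊗ w ↦ (-1) ^ (|v| |w|) w ⊗ v` of super vector spaces. -/
noncomputable def superSwap (Γ : Module.End ℂ A) (Δ : Module.End ℂ B) :
    A ⊗[ℂ] B →ₗ[ℂ] B ⊗[ℂ] A :=
  (TensorProduct.comm ℂ A B).toLinearMap ∘ₗ
    ((2 : ℂ)⁻¹ • (map 1 1 + map Γ 1 + map 1 Δ - map Γ Δ))

/-- The braiding: first `v ⊗ w ↦ q ^ (-λ_E μ_G - λ_G μ_E) v ⊗ w` on vectors of weights `λ`, `μ`,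
then multiplication by `1 + (q - q⁻¹) (X ⊗ Y) (K ⊗ K⁻¹)`, then the super symmetry. -/
noncomputable def braidMap (h : QParam) (ρ : Gen → Module.End ℂ A) (Γ : Module.End ℂ A)
    (σ : Gen → Module.End ℂ B) (Δ : Module.End ℂ B) : A ⊗[ℂ] B →ₗ[ℂ] B ⊗[ℂ] A :=
  superSwap Γ Δ ∘ₗ (1 + h.diff • map (ρ .X * ρ .K * Γ) (σ .Y * σ .Kinv)) ∘ₗ
    qpow h (-(map (ρ .E) (σ .G) + map (ρ .G) (σ .E)))

/-- The inverse braiding. -/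
noncomputable def braidInv (h : QParam) (ρ : Gen → Module.End ℂ A) (Γ : Module.End ℂ A)
    (σ : Gen → Module.End ℂ B) (Δ : Module.End ℂ B) : B ⊗[ℂ] A →ₗ[ℂ] A ⊗[ℂ] B :=
  qpow h (map (ρ .E) (σ .G) + map (ρ .G) (σ .E)) ∘ₗ
    (1 - h.diff • map (ρ .X * ρ .K * Γ) (σ .Y * σ .Kinv)) ∘ₗ superSwap Δ Γ

theorem superSwap_apply {v : A} {e g s : ℂ} (hv : HW h ρ Γ v e g s)
    {w : B} {e' g' s' : ℂ} (hw : HW h σ Δ w e' g' s') :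
    superSwap Γ Δ (v ⊗ₜ w) = ((1 + s + s' - s * s') / 2) • w ⊗ₜ[ℂ] v := by
  simp [superSwap, hv.Γ, hw.Γ, ← smul_tmul', smul_smul]
  module

variable [FiniteDimensional ℂ A] [FiniteDimensional ℂ B]

theorem braidMap_apply (o : IsOps h ρ Γ) (o' : IsOps h σ Δ)
    {v : A} {e g s : ℂ} (hv : HW h ρ Γ v e g s)
    {w : B} {e' g' s' : ℂ} (hw : HW h σ Δ w e' g' s') :
    braidMap h ρ Γ σ Δ (v ⊗ₜ w) =
      ((h.pow (e * g'))⁻¹ * (h.pow (g * e'))⁻¹ * ((1 + s + s' - s * s') / 2)) • w ⊗ₜ[ℂ] v +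
      ((h.pow (e * g'))⁻¹ * (h.pow (g * e'))⁻¹ *
        (h.diff * s * h.pow e * (h.pow e')⁻¹ * ((1 - s - s' - s * s') / 2))) •
        (σ .Y w) ⊗ₜ[ℂ] (ρ .X v) := by
  have h1 : (-(map (ρ .E) (σ .G) + map (ρ .G) (σ .E))) (v ⊗ₜ[ℂ] w) =
    (-(e * g') + -(g * e')) • v ⊗ₜ[ℂ] w := by
    simp [hv.E, hw.G, hv.G, hw.E, ← smul_tmul', smul_smul]
    module
  rw [braidMap, LinearMap.comp_apply, LinearMap.comp_apply, qpow_apply h h1]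
  simp only [map_smul, LinearMap.add_apply, Module.End.one_apply, LinearMap.smul_apply, map_tmul,
    Module.End.mul_apply, hv.Γ, hv.K, hw.Kinv, map_add, ← smul_tmul', tmul_smul,
    superSwap_apply hv hw, superSwap_apply (hv.X o) (hw.Y o'), h.pow_add, h.pow_neg, smul_add,
    smul_smul]
  module

theorem braidInv_apply (o : IsOps h ρ Γ) (o' : IsOps h σ Δ)
    {v : A} {e g s : ℂ} (hv : HW h ρ Γ v e g s)
    {w : B} {e' g' s' : ℂ} (hw : HW h σ Δ w e' g' s') :
    braidInv h ρ Γ σ Δ (w ⊗ₜ v) =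
      (h.pow (e * g') * (h.pow (g * e')) * ((1 + s + s' - s * s') / 2)) • v ⊗ₜ[ℂ] w -
      (h.pow (e * (g' - 1)) * (h.pow ((g + 1) * e')) *
        (h.diff * s * h.pow e * (h.pow e')⁻¹ * ((1 + s + s' - s * s') / 2))) •
        (ρ .X v) ⊗ₜ[ℂ] (σ .Y w) := by
  have h1 : ∀ {v : A} {e g s : ℂ} (hv : HW h ρ Γ v e g s)
    {w : B} {e' g' s' : ℂ} (hw : HW h σ Δ w e' g' s'),
    ((map (ρ .E) (σ .G) + map (ρ .G) (σ .E))) (v ⊗ₜ[ℂ] w) =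
    ((e * g') + (g * e')) • v ⊗ₜ[ℂ] w := by
    intro v e g s hv w e' g' s' hw
    simp [hv.E, hw.G, hv.G, hw.E, ← smul_tmul', smul_smul]
    module
  rw [braidInv, LinearMap.comp_apply, LinearMap.comp_apply]
  simp only [map_smul, LinearMap.sub_apply, Module.End.one_apply, LinearMap.smul_apply, map_tmul,
    Module.End.mul_apply, hv.Γ, hv.K, hw.Kinv, map_sub, ← smul_tmul', tmul_smul,
    superSwap_apply hw hv, qpow_apply h (h1 hv hw), qpow_apply h (h1 (hv.X o) (hw.Y o')),
    h.pow_add, h.pow_neg, smul_add, smul_smul]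
  module

end

section
variable {h : QParam} {A B D : Type} [AddCommGroup A] [Module ℂ A]
  [AddCommGroup B] [Module ℂ B] [AddCommGroup D] [Module ℂ D]
  {ρ : Gen → Module.End ℂ A} {Γ : Module.End ℂ A}
  {σ : Gen → Module.End ℂ B} {Δ : Module.End ℂ B}
  {κ : Gen → Module.End ℂ D} {Λ : Module.End ℂ D}
  [FiniteDimensional ℂ A] [FiniteDimensional ℂ B] [FiniteDimensional ℂ D]

theorem QParam.pow_sub (h : QParam) (a b : ℂ) : h.pow (a - b) = h.pow a * (h.pow b)⁻¹ := by
  rw [sub_eq_add_neg, h.pow_add, h.pow_neg]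

theorem braidMap_op (o : IsOps h ρ Γ) (o' : IsOps h σ Δ) (x : Gen) :
    braidMap h ρ Γ σ Δ ∘ₗ tensorOps ρ Γ σ x = tensorOps σ Δ ρ x ∘ₗ braidMap h ρ Γ σ Δ := by
  refine ext_HW2 o o' fun v e g s hv w e' g' s' hw => ?_
  have hd := h.diff_ne_zero
  have p1 := h.pow_ne_zero e
  have p2 := h.pow_ne_zero e'
  have p3 := h.pow_ne_zero (e * g')
  have p4 := h.pow_ne_zero (g * e')
  have hX := hv.X o
  have hX' := hw.X o'
  have hY := hv.Y o
  have hY' := hw.Y o'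
  cases x <;>
  simp only [LinearMap.comp_apply, braidMap_apply o o' hv hw, map_add, map_smul, tensorOps,
      LinearMap.add_apply, map_tmul, hv.E, hw.E, hv.G, hw.G, hv.K, hw.K, hv.Kinv, hw.Kinv,
      hv.Γ, hw.Γ, hX.E, hX.G, hX.K, hX.Kinv, hX.Γ, hY'.E, hY'.G, hY'.K, hY'.Kinv, hY'.Γ,
      Module.End.one_apply, Module.End.mul_apply, ← smul_tmul', tmul_smul, smul_smul,
      braidMap_apply o o' hX hw, braidMap_apply o o' hY hw, braidMap_apply o o' hv hX',
      braidMap_apply o o' hv hY', o.pw.2.2.2.2.2.2.2.2.2.2.2.2.2.2.2.2.1,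
      o'.pw.2.2.2.2.2.2.2.2.2.2.2.2.2.2.2.2.2.1,
      o.pw.2.2.2.2.2.2.2.2.2.2.2.2.2.2.2.1, o'.pw.2.2.2.2.2.2.2.2.2.2.2.2.2.2.2.1,
      o.pw.2.2.2.2.2.2.2.2.2.2.2.2.2.2.2.2.1,
      sub_tmul, tmul_sub, smul_sub, smul_zero, tmul_zero, zero_tmul, mul_add, mul_sub, add_mul,
      sub_mul, one_mul, mul_one, h.pow_add, h.pow_sub, mul_inv]
  all_goals
    rcases hv.sq with rfl | rfl <;> rcases hw.sq with rfl | rfl <;>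
    match_scalars <;> field_simp <;> ring_nf

theorem braidMap_Γ (o : IsOps h ρ Γ) (o' : IsOps h σ Δ) :
    braidMap h ρ Γ σ Δ ∘ₗ map Γ Δ = map Δ Γ ∘ₗ braidMap h ρ Γ σ Δ := by
  refine ext_HW2 o o' fun v e g s hv w e' g' s' hw => ?_
  simp only [LinearMap.comp_apply, braidMap_apply o o' hv hw, map_add, map_smul,
      map_tmul, hv.Γ, hw.Γ, (hv.X o).Γ, (hw.Y o').Γ, ← smul_tmul', tmul_smul, smul_smul]
  module

theorem HW.map {v : A} {e g s : ℂ} (hv : HW h ρ Γ v e g s) {f : A →ₗ[ℂ] B}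
    (hf : ∀ x, f ∘ₗ ρ x = σ x ∘ₗ f) (hΓ : f ∘ₗ Γ = Δ ∘ₗ f) : HW h σ Δ (f v) e g s where
  E := by rw [← LinearMap.comp_apply, ← hf, LinearMap.comp_apply, hv.E, map_smul]
  G := by rw [← LinearMap.comp_apply, ← hf, LinearMap.comp_apply, hv.G, map_smul]
  K := by rw [← LinearMap.comp_apply, ← hf, LinearMap.comp_apply, hv.K, map_smul]
  Kinv := by rw [← LinearMap.comp_apply, ← hf, LinearMap.comp_apply, hv.Kinv, map_smul]
  Γ := by rw [← LinearMap.comp_apply, ← hΓ, LinearMap.comp_apply, hv.Γ, map_smul]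
  sq := hv.sq

theorem braidMap_natural {A' B' : Type} [AddCommGroup A'] [Module ℂ A'] [AddCommGroup B']
    [Module ℂ B'] [FiniteDimensional ℂ A'] [FiniteDimensional ℂ B']
    {ρ' : Gen → Module.End ℂ A'} {Γ' : Module.End ℂ A'}
    {σ' : Gen → Module.End ℂ B'} {Δ' : Module.End ℂ B'}
    (o : IsOps h ρ Γ) (o' : IsOps h σ Δ) (p : IsOps h ρ' Γ') (p' : IsOps h σ' Δ')
    {f : A →ₗ[ℂ] A'} (hf : ∀ x, f ∘ₗ ρ x = ρ' x ∘ₗ f) (hΓ : f ∘ₗ Γ = Γ' ∘ₗ f)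
    {g : B →ₗ[ℂ] B'} (hg : ∀ x, g ∘ₗ σ x = σ' x ∘ₗ g) (hΓ' : g ∘ₗ Δ = Δ' ∘ₗ g) :
    braidMap h ρ' Γ' σ' Δ' ∘ₗ TensorProduct.map f g =
      TensorProduct.map g f ∘ₗ braidMap h ρ Γ σ Δ := by
  refine ext_HW2 o o' fun v e a s hv w e' a' s' hw => ?_
  have h1 : f (ρ .X v) = ρ' .X (f v) := LinearMap.congr_fun (hf .X) v
  have h2 : g (σ .Y w) = σ' .Y (g w) := LinearMap.congr_fun (hg .Y) w
  simp only [LinearMap.comp_apply, braidMap_apply o o' hv hw, map_add, map_smul,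
      map_tmul, h1, h2, braidMap_apply p p' (hv.map hf hΓ) (hw.map hg hΓ')]

theorem braidMap_left_inv (o : IsOps h ρ Γ) (o' : IsOps h σ Δ) :
    braidInv h ρ Γ σ Δ ∘ₗ braidMap h ρ Γ σ Δ = LinearMap.id := by
  refine ext_HW2 o o' fun v e g s hv w e' g' s' hw => ?_
  have hd := h.diff_ne_zero
  have p1 := h.pow_ne_zero e
  have p2 := h.pow_ne_zero e'
  have p3 := h.pow_ne_zero (e * g')
  have p4 := h.pow_ne_zero (g * e')
  simp only [LinearMap.comp_apply, braidMap_apply o o' hv hw, map_add, map_smul,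
      braidInv_apply o o' hv hw, braidInv_apply o o' (hv.X o) (hw.Y o'), LinearMap.id_apply,
      o.pw.2.2.2.2.2.2.2.2.2.2.2.2.2.2.2.2.1, zero_tmul, smul_zero, h.pow_add, h.pow_sub,
      mul_add, mul_sub, add_mul, sub_mul, one_mul, mul_one]
  rcases hv.sq with rfl | rfl <;> rcases hw.sq with rfl | rfl <;>
    match_scalars <;> field_simp <;> ring_nf

theorem braidMap_right_inv (o : IsOps h ρ Γ) (o' : IsOps h σ Δ) :
    braidMap h ρ Γ σ Δ ∘ₗ braidInv h ρ Γ σ Δ = LinearMap.id := by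
  refine ext_HW2 o' o fun w e' g' s' hw v e g s hv => ?_
  have hd := h.diff_ne_zero
  have p1 := h.pow_ne_zero e
  have p2 := h.pow_ne_zero e'
  have p3 := h.pow_ne_zero (e * g')
  have p4 := h.pow_ne_zero (g * e')
  simp only [LinearMap.comp_apply, braidMap_apply o o' hv hw, map_add, map_sub, map_smul,
      braidInv_apply o o' hv hw, braidMap_apply o o' (hv.X o) (hw.Y o'), LinearMap.id_apply,
      o.pw.2.2.2.2.2.2.2.2.2.2.2.2.2.2.2.2.1, tmul_zero, smul_zero, h.pow_add, h.pow_sub,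
      mul_add, mul_sub, add_mul, sub_mul, one_mul, mul_one]
  rcases hv.sq with rfl | rfl <;> rcases hw.sq with rfl | rfl <;>
    match_scalars <;> field_simp <;> ring_nf

theorem braidMap_hexagon_left (o : IsOps h ρ Γ) (o' : IsOps h σ Δ) (o'' : IsOps h κ Λ) :
    (TensorProduct.assoc ℂ B D A).toLinearMap ∘ₗ
      braidMap h ρ Γ (tensorOps σ Δ κ) (TensorProduct.map Δ Λ) ∘ₗ
      (TensorProduct.assoc ℂ A B D).toLinearMap =
    TensorProduct.map LinearMap.id (braidMap h ρ Γ κ Λ) ∘ₗ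
      (TensorProduct.assoc ℂ B A D).toLinearMap ∘ₗ
      TensorProduct.map (braidMap h ρ Γ σ Δ) LinearMap.id := by
  refine ext_HW3 o o' o'' fun v e g s hv w e' g' s' hw z e'' g'' s'' hz => ?_
  have p1 := h.pow_ne_zero e
  have p2 := h.pow_ne_zero e'
  have p3 := h.pow_ne_zero (e * g')
  have p4 := h.pow_ne_zero (g * e')
  have p5 := h.pow_ne_zero e''
  have p6 := h.pow_ne_zero (e * g'')
  have p7 := h.pow_ne_zero (g * e'')
  simp only [LinearMap.comp_apply, LinearEquiv.coe_coe, TensorProduct.assoc_tmul,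
    braidMap_apply o (isOps_tensor o' o'') hv (hw.tmul hz), map_tmul, LinearMap.id_apply,
    braidMap_apply o o' hv hw, add_tmul, map_add, map_smul, ← smul_tmul', tmul_smul, tmul_add,
    braidMap_apply o o'' hv hz, braidMap_apply o o'' (hv.X o) hz, tensorOps,
    LinearMap.add_apply, Module.End.mul_apply, Module.End.one_apply, hw.Γ, hw.K,
    o.pw.2.2.2.2.2.2.2.2.2.2.2.2.2.2.2.2.1, tmul_zero, smul_zero, smul_smul, h.pow_add,
    mul_add, add_mul, one_mul, mul_one, smul_add, add_zero]
  rcases hv.sq with rfl | rfl <;> rcases hw.sq with rfl | rfl <;> rcases hz.sq with rfl | rfl <;>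
    match_scalars <;> field_simp <;> ring_nf

theorem braidMap_hexagon_right (o : IsOps h ρ Γ) (o' : IsOps h σ Δ) (o'' : IsOps h κ Λ) :
    braidMap h (tensorOps ρ Γ σ) (TensorProduct.map Γ Δ) κ Λ =
    (TensorProduct.assoc ℂ D A B).toLinearMap ∘ₗ
      TensorProduct.map (braidMap h ρ Γ κ Λ) LinearMap.id ∘ₗ
      (TensorProduct.assoc ℂ A D B).symm.toLinearMap ∘ₗ
      TensorProduct.map LinearMap.id (braidMap h σ Δ κ Λ) ∘ₗ
      (TensorProduct.assoc ℂ A B D).toLinearMap := by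
  refine ext_HW3 o o' o'' fun v e g s hv w e' g' s' hw z e'' g'' s'' hz => ?_
  have p1 := h.pow_ne_zero e
  have p2 := h.pow_ne_zero e'
  have p3 := h.pow_ne_zero (e * g'')
  have p4 := h.pow_ne_zero (g * e'')
  have p5 := h.pow_ne_zero e''
  have p6 := h.pow_ne_zero (e' * g'')
  have p7 := h.pow_ne_zero (g' * e'')
  simp only [LinearMap.comp_apply, LinearEquiv.coe_coe, TensorProduct.assoc_tmul,
    TensorProduct.assoc_symm_tmul,
    braidMap_apply (isOps_tensor o o') o'' (hv.tmul hw) hz, map_tmul, LinearMap.id_apply,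
    braidMap_apply o' o'' hw hz, add_tmul, map_add, map_smul, ← smul_tmul', tmul_smul, tmul_add,
    braidMap_apply o o'' hv hz, braidMap_apply o o'' hv (hz.Y o''), tensorOps,
    LinearMap.add_apply, Module.End.mul_apply, Module.End.one_apply, hv.Γ, hw.Kinv,
    o''.pw.2.2.2.2.2.2.2.2.2.2.2.2.2.2.2.2.2.1, zero_tmul, smul_zero, smul_smul, h.pow_add,
    mul_sub, h.pow_sub,
    mul_add, add_mul, one_mul, mul_one, smul_add, add_zero]
  rcases hv.sq with rfl | rfl <;> rcases hw.sq with rfl | rfl <;> rcases hz.sq with rfl | rfl <;>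
    match_scalars <;> field_simp <;> ring_nf

end

section
variable {h : QParam} {A B D : Type} [AddCommGroup A] [Module ℂ A]
  [AddCommGroup B] [Module ℂ B] [AddCommGroup D] [Module ℂ D]
  {ρ : Gen → Module.End ℂ A} {Γ : Module.End ℂ A}
  {σ : Gen → Module.End ℂ B} {Δ : Module.End ℂ B}
  {κ : Gen → Module.End ℂ D} {Λ : Module.End ℂ D}
  [FiniteDimensional ℂ A] [FiniteDimensional ℂ B] [FiniteDimensional ℂ D]

theorem braidMap_hexagon_right' (o : IsOps h ρ Γ) (o' : IsOps h σ Δ) (o'' : IsOps h κ Λ) :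
    (TensorProduct.assoc ℂ D A B).symm.toLinearMap ∘ₗ
      braidMap h (tensorOps ρ Γ σ) (TensorProduct.map Γ Δ) κ Λ ∘ₗ
      (TensorProduct.assoc ℂ A B D).symm.toLinearMap =
      TensorProduct.map (braidMap h ρ Γ κ Λ) LinearMap.id ∘ₗ
      (TensorProduct.assoc ℂ A D B).symm.toLinearMap ∘ₗ
      TensorProduct.map LinearMap.id (braidMap h σ Δ κ Λ) := by
  rw [braidMap_hexagon_right o o' o'']
  ext x
  simp

/-- The twist `q ^ (-2 E G) (K - (q - q⁻¹) Y X)`. -/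
noncomputable def twistMap (h : QParam) (ρ : Gen → Module.End ℂ A) : Module.End ℂ A :=
  qpow h (-(2 : ℂ) • (ρ .E * ρ .G)) * (ρ .K - h.diff • (ρ .Y * ρ .X))

/-- The inverse twist. -/
noncomputable def twistInv (h : QParam) (ρ : Gen → Module.End ℂ A) : Module.End ℂ A :=
  qpow h ((2 : ℂ) • (ρ .E * ρ .G)) * (ρ .Kinv + h.diff • (ρ .Y * ρ .X))

theorem HW.YX {v : A} {e g s : ℂ} (hv : HW h ρ Γ v e g s) (o : IsOps h ρ Γ) :
    HW h ρ Γ (ρ .Y (ρ .X v)) e g s := by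
  simpa using (hv.X o).Y o

theorem twistMap_apply (o : IsOps h ρ Γ) {v : A} {e g s : ℂ} (hv : HW h ρ Γ v e g s) :
    twistMap h ρ v = ((h.pow (e * g))⁻¹ * (h.pow (e * g))⁻¹ * h.pow e) • v -
      ((h.pow (e * g))⁻¹ * (h.pow (e * g))⁻¹ * h.diff) • ρ .Y (ρ .X v) := by
  have h1 : ∀ v, HW h ρ Γ v e g s →
      (-(2 : ℂ) • (ρ .E * ρ .G)) v = (-(e * g) + -(e * g)) • v := fun v hv => by
    simp [hv.E, hv.G]; module
  have h2 := qpow_apply h (h1 _ hv)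
  have h3 := qpow_apply h (h1 _ (hv.YX o))
  simp only [twistMap, Module.End.mul_apply, LinearMap.sub_apply, LinearMap.smul_apply, map_sub,
    map_smul, hv.K, h2, h3, h.pow_add, h.pow_neg]
  module

theorem twistInv_apply (o : IsOps h ρ Γ) {v : A} {e g s : ℂ} (hv : HW h ρ Γ v e g s) :
    twistInv h ρ v = ((h.pow (e * g)) * (h.pow (e * g)) * (h.pow e)⁻¹) • v +
      ((h.pow (e * g)) * (h.pow (e * g)) * h.diff) • ρ .Y (ρ .X v) := by
  have h1 : ∀ v, HW h ρ Γ v e g s →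
      ((2 : ℂ) • (ρ .E * ρ .G)) v = ((e * g) + (e * g)) • v := fun v hv => by
    simp [hv.E, hv.G]; module
  have h2 := qpow_apply h (h1 _ hv)
  have h3 := qpow_apply h (h1 _ (hv.YX o))
  simp only [twistInv, Module.End.mul_apply, LinearMap.add_apply, LinearMap.smul_apply, map_add,
    map_smul, hv.Kinv, h2, h3, h.pow_add, h.pow_neg]
  module

theorem YXYX (o : IsOps h ρ Γ) {v : A} {e g s : ℂ} (hv : HW h ρ Γ v e g s) :
    ρ .Y (ρ .X (ρ .Y (ρ .X v))) = (h.diff⁻¹ * (h.pow e - (h.pow e)⁻¹)) • ρ .Y (ρ .X v) := by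
  rw [o.pw.2.2.2.2.2.2.2.2.2.2.2.2.2.2.2.1, (hv.X o).K, (hv.X o).Kinv,
    o.pw.2.2.2.2.2.2.2.2.2.2.2.2.2.2.2.2.1]
  simp
  module

theorem twistMap_right_inv (o : IsOps h ρ Γ) : twistMap h ρ * twistInv h ρ = 1 := by
  refine ext_HW o fun v e g s hv => ?_
  have hd := h.diff_ne_zero
  have p1 := h.pow_ne_zero e
  have p4 := h.pow_ne_zero (e * g)
  simp only [Module.End.mul_apply, twistInv_apply o hv, map_add, map_smul, twistMap_apply o hv,
    twistMap_apply o (hv.YX o), YXYX o hv, Module.End.one_apply]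
  match_scalars <;> field_simp <;> ring_nf

theorem twistMap_left_inv (o : IsOps h ρ Γ) : twistInv h ρ * twistMap h ρ = 1 := by
  refine ext_HW o fun v e g s hv => ?_
  have hd := h.diff_ne_zero
  have p1 := h.pow_ne_zero e
  have p4 := h.pow_ne_zero (e * g)
  simp only [Module.End.mul_apply, twistMap_apply o hv, map_sub, map_smul, twistInv_apply o hv,
    twistInv_apply o (hv.YX o), YXYX o hv, Module.End.one_apply]
  match_scalars <;> field_simp <;> ring_nf

theorem twistMap_natural (o : IsOps h ρ Γ) (o' : IsOps h σ Δ) {f : A →ₗ[ℂ] B}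
    (hf : ∀ x, f ∘ₗ ρ x = σ x ∘ₗ f) (hΓ : f ∘ₗ Γ = Δ ∘ₗ f) :
    f ∘ₗ twistMap h ρ = twistMap h σ ∘ₗ f := by
  refine ext_HW o fun v e g s hv => ?_
  have h1 : ∀ v, f (ρ .X v) = σ .X (f v) := LinearMap.congr_fun (hf .X)
  have h2 : ∀ v, f (ρ .Y v) = σ .Y (f v) := LinearMap.congr_fun (hf .Y)
  simp only [LinearMap.comp_apply, twistMap_apply o hv, twistMap_apply o' (hv.map hf hΓ), map_sub,
    map_smul, h1, h2]

theorem twistMap_op (o : IsOps h ρ Γ) (x : Gen) :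
    twistMap h ρ ∘ₗ ρ x = ρ x ∘ₗ twistMap h ρ := by
  refine ext_HW o fun v e g s hv => ?_
  have hd := h.diff_ne_zero
  have p1 := h.pow_ne_zero e
  have p4 := h.pow_ne_zero (e * g)
  have hX := hv.X o
  have hY := hv.Y o
  have hYX := hv.YX o
  cases x <;>
  simp only [LinearMap.comp_apply, twistMap_apply o hv, map_sub, map_smul, hv.E, hv.G, hv.K,
    hv.Kinv, hYX.E, hYX.G, hYX.K, hYX.Kinv, twistMap_apply o hX, twistMap_apply o hY,
    o.pw.2.2.2.2.2.2.2.2.2.2.2.2.2.2.2.2.1, o.pw.2.2.2.2.2.2.2.2.2.2.2.2.2.2.2.2.2.1,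
    o.pw.2.2.2.2.2.2.2.2.2.2.2.2.2.2.2.1, hX.K, hX.Kinv, map_zero, smul_zero, mul_add, mul_sub,
    mul_one, h.pow_add, h.pow_sub, smul_sub, smul_smul] <;>
  match_scalars <;> field_simp <;> ring_nf

theorem twistMap_Γ (o : IsOps h ρ Γ) : twistMap h ρ ∘ₗ Γ = Γ ∘ₗ twistMap h ρ := by
  refine ext_HW o fun v e g s hv => ?_
  simp only [LinearMap.comp_apply, hv.Γ, map_smul, twistMap_apply o hv, map_sub, (hv.YX o).Γ]
  module

theorem twistMap_tensor (o : IsOps h ρ Γ) (o' : IsOps h σ Δ) :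
    twistMap h (tensorOps ρ Γ σ) = braidMap h σ Δ ρ Γ ∘ₗ braidMap h ρ Γ σ Δ ∘ₗ
      TensorProduct.map (twistMap h ρ) (twistMap h σ) := by
  refine ext_HW2 o o' fun v e g s hv w e' g' s' hw => ?_
  have hd := h.diff_ne_zero
  have p1 := h.pow_ne_zero e
  have p2 := h.pow_ne_zero e'
  have p3 := h.pow_ne_zero (e * g')
  have p4 := h.pow_ne_zero (g * e')
  have p5 := h.pow_ne_zero (e * g)
  have p6 := h.pow_ne_zero (e' * g')
  have e1 : h.pow (e' * g) = h.pow (g * e') := by rw [mul_comm]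
  have e2 : h.pow (g' * e) = h.pow (e * g') := by rw [mul_comm]
  have hv' := hv.YX o
  have hw' := hw.YX o'
  simp only [twistMap_apply (isOps_tensor o o') (hv.tmul hw), LinearMap.comp_apply, map_tmul,
    twistMap_apply o hv, twistMap_apply o' hw, sub_tmul, tmul_sub, ← smul_tmul', tmul_smul,
    map_sub, map_smul, tensorOps, LinearMap.add_apply, map_add, Module.End.one_apply,
    Module.End.mul_apply, hv.Γ, hw.Kinv, (hv.X o).K, (hv.X o).Γ, (hw.Y o').Kinv, (hw.X o').Kinv, (hw.X o').K,
    (hv.X o).Kinv, hv.K, hv'.K, hw'.K, hv'.Kinv, hw'.Kinv, hw.K, hv.Kinv,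
    braidMap_apply o o' hv hw, braidMap_apply o o' hv hw', braidMap_apply o o' hv' hw,
    braidMap_apply o o' hv' hw',
    braidMap_apply o' o hw hv, braidMap_apply o' o hw hv', braidMap_apply o' o hw' hv,
    braidMap_apply o' o hw' hv',
    braidMap_apply o' o (hw.Y o') (hv.X o),
    o.pw.2.2.2.2.2.2.2.2.2.2.2.2.2.2.2.2.1, o.pw.2.2.2.2.2.2.2.2.2.2.2.2.2.2.2.2.2.1,
    o.pw.2.2.2.2.2.2.2.2.2.2.2.2.2.2.2.1,
    o'.pw.2.2.2.2.2.2.2.2.2.2.2.2.2.2.2.2.1, o'.pw.2.2.2.2.2.2.2.2.2.2.2.2.2.2.2.2.2.1,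
    o'.pw.2.2.2.2.2.2.2.2.2.2.2.2.2.2.2.1, map_zero, tmul_zero, zero_tmul, smul_zero, smul_add,
    smul_sub, smul_smul, add_mul, mul_add, mul_sub, sub_mul, h.pow_add, h.pow_sub, mul_one,
    one_mul, e1, e2]
  rcases hv.sq with rfl | rfl <;> rcases hw.sq with rfl | rfl <;>
    match_scalars <;> field_simp <;> ring_nf

theorem twistMap_dual (o : IsOps h ρ Γ) :
    twistMap h (dualOps ρ Γ) = LinearMap.dualMap (twistMap h ρ) := by
  have od := isOps_dual o
  have hd := h.diff_ne_zero
  refine ext_HW od fun f e g s hf => ext_HW o fun v e' g' s' hv => ?_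
  have p1 := h.pow_ne_zero e
  have hE := LinearMap.congr_fun hf.E v
  have hG := LinearMap.congr_fun hf.G v
  have hG' := LinearMap.congr_fun hf.G (ρ .Y (ρ .X v))
  have hE' := LinearMap.congr_fun hf.E (ρ .Y (ρ .X v))
  simp only [dualOps, LinearMap.neg_apply, LinearMap.dualMap_apply, hv.E, map_smul,
    LinearMap.smul_apply, smul_eq_mul, hv.G, (hv.YX o).E, (hv.YX o).G] at hE hG hE' hG'
  rw [twistMap_apply od hf, LinearMap.dualMap_apply, twistMap_apply o hv]
  have a1 : (-e' - e) * f v = 0 := by linear_combination hE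
  have a2 : (-g' - g) * f v = 0 := by linear_combination hG
  have a3 : (-e' - e) * f (ρ .Y (ρ .X v)) = 0 := by linear_combination hE'
  have a4 : (-g' - g) * f (ρ .Y (ρ .X v)) = 0 := by linear_combination hG'
  by_cases hz : f v = 0 ∧ f (ρ .Y (ρ .X v)) = 0
  · simp [dualOps, hz.1, hz.2, o.pw, hv.K, hv.Kinv]
  · have he : e = -e' := by
      rcases mul_eq_zero.1 a1 with h1 | h1
      · linear_combination -h1
      · rcases mul_eq_zero.1 a3 with h3 | h3
        · linear_combination -h3
        · exact absurd ⟨h1, h3⟩ hz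
    have hg : g = -g' := by
      rcases mul_eq_zero.1 a2 with h1 | h1
      · linear_combination -h1
      · rcases mul_eq_zero.1 a4 with h3 | h3
        · linear_combination -h3
        · exact absurd ⟨h1, h3⟩ hz
    subst he hg
    have p2 := h.pow_ne_zero e'
    have p3 := h.pow_ne_zero (e' * g')
    have hY := hv.Y o
    have hX := hv.X o
    simp only [dualOps, o.pw, hv.K, hv.Kinv, hX.K, hX.Kinv, hY.K, hY.Kinv, LinearMap.sub_apply,
      LinearMap.smul_apply, LinearMap.neg_apply, LinearMap.dualMap_apply, Module.End.mul_apply,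
      map_smul, map_neg, map_sub, smul_eq_mul, h.pow_neg, neg_mul_neg, neg_neg]
    field_simp
    ring

end

namespace WtMod
variable {h : QParam}

noncomputable def braid (V W : WtMod h) : tens V W ≅ tens W V where
  hom := .mk (braidMap h V.op V.Γ W.op W.Γ) (braidMap_op V.isOps W.isOps)
    (braidMap_Γ V.isOps W.isOps)
  inv := .mk (braidInv h V.op V.Γ W.op W.Γ)
    (fun x => by
      have h1 := braidMap_op V.isOps W.isOps x
      have h2 := braidMap_left_inv V.isOps W.isOps
      have h3 := braidMap_right_inv V.isOps W.isOps
      change braidInv h V.op V.Γ W.op W.Γ ∘ₗ tensorOps W.op W.Γ V.op x =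
        tensorOps V.op V.Γ W.op x ∘ₗ braidInv h V.op V.Γ W.op W.Γ
      rw [← LinearMap.comp_id (braidInv h V.op V.Γ W.op W.Γ ∘ₗ _), ← h3,
        LinearMap.comp_assoc, ← LinearMap.comp_assoc (f := braidInv _ _ _ _ _), ← h1,
        ← LinearMap.comp_assoc, ← LinearMap.comp_assoc, h2,
        LinearMap.id_comp])
    (by
      have h1 := braidMap_Γ V.isOps W.isOps
      have h2 := braidMap_left_inv V.isOps W.isOps
      have h3 := braidMap_right_inv V.isOps W.isOps
      change braidInv h V.op V.Γ W.op W.Γ ∘ₗ map W.Γ V.Γ =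
        map V.Γ W.Γ ∘ₗ braidInv h V.op V.Γ W.op W.Γ
      rw [← LinearMap.comp_id (braidInv h V.op V.Γ W.op W.Γ ∘ₗ _), ← h3,
        LinearMap.comp_assoc, ← LinearMap.comp_assoc (f := braidInv _ _ _ _ _), ← h1,
        ← LinearMap.comp_assoc, ← LinearMap.comp_assoc, h2,
        LinearMap.id_comp])
  hom_inv_id := hom_ext (braidMap_left_inv V.isOps W.isOps)
  inv_hom_id := hom_ext (braidMap_right_inv V.isOps W.isOps)

noncomputable instance : BraidedCategory (WtMod h) where
  braiding := braid
  braiding_naturality_right V _ _ f := hom_ext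
    (braidMap_natural V.isOps (WtMod.isOps _) V.isOps (WtMod.isOps _) (f := LinearMap.id) (g := lin f)
      (fun _ => rfl) rfl f.op_comm f.Γ_comm)
  braiding_naturality_left f W := hom_ext
    (braidMap_natural (WtMod.isOps _) W.isOps (WtMod.isOps _) W.isOps (f := lin f) (g := LinearMap.id)
      f.op_comm f.Γ_comm (fun _ => rfl) rfl)
  hexagon_forward U V W := hom_ext (LinearMap.ext fun x =>
    LinearMap.congr_fun (braidMap_hexagon_left U.isOps V.isOps W.isOps) x)
  hexagon_reverse U V W := hom_ext (LinearMap.ext fun x =>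
    LinearMap.congr_fun (braidMap_hexagon_right' U.isOps V.isOps W.isOps) x)

noncomputable def theta (V : WtMod h) : V ≅ V where
  hom := .mk (twistMap h V.op) (twistMap_op V.isOps) (twistMap_Γ V.isOps)
  inv := .mk (twistInv h V.op)
    (fun x => by
      have h1 := twistMap_op V.isOps x
      have h2 := twistMap_left_inv V.isOps
      have h3 := twistMap_right_inv V.isOps
      change twistInv h V.op * V.op x = V.op x * twistInv h V.op
      change twistMap h V.op * V.op x = V.op x * twistMap h V.op at h1
      rw [← mul_one (twistInv h V.op * _), ← h3, mul_assoc, ← mul_assoc (V.op x), ← h1,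
        ← mul_assoc, ← mul_assoc, h2, one_mul])
    (by
      have h1 := twistMap_Γ V.isOps
      have h2 := twistMap_left_inv V.isOps
      have h3 := twistMap_right_inv V.isOps
      change twistInv h V.op * V.Γ = V.Γ * twistInv h V.op
      change twistMap h V.op * V.Γ = V.Γ * twistMap h V.op at h1
      rw [← mul_one (twistInv h V.op * _), ← h3, mul_assoc, ← mul_assoc V.Γ, ← h1,
        ← mul_assoc, ← mul_assoc, h2, one_mul])
  hom_inv_id := hom_ext (twistMap_left_inv V.isOps)
  inv_hom_id := hom_ext (twistMap_right_inv V.isOps)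

theorem raw_mate {A : Type} [AddCommGroup A] [Module ℂ A] [FiniteDimensional ℂ A]
    (T : Module.End ℂ A) (f : Module.Dual ℂ A) :
    TensorProduct.lid ℂ (Module.Dual ℂ A) (map (contractLeft ℂ A) LinearMap.id
      ((TensorProduct.assoc ℂ (Module.Dual ℂ A) A (Module.Dual ℂ A)).symm
        (map LinearMap.id (map T LinearMap.id) (map LinearMap.id (coevaluation ℂ A)
          ((TensorProduct.rid ℂ (Module.Dual ℂ A)).symm f))))) = LinearMap.dualMap T f := by
  rw [TensorProduct.rid_symm_apply, map_tmul, coevaluation_apply_one]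
  simp only [tmul_sum, map_sum, map_tmul, LinearMap.id_apply, TensorProduct.assoc_symm_tmul,
    contractLeft_apply, TensorProduct.lid_tmul]
  exact (Module.Basis.ofVectorSpace ℂ A).sum_dual_apply_smul_coord (LinearMap.dualMap T f)

theorem lin_mate {V : WtMod h} (f : V ⟶ V) : lin (rightAdjointMate f) = LinearMap.dualMap (lin f) := by
  refine LinearMap.ext fun φ => ?_
  rw [rightAdjointMate, lin_comp, lin_comp, lin_comp, lin_comp, lin_comp]
  exact raw_mate (lin f) φ

noncomputable instance : RelMod.RibbonCategory (WtMod h) where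
  twist := theta
  twist_naturality {V W} f :=
    hom_ext (twistMap_natural V.isOps W.isOps f.op_comm f.Γ_comm).symm
  twist_tensor V W := hom_ext (by
    refine (show lin (theta (tens V W)).hom = _ from twistMap_tensor V.isOps W.isOps).trans ?_
    rfl)
  twist_dual V := hom_ext ((twistMap_dual V.isOps).trans (lin_mate (theta V).hom).symm)

theorem raw_evR {A : Type} [AddCommGroup A] [Module ℂ A] [FiniteDimensional ℂ A]
    {ρ : Gen → Module.End ℂ A} {Γ : Module.End ℂ A} (o : IsOps h ρ Γ) :
    contractLeft ℂ A ∘ₗ braidMap h ρ Γ (dualOps ρ Γ) (LinearMap.dualMap Γ) ∘ₗ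
      map (twistMap h ρ) LinearMap.id =
    contractLeft ℂ A ∘ₗ (TensorProduct.comm ℂ A (Module.Dual ℂ A)).toLinearMap ∘ₗ
      map (Γ * ρ .K) LinearMap.id := by
  have od := isOps_dual o
  have hd := h.diff_ne_zero
  refine ext_HW2 o od fun v e' g' s' hv f e g s hf => ?_
  have p1 := h.pow_ne_zero e
  have hX := hv.X o
  have hYX := hv.YX o
  have hE := LinearMap.congr_fun hf.E v
  have hG := LinearMap.congr_fun hf.G v
  have hS := LinearMap.congr_fun hf.Γ v
  have hG' := LinearMap.congr_fun hf.G (ρ .Y (ρ .X v))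
  have hE' := LinearMap.congr_fun hf.E (ρ .Y (ρ .X v))
  have hS' := LinearMap.congr_fun hf.Γ (ρ .Y (ρ .X v))
  simp only [dualOps, LinearMap.neg_apply, LinearMap.dualMap_apply, hv.E, map_smul, hv.Γ, hYX.Γ,
    LinearMap.smul_apply, smul_eq_mul, hv.G, hYX.E, hYX.G] at hE hG hE' hG' hS hS'
  simp only [LinearMap.comp_apply, map_tmul, LinearMap.id_apply, twistMap_apply o hv, sub_tmul,
    map_sub, braidMap_apply o od hv hf, braidMap_apply o od hYX hf, ← smul_tmul', map_smul, map_add,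
    contractLeft_apply, LinearEquiv.coe_coe, TensorProduct.comm_tmul, Module.End.mul_apply, hv.K,
    hv.Γ, dualOps, LinearMap.neg_apply, LinearMap.dualMap_apply, hX.Kinv, map_neg,
    (hX.Y o).Γ, YXYX o hv, smul_eq_mul, (hYX.X o).Kinv, ((hYX.X o).Y o).Γ]
  by_cases hz : f v = 0 ∧ f (ρ .Y (ρ .X v)) = 0
  · simp [hz.1, hz.2]
  · have he : e = -e' := by
      by_contra hne
      refine hz ⟨?_, ?_⟩
      · exact (mul_eq_zero.1 (show (e + e') * f v = 0 by linear_combination -hE)).resolve_left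
          fun h0 => hne (by linear_combination h0)
      · exact (mul_eq_zero.1 (show (e + e') * f _ = 0 by linear_combination -hE')).resolve_left
          fun h0 => hne (by linear_combination h0)
    have hg : g = -g' := by
      by_contra hne
      refine hz ⟨?_, ?_⟩
      · exact (mul_eq_zero.1 (show (g + g') * f v = 0 by linear_combination -hG)).resolve_left
          fun h0 => hne (by linear_combination h0)
      · exact (mul_eq_zero.1 (show (g + g') * f _ = 0 by linear_combination -hG')).resolve_left
          fun h0 => hne (by linear_combination h0)
    have hs : s = s' := by
      by_contra hne
      refine hz ⟨?_, ?_⟩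
      · exact (mul_eq_zero.1 (show (s - s') * f v = 0 by linear_combination -hS)).resolve_left
          fun h0 => hne (by linear_combination h0)
      · refine (mul_eq_zero.1 (show (s - s') * f (ρ .Y (ρ .X v)) = 0 by
          linear_combination -hS')).resolve_left fun h0 => hne (by linear_combination h0)
    subst he hg hs
    have p2 := h.pow_ne_zero e'
    have p3 := h.pow_ne_zero (e' * g')
    have e1 : h.pow (g' * -e') = (h.pow (e' * g'))⁻¹ := by rw [← h.pow_neg]; congr 1; ring
    have e2 : h.pow (e' * -g') = (h.pow (e' * g'))⁻¹ := by rw [← h.pow_neg]; congr 1; ring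
    simp only [e1, e2, h.pow_neg]
    rcases hv.sq with rfl | rfl <;> field_simp <;> ring

/-- The right evaluation is the super evaluation twisted by `K`. -/
theorem evR_tmul (V : WtMod h) (v : V.carrier) (f : Module.Dual ℂ V.carrier) :
    lin (RelMod.evR V) (v ⊗ₜ[ℂ] f : V.carrier ⊗[ℂ] Module.Dual ℂ V.carrier) =
      f (V.Γ (V.op .K v)) :=
  LinearMap.congr_fun (raw_evR V.isOps) (v ⊗ₜ f)

end WtMod

/-- The parameter `ħ = 2 π i / r`, so that `q = exp (2 π i / r)`. -/
noncomputable def root (r : ℕ) (hr : 3 ≤ r) : QParam where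
  hbar := 2 * Real.pi * Complex.I / r
  ne_one h := by
    have := (Complex.isPrimitiveRoot_exp r (by omega)).pow_ne_one_of_pos_of_lt
      one_ne_zero (by omega : 1 < r)
    exact this (by rw [pow_one]; exact h)
  ne_neg_one h := by
    have := (Complex.isPrimitiveRoot_exp r (by omega)).pow_ne_one_of_pos_of_lt
      two_ne_zero (by omega : 2 < r)
    exact this (by rw [h]; norm_num)

theorem root_pow (r : ℕ) (hr : 3 ≤ r) (n : ℤ) : (root r hr).pow (n * r) = 1 := by
  have : (r : ℂ) ≠ 0 := by
    exact_mod_cast (by omega : r ≠ 0)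
  have h : 2 * Real.pi * Complex.I / r * (n * r) = n * (2 * Real.pi * Complex.I) := by
    field_simp
  rw [QParam.pow, root, h, Complex.exp_int_mul_two_pi_mul_I]

/-- The group `ℂ/ℤ`. -/
abbrev CmodZ : Type := ℂ ⧸ AddSubgroup.zmultiples (1 : ℂ)

/-- The full subcategory of modules all of whose weights are congruent to `g`. -/
def weightDegree (h : QParam) (g : CmodZ × CmodZ) : ObjectProperty (WtMod h) := fun V =>
  ∀ (e b : ℂ) (v : V.carrier), v ≠ 0 → V.op .E v = e • v → V.op .G v = b • v →
    ((e : CmodZ), (b : CmodZ)) = g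

/-- `(n, n', p) ↦ ε(n r, n' r)_p`. -/
noncomputable def sigma (r : ℕ) (hr : 3 ≤ r) :
    Discrete (ℤ × ℤ × ZMod 2) ⥤ WtMod (root r hr) :=
  Discrete.functor fun z => WtMod.eps (root r hr) (z.1 * r) (z.2.1 * r) z.2.2
    (by rw [root_pow, one_mul])

/-- The modules `V(α₀ + i, a₀ + j)_0` with `0 ≤ i, j < r`, for the lift `(α₀, a₀)` of `g`. -/
noncomputable def generic (r : ℕ) (hr : 3 ≤ r) (lift : CmodZ × CmodZ → ℂ × ℂ)
    (g : CmodZ × CmodZ) (i : Fin r × Fin r) : WtMod (root r hr) :=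
  WtMod.kac (root r hr) ((lift g).1 + (i.1 : ℕ)) ((lift g).2 + (i.2 : ℕ)) 0

/-- The set of all `(ᾱ, ā)` with `ᾱ` the class of `0` or of `1/2`. -/
def critical : Set (CmodZ × CmodZ) :=
  {g | g.1 = ((0 : ℂ) : CmodZ) ∨ g.1 = ((1 / 2 : ℂ) : CmodZ)}

/-- The relative modular structure on the category of weight modules, for a monoidal structure of
`sigma`, a modified trace `t` and a choice of lifts. -/
noncomputable def relData (r : ℕ) (hr : 3 ≤ r) (lift : CmodZ × CmodZ → ℂ × ℂ)
    (mon : (sigma r hr).Monoidal) (t : ModifiedTrace ℂ (projectives (WtMod (root r hr)))) :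
    RelData ℂ (WtMod (root r hr)) (CmodZ × CmodZ) (ℤ × ℤ × ZMod 2) where
  deg := weightDegree (root r hr)
  σ := sigma r hr
  monoidal := mon
  t := t
  I _ := Fin r × Fin r
  fintype _ := inferInstance
  Θ := generic r hr lift

end GL11

/-!
The algebra is small enough for everything to be read off from weight vectors: `E`, `G` and `K` act
by scalars on them, and `X² = Y² = 0`.

*Projective modules and the modified trace.* If `f` is a linear map between modules which preserves
weights and parities, its average `[X, [Y, f]]` is a morphism of modules (`avgHom`). A module `V` is
projective if and only if the identity of `V` is the average of some `φ` (`projectives_iff`). Averaging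
is self-adjoint for the super trace (`superTrace_mul_avg`), so that `f ↦ str (φ f)` does not depend on
`φ` and is cyclic. As `φ ⊗ K` has average `1` on `V ⊗ W`, it is compatible with partial traces, and
`modifiedTrace` is a modified trace. Its value on `V(α, a)` is `(q ^ α - q ^ (-α))⁻¹`.

*Domination.* In a basis of weight vectors `φ` is a sum of maps of rank one. The average of such a map
factors through an induced module, and even through a Kac module if `[e] ≠ 0` for all weights `e`
(`isDominatedBy_ind`, `isDominatedBy_kac`). The latter holds in all degrees outside of the critical set
(`typical_of_notMem_critical`), where the Kac modules are therefore simple, projective and dominating.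
In arbitrary degrees an indecomposable projective module is a retract of one of these modules, by the
Fitting lemma (`exists_retract_of_isDominatedBy`). An induced module with `[e] = 0` has no non-trivial
idempotent endomorphism (`idem_ind`), and neither has a Kac module. This gives all indecomposable
projective modules (`exists_iso_projCover`), which form finitely many orbits in each degree under the
tensor product with the modules `ε(n r, n' r)`.

*Loops.* A loop coloured by `V(α, a)` acts on a vector of weight `(e, g)` by
`q ^ (-2 (e a + g α)) ((q - q⁻¹) q ^ e (q ^ α - q ^ (-α)) YX - q ^ α q ^ e (q ^ e - q ^ (-e)))`, by a
computation with the braiding (`lin_posLoop_kac`). The factor `q ^ α - q ^ (-α)` of the first term is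
cancelled by the modified dimension of `V(α, a)`. Now sum over the `r²` modules of a generic degree.
Since `r` is odd, `q²` is a primitive `r`-th root of unity and the sums over `a` and `α` are geometric.
For the stabilisation coefficients the sum over `a` selects the only `α` with `q ^ α = q ^ e`, and the
result is the twist, up to the factor `∓ r` (`sum_resonance`, `stabilisation_minus`,
`stabilisation_plus`). For the modularity parameter the weights of `V_i ⊗ V_j*` are integral, and the
sum is `r² (q - q⁻¹) YX` on weights divisible by `r` and zero otherwise (`lin_kirby`). For `i = j` the
operator `YX` is the composition of evaluation and coevaluation times `-[α]`, and for `i ≠ j` it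
vanishes on the vectors in question (`modularity_diag`, `modularity_off_diag`).
-/

namespace GL11

open CategoryTheory MonoidalCategory TensorProduct RelMod

/-! ### Weight vectors, weight projections and weight maps -/

namespace WtMod
variable {h : QParam}

/-- `v` is a homogeneous vector of `V` of weight `(e, g)` and parity sign `s`. -/
abbrev IsWt (V : WtMod h) (v : V.carrier) (e g s : ℂ) : Prop := HW h V.op V.Γ v e g s

theorem isWt_of_E_G_Γ {V : WtMod h} {v : V.carrier} {e g s : ℂ} (hE : V.op .E v = e • v)
    (hG : V.op .G v = g • v) (hΓ : V.Γ v = s • v) (hs : s = 1 ∨ s = -1) : V.IsWt v e g s where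
  E := hE
  G := hG
  K := V.isOps.K_weight hE
  Kinv := by rw [V.isOps.Kinv_apply (V.isOps.K_weight hE), h.pow_neg]
  Γ := hΓ
  sq := hs

theorem X_X_apply (V : WtMod h) (v : V.carrier) : V.op .X (V.op .X v) = 0 :=
  LinearMap.congr_fun V.isOps.X_X v

theorem Y_Y_apply (V : WtMod h) (v : V.carrier) : V.op .Y (V.op .Y v) = 0 :=
  LinearMap.congr_fun V.isOps.Y_Y v

theorem exists_weightBasis (V : WtMod h) : ∃ (n : ℕ) (b : Module.Basis (Fin n) ℂ V.carrier)
    (e g s : Fin n → ℂ), ∀ i, V.IsWt (b i) (e i) (g i) (s i) := by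
  classical
  let b := Module.Basis.ofSpan V.isOps.span_HW.ge
  have hf := Module.Finite.finite_basis b
  let f := (Finite.equivFin _ : _ ≃ Fin (Nat.card ((linearIndepOn_empty ℂ id).extend
    (Set.empty_subset {v | ∃ e g s, V.IsWt v e g s}))))
  have hb : ∀ i, ∃ e g s, V.IsWt (b.reindex f i) e g s := fun i =>
    by
      rw [Module.Basis.reindex_apply]
      exact Module.Basis.ofSpan_subset V.isOps.span_HW.ge ⟨f.symm i, rfl⟩
  choose e g s hegs using hb
  exact ⟨_, b.reindex f, e, g, s, hegs⟩

/-- A weight vector is a combination of the members of the same weight of a weight basis. -/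
theorem weight_eq_of_repr_ne_zero {V : WtMod h} {n : ℕ} {b : Module.Basis (Fin n) ℂ V.carrier}
    {e' g' s' : Fin n → ℂ} (hb : ∀ i, V.IsWt (b i) (e' i) (g' i) (s' i)) {v : V.carrier} {e g s : ℂ}
    (hv : V.IsWt v e g s) {i : Fin n} (hi : b.repr v i ≠ 0) : e' i = e ∧ g' i = g ∧ s' i = s := by
  have key : ∀ {T : Module.End ℂ V.carrier} {c : Fin n → ℂ} {z : ℂ}, (∀ i, T (b i) = c i • b i) →
      T v = z • v → c i = z := by
    intro T c z hT hz
    have h1 : b.coord i ∘ₗ T = c i • b.coord i := by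
      refine b.ext fun j => ?_
      rcases eq_or_ne j i with rfl | hij
      · simp [hT]
      · simp [hT, Finsupp.single_apply, hij]
    have h2 := LinearMap.congr_fun h1 v
    simp only [LinearMap.comp_apply, hz, map_smul, LinearMap.smul_apply, smul_eq_mul,
      Module.Basis.coord_apply] at h2
    exact (mul_right_cancel₀ hi h2).symm
  exact ⟨key (fun i => (hb i).E) hv.E, key (fun i => (hb i).G) hv.G, key (fun i => (hb i).Γ) hv.Γ⟩

/-- The sum of the weight spaces of `V` with weights in `S` is the range of this projection; the
remaining weight spaces form its kernel. -/
noncomputable def weightProj (V : WtMod h) (S : Set (ℂ × ℂ × ℂ)) : Module.End ℂ V.carrier :=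
  open Classical in
  let hb := V.exists_weightBasis.choose_spec
  let b := hb.choose
  b.constr ℂ fun i => if (hb.choose_spec.choose i, hb.choose_spec.choose_spec.choose i,
    hb.choose_spec.choose_spec.choose_spec.choose i) ∈ S then b i else 0

open Classical in
theorem weightProj_apply {V : WtMod h} (S : Set (ℂ × ℂ × ℂ)) {v : V.carrier} {e g s : ℂ}
    (hv : V.IsWt v e g s) : V.weightProj S v = if (e, g, s) ∈ S then v else 0 := by
  obtain ⟨n, b, e', g', s', hb, hP⟩ : ∃ (n : ℕ) (b : Module.Basis (Fin n) ℂ V.carrier)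
      (e' g' s' : Fin n → ℂ) (_ : ∀ i, V.IsWt (b i) (e' i) (g' i) (s' i)),
      V.weightProj S = b.constr ℂ fun i => if (e' i, g' i, s' i) ∈ S then b i else 0 :=
    ⟨_, _, _, _, _, V.exists_weightBasis.choose_spec.choose_spec.choose_spec.choose_spec.choose_spec,
      rfl⟩
  have hc : ∀ i, b.repr v i ≠ 0 → (e' i, g' i, s' i) = (e, g, s) := fun i hi => by
    obtain ⟨h1, h2, h3⟩ := weight_eq_of_repr_ne_zero hb hv hi
    rw [h1, h2, h3]
  rw [hP, Module.Basis.constr_apply_fintype]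
  have hc' : ∀ i, (b.equivFun v i • if (e' i, g' i, s' i) ∈ S then b i else 0) =
      if (e, g, s) ∈ S then b.repr v i • b i else 0 := fun i => by
    rcases eq_or_ne (b.repr v i) 0 with h0 | h0
    · simp [h0]
    · rw [hc i h0]; simp
  rw [Finset.sum_congr rfl fun i _ => hc' i]
  split_ifs with hS
  · exact b.sum_repr v
  · simp

/-- A linear map which preserves weights and parities. -/
structure IsWeightMap (V W : WtMod h) (f : V.carrier →ₗ[ℂ] W.carrier) : Prop where
  E : ∀ v, f (V.op .E v) = W.op .E (f v)
  G : ∀ v, f (V.op .G v) = W.op .G (f v)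
  Γ : ∀ v, f (V.Γ v) = W.Γ (f v)

namespace IsWeightMap
variable {V W Z : WtMod h} {f : V.carrier →ₗ[ℂ] W.carrier} {g : W.carrier →ₗ[ℂ] Z.carrier}

theorem map_wt (hf : IsWeightMap V W f) {v : V.carrier} {e b s : ℂ} (hv : V.IsWt v e b s) :
    W.IsWt (f v) e b s :=
  isWt_of_E_G_Γ (by rw [← hf.E, hv.E, map_smul]) (by rw [← hf.G, hv.G, map_smul])
    (by rw [← hf.Γ, hv.Γ, map_smul]) hv.sq

theorem of_map_wt (hf : ∀ v e b s, V.IsWt v e b s → W.IsWt (f v) e b s) : IsWeightMap V W f where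
  E := LinearMap.congr_fun (f := f ∘ₗ V.op .E) (g := W.op .E ∘ₗ f)
    (ext_HW V.isOps fun v e b s hv => by simp [hv.E, (hf v e b s hv).E])
  G := LinearMap.congr_fun (f := f ∘ₗ V.op .G) (g := W.op .G ∘ₗ f)
    (ext_HW V.isOps fun v e b s hv => by simp [hv.G, (hf v e b s hv).G])
  Γ := LinearMap.congr_fun (f := f ∘ₗ V.Γ) (g := W.Γ ∘ₗ f)
    (ext_HW V.isOps fun v e b s hv => by simp [hv.Γ, (hf v e b s hv).Γ])

theorem K (hf : IsWeightMap V W f) : ∀ v, f (V.op .K v) = W.op .K (f v) :=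
  LinearMap.congr_fun (f := f ∘ₗ V.op .K) (g := W.op .K ∘ₗ f)
    (ext_HW V.isOps fun v e b s hv => by simp [hv.K, (hf.map_wt hv).K])

theorem Kinv (hf : IsWeightMap V W f) : ∀ v, f (V.op .Kinv v) = W.op .Kinv (f v) :=
  LinearMap.congr_fun (f := f ∘ₗ V.op .Kinv) (g := W.op .Kinv ∘ₗ f)
    (ext_HW V.isOps fun v e b s hv => by simp [hv.Kinv, (hf.map_wt hv).Kinv])

theorem comp (hg : IsWeightMap W Z g) (hf : IsWeightMap V W f) : IsWeightMap V Z (g ∘ₗ f) where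
  E v := by simp [hf.E, hg.E]
  G v := by simp [hf.G, hg.G]
  Γ v := by simp [hf.Γ, hg.Γ]

end IsWeightMap

theorem isWeightMap_lin {V W : WtMod h} (f : V ⟶ W) : IsWeightMap V W (lin f) where
  E := f.op_apply .E
  G := f.op_apply .G
  Γ := f.Γ_apply

theorem isWeightMap_weightProj (V : WtMod h) (S : Set (ℂ × ℂ × ℂ)) :
    IsWeightMap V V (V.weightProj S) := .of_map_wt fun v e b s hv => by
  classical
  rw [weightProj_apply S hv]
  split_ifs
  · exact hv
  · exact isWt_of_E_G_Γ (by simp) (by simp) (by simp) hv.sq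

theorem IsWeightMap.weightProj_comm {V W : WtMod h} {f : V.carrier →ₗ[ℂ] W.carrier}
    (hf : IsWeightMap V W f) (S : Set (ℂ × ℂ × ℂ)) (v : V.carrier) :
    f (V.weightProj S v) = W.weightProj S (f v) :=
  LinearMap.congr_fun (f := f ∘ₗ V.weightProj S) (g := W.weightProj S ∘ₗ f)
    (ext_HW V.isOps fun v e b s hv => by
      classical
      simp only [LinearMap.comp_apply, weightProj_apply S hv, weightProj_apply S (hf.map_wt hv)]
      split_ifs <;> simp) v

theorem isWt_weightProj_singleton {V : WtMod h} (e g s : ℂ) (hs : s = 1 ∨ s = -1) (v : V.carrier) :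
    V.IsWt (V.weightProj {(e, g, s)} v) e g s := by
  classical
  have key : ∀ {T : Module.End ℂ V.carrier} {z : ℂ},
      (∀ v, V.IsWt v e g s → T v = z • v) → ∀ v, T (V.weightProj {(e, g, s)} v) =
      z • V.weightProj {(e, g, s)} v := fun {T z} hT =>
    LinearMap.congr_fun (f := T ∘ₗ V.weightProj {(e, g, s)}) (g := z • V.weightProj {(e, g, s)})
      (ext_HW V.isOps fun v e' g' s' hv => by
        simp only [LinearMap.comp_apply, weightProj_apply _ hv, LinearMap.smul_apply,
          Set.mem_singleton_iff]
        split_ifs with hw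
        · cases hw; exact hT v hv
        · simp)
  exact isWt_of_E_G_Γ (key (fun v hv => hv.E) v) (key (fun v hv => hv.G) v)
    (key (fun v hv => hv.Γ) v) hs

/-- Every vector is a finite sum of its components of the various weights. -/
theorem exists_sum_weightProj {V : WtMod h} (v : V.carrier) : ∃ t : Finset (ℂ × ℂ × ℂ),
    (∀ w ∈ t, w.2.2 = 1 ∨ w.2.2 = -1) ∧ v = ∑ w ∈ t, V.weightProj {w} v := by
  classical
  obtain ⟨n, b, e, g, s, hb⟩ := V.exists_weightBasis
  let t := Finset.univ.image fun i => (e i, g i, s i)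
  have : (LinearMap.id : Module.End ℂ V.carrier) = ∑ w ∈ t, V.weightProj {w} := by
    refine b.ext fun i => ?_
    simp only [LinearMap.id_apply, LinearMap.sum_apply, weightProj_apply _ (hb i),
      Set.mem_singleton_iff]
    rw [Finset.sum_ite_eq, if_pos (Finset.mem_image_of_mem _ (Finset.mem_univ i))]
  refine ⟨t, fun w hw => ?_, ?_⟩
  · obtain ⟨i, -, rfl⟩ := Finset.mem_image.1 hw
    exact (hb i).sq
  · simpa using LinearMap.congr_fun this v

/-- A linear functional which preserves weights, as a map to the one-dimensional super vector space
of weight `(e, g)` and parity sign `s`. -/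
structure IsWtFunctional (V : WtMod h) (ξ : V.carrier →ₗ[ℂ] ℂ) (e g s : ℂ) : Prop where
  E : ∀ v, ξ (V.op .E v) = e * ξ v
  G : ∀ v, ξ (V.op .G v) = g * ξ v
  Γ : ∀ v, ξ (V.Γ v) = s * ξ v

theorem isWtFunctional_coord {V : WtMod h} {n : ℕ} (b : Module.Basis (Fin n) ℂ V.carrier)
    {e g s : Fin n → ℂ} (hb : ∀ i, V.IsWt (b i) (e i) (g i) (s i)) (i : Fin n) :
    V.IsWtFunctional (b.coord i) (e i) (g i) (s i) := by
  have key : ∀ {T : Module.End ℂ V.carrier} {c : Fin n → ℂ}, (∀ i, T (b i) = c i • b i) →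
      ∀ v, b.coord i (T v) = c i * b.coord i v := by
    intro T c hT
    refine LinearMap.congr_fun (f := b.coord i ∘ₗ T) (g := c i • b.coord i)
      (b.ext fun j => ?_)
    rcases eq_or_ne j i with rfl | hij
    · simp [hT]
    · simp [hT, Finsupp.single_apply, hij]
  exact ⟨key fun i => (hb i).E, key fun i => (hb i).G, key fun i => (hb i).Γ⟩

theorem isWtFunctional_comp_weightProj {V : WtMod h} (ξ : V.carrier →ₗ[ℂ] ℂ) {e g s : ℂ}
    (hs : s = 1 ∨ s = -1) : V.IsWtFunctional (ξ ∘ₗ V.weightProj {(e, g, s)}) e g s where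
  E v := by simp [(isWeightMap_weightProj V _).E, (isWt_weightProj_singleton e g s hs v).E]
  G v := by simp [(isWeightMap_weightProj V _).G, (isWt_weightProj_singleton e g s hs v).G]
  Γ v := by simp [(isWeightMap_weightProj V _).Γ, (isWt_weightProj_singleton e g s hs v).Γ]

theorem IsWtFunctional.smulRight {V W : WtMod h} {ξ : V.carrier →ₗ[ℂ] ℂ} {e g s : ℂ}
    (hξ : V.IsWtFunctional ξ e g s) {w : W.carrier} (hw : W.IsWt w e g s) :
    IsWeightMap V W (ξ.smulRight w) where
  E v := by simp [hξ.E, hw.E, smul_smul, mul_comm]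
  G v := by simp [hξ.G, hw.G, smul_smul, mul_comm]
  Γ v := by simp [hξ.Γ, hw.Γ, smul_smul, mul_comm]

/-! ### Averaging weight maps -/

section avg
variable {V W Z : WtMod h}

/-- The average of a linear map `f`: the iterated super commutator `[X, [Y, f]]`, where `f` is
considered as an even map. It commutes with `X` and `Y` since `X² = Y² = 0`. -/
noncomputable def avg (V W : WtMod h) (f : V.carrier →ₗ[ℂ] W.carrier) :
    V.carrier →ₗ[ℂ] W.carrier :=
  W.op .X ∘ₗ W.op .Y ∘ₗ f - W.op .X ∘ₗ f ∘ₗ V.op .Y + W.op .Y ∘ₗ f ∘ₗ V.op .X -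
    f ∘ₗ V.op .Y ∘ₗ V.op .X

theorem avg_apply (f : V.carrier →ₗ[ℂ] W.carrier) (v : V.carrier) :
    avg V W f v = W.op .X (W.op .Y (f v)) - W.op .X (f (V.op .Y v)) + W.op .Y (f (V.op .X v)) -
      f (V.op .Y (V.op .X v)) := rfl

theorem avg_sum {ι : Type*} (t : Finset ι) (f : ι → V.carrier →ₗ[ℂ] W.carrier) :
    avg V W (∑ i ∈ t, f i) = ∑ i ∈ t, avg V W (f i) := by
  ext v
  simp [avg_apply, Finset.sum_add_distrib, Finset.sum_sub_distrib]

theorem avg_lin_comp (f : V.carrier →ₗ[ℂ] W.carrier) (g : W ⟶ Z) :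
    avg V Z (lin g ∘ₗ f) = lin g ∘ₗ avg V W f := by
  ext v
  simp [avg_apply, g.op_apply]

theorem avg_comp_lin (f : V ⟶ W) (g : W.carrier →ₗ[ℂ] Z.carrier) :
    avg V Z (g ∘ₗ lin f) = avg W Z g ∘ₗ lin f := by
  ext v
  simp [avg_apply, f.op_apply]

/-- The average of a weight map is a morphism of modules. -/
noncomputable def avgHom {f : V.carrier →ₗ[ℂ] W.carrier} (hf : IsWeightMap V W f) : V ⟶ W where
  toLin := avg V W f
  op_comm x := by
    ext v
    cases x <;> simp [avg_apply, V.isOps.pw, W.isOps.pw, ← hf.E, ← hf.G, ← hf.K, ← hf.Kinv,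
      smul_sub] <;> abel
  Γ_comm := by
    ext v
    simp [avg_apply, V.isOps.pw, W.isOps.pw, ← hf.Γ]

@[simp] theorem lin_avgHom {f : V.carrier →ₗ[ℂ] W.carrier} (hf : IsWeightMap V W f) :
    lin (avgHom hf) = avg V W f := rfl

end avg

end WtMod
/-! ### Induced modules and Kac modules -/

/-- The quantum number `[z] = (q ^ z - q ^ (-z)) / (q - q⁻¹)`. -/
noncomputable def QParam.bracket (h : QParam) (z : ℂ) : ℂ := h.diff⁻¹ * (h.pow z - h.pow (-z))

theorem QParam.diff_mul_bracket (h : QParam) (z : ℂ) :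
    h.diff * h.bracket z = h.pow z - h.pow (-z) := mul_inv_cancel_left₀ h.diff_ne_zero _

theorem parSign_ne_zero (p : ZMod 2) : parSign p ≠ 0 := by
  rcases parSign_cases p with h | h <;> simp [h]

theorem exists_parSign_eq {s : ℂ} (hs : s = 1 ∨ s = -1) : ∃ p, parSign p = s := by
  rcases hs with rfl | rfl
  · exact ⟨0, by simp [parSign]⟩
  · exact ⟨1, by simp [parSign]⟩

theorem parSign_injective : Function.Injective parSign := by
  intro p q hpq
  have h0 : ∀ p : ZMod 2, p = 0 ∨ p = 1 := by decide
  have h1 : (1 : ℂ) ≠ -1 := by norm_num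
  revert hpq
  rcases h0 p with rfl | rfl <;> rcases h0 q with rfl | rfl <;> simp [parSign, h1, h1.symm]

theorem parSign_add (p q : ZMod 2) : parSign (p + q) = parSign p * parSign q := by
  have h0 : ∀ p : ZMod 2, p = 0 ∨ p = 1 := by decide
  have h1 : (1 + 1 : ZMod 2) = 0 := rfl
  rcases h0 p with rfl | rfl <;> rcases h0 q with rfl | rfl <;> simp [parSign, h1]

namespace WtMod
variable {h : QParam}

/-- The relation `XY + YX = (K - K⁻¹) / (q - q⁻¹)` on a weight vector. -/
theorem XY_apply {V : WtMod h} {v : V.carrier} {e g s : ℂ} (hv : V.IsWt v e g s) :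
    V.op .X (V.op .Y v) = h.bracket e • v - V.op .Y (V.op .X v) := by
  have h1 := LinearMap.congr_fun V.isOps.X_Y v
  simp only [LinearMap.add_apply, Module.End.mul_apply, LinearMap.smul_apply, LinearMap.sub_apply,
    hv.K, hv.Kinv] at h1
  rw [eq_sub_iff_add_eq, h1, QParam.bracket, h.pow_neg]
  module

/-- The operators of the induced module, in the basis `w`, `Xw`, `Yw`, `YXw`. -/
noncomputable def indOps (h : QParam) (e g : ℂ) : Gen → Module.End ℂ (ℂ × ℂ × ℂ × ℂ)
  | .E => e • 1
  | .G =>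
    { toFun := fun c => (g * c.1, (g + 1) * c.2.1, (g - 1) * c.2.2.1, g * c.2.2.2)
      map_add' := fun c d => by simp [mul_add]
      map_smul' := fun a c => by simp [mul_left_comm] }
  | .K => h.pow e • 1
  | .Kinv => h.pow (-e) • 1
  | .X =>
    { toFun := fun c => (h.bracket e * c.2.2.1, c.1 + h.bracket e * c.2.2.2, 0, -c.2.2.1)
      map_add' := fun c d => by simp [mul_add]; exact ⟨by ring, by ring⟩
      map_smul' := fun a c => by simp [mul_left_comm, mul_add] }
  | .Y =>
    { toFun := fun c => (0, 0, c.1, c.2.1)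
      map_add' := fun c d => by simp
      map_smul' := fun a c => by simp }

/-- The parity involution of the induced module. -/
noncomputable def indΓ (p : ZMod 2) : Module.End ℂ (ℂ × ℂ × ℂ × ℂ) where
  toFun c := (parSign p * c.1, -(parSign p * c.2.1), -(parSign p * c.2.2.1), parSign p * c.2.2.2)
  map_add' c d := by simp [mul_add]; exact ⟨by ring, by ring⟩
  map_smul' a c := by simp [mul_left_comm]

theorem indOps_apply (h : QParam) (e g : ℂ) (p : ZMod 2) (x y z t : ℂ) :
    indOps h e g .E (x, y, z, t) = (e * x, e * y, e * z, e * t) ∧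
    indOps h e g .G (x, y, z, t) = (g * x, (g + 1) * y, (g - 1) * z, g * t) ∧
    indOps h e g .K (x, y, z, t) = (h.pow e * x, h.pow e * y, h.pow e * z, h.pow e * t) ∧
    indOps h e g .Kinv (x, y, z, t) =
      (h.pow (-e) * x, h.pow (-e) * y, h.pow (-e) * z, h.pow (-e) * t) ∧
    indOps h e g .X (x, y, z, t) = (h.bracket e * z, x + h.bracket e * t, 0, -z) ∧
    indOps h e g .Y (x, y, z, t) = (0, 0, x, y) ∧
    indΓ p (x, y, z, t) = (parSign p * x, -(parSign p * y), -(parSign p * z), parSign p * t) :=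
  ⟨rfl, rfl, rfl, rfl, rfl, rfl, rfl⟩

theorem ind_ext {M : Type} [AddCommGroup M] [Module ℂ M] {f f' : ℂ × ℂ × ℂ × ℂ →ₗ[ℂ] M}
    (hf : ∀ x y z t, f (x, y, z, t) = f' (x, y, z, t)) : f = f' :=
  LinearMap.ext fun c => hf c.1 c.2.1 c.2.2.1 c.2.2.2

theorem isOps_ind (h : QParam) (e g : ℂ) (p : ZMod 2) : IsOps h (indOps h e g) (indΓ p) where
  K_Kinv := ind_ext fun x y z t => by
    simp only [Module.End.mul_apply, indOps_apply h e g p, Module.End.one_apply, ← mul_assoc,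
      ← h.pow_add, add_neg_cancel, h.pow_zero, one_mul]
  Kinv_K := ind_ext fun x y z t => by
    simp only [Module.End.mul_apply, indOps_apply h e g p, Module.End.one_apply, ← mul_assoc,
      ← h.pow_add, neg_add_cancel, h.pow_zero, one_mul]
  K_E := ind_ext fun x y z t => by
    simp only [Module.End.mul_apply, indOps_apply h e g p, mul_left_comm]
  K_G := ind_ext fun x y z t => by
    simp only [Module.End.mul_apply, indOps_apply h e g p, mul_left_comm]
  K_X := ind_ext fun x y z t => by
    simp only [Module.End.mul_apply, indOps_apply h e g p, mul_left_comm, mul_add, mul_neg, mul_zero]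
  K_Y := ind_ext fun x y z t => by simp only [Module.End.mul_apply, indOps_apply h e g p, mul_zero]
  E_X := ind_ext fun x y z t => by
    simp only [Module.End.mul_apply, indOps_apply h e g p, mul_left_comm, mul_add, mul_neg, mul_zero]
  E_Y := ind_ext fun x y z t => by simp only [Module.End.mul_apply, indOps_apply h e g p, mul_zero]
  E_G := ind_ext fun x y z t => by
    simp only [Module.End.mul_apply, indOps_apply h e g p, mul_left_comm]
  G_X := ind_ext fun x y z t => by
    simp only [Module.End.mul_apply, LinearMap.add_apply, indOps_apply h e g p, Prod.mk_add_mk,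
      Prod.mk.injEq]
    refine ⟨by ring, by ring, by ring, by ring⟩
  G_Y := ind_ext fun x y z t => by
    simp only [Module.End.mul_apply, LinearMap.sub_apply, indOps_apply h e g p, Prod.mk_sub_mk,
      Prod.mk.injEq]
    refine ⟨by ring, by ring, by ring, by ring⟩
  X_Y := ind_ext fun x y z t => by
    simp only [Module.End.mul_apply, LinearMap.add_apply, LinearMap.sub_apply, LinearMap.smul_apply,
      indOps_apply h e g p, Prod.mk_sub_mk, Prod.mk_add_mk, Prod.smul_mk, smul_eq_mul,
      Prod.mk.injEq, QParam.bracket]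
    refine ⟨by ring, by ring, by ring, by ring⟩
  X_X := ind_ext fun x y z t => by
    simp only [Module.End.mul_apply, indOps_apply h e g p, mul_neg, mul_zero, add_neg_cancel,
      neg_zero, LinearMap.zero_apply]
    rfl
  Y_Y := ind_ext fun x y z t => by
    simp only [Module.End.mul_apply, indOps_apply h e g p]
    rfl
  Γ_Γ := ind_ext fun x y z t => by
    simp only [Module.End.mul_apply, indOps_apply h e g p, mul_neg, neg_neg, ← mul_assoc,
      parSign_mul_self, one_mul, Module.End.one_apply]
  Γ_E := ind_ext fun x y z t => by
    simp only [Module.End.mul_apply, indOps_apply h e g p, mul_left_comm, mul_neg]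
  Γ_G := ind_ext fun x y z t => by
    simp only [Module.End.mul_apply, indOps_apply h e g p, mul_left_comm, mul_neg]
  Γ_K := ind_ext fun x y z t => by
    simp only [Module.End.mul_apply, indOps_apply h e g p, mul_left_comm, mul_neg]
  Γ_X := ind_ext fun x y z t => by
    simp only [Module.End.mul_apply, indOps_apply h e g p, mul_left_comm, mul_neg, LinearMap.neg_apply,
      Prod.neg_mk, Prod.mk.injEq]
    refine ⟨by ring, by ring, by ring, by ring⟩
  Γ_Y := ind_ext fun x y z t => by
    simp only [Module.End.mul_apply, indOps_apply h e g p, LinearMap.neg_apply,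
      Prod.neg_mk, Prod.mk.injEq, mul_zero, neg_zero, neg_neg, true_and, and_true]
  span := by
    rw [eq_top_iff]
    rintro ⟨x, y, z, t⟩ -
    have : ((x, y, z, t) : ℂ × ℂ × ℂ × ℂ) =
      (x, 0, 0, 0) + (0, y, 0, 0) + (0, 0, z, 0) + (0, 0, 0, t) := by simp
    rw [this]
    refine add_mem (add_mem (add_mem (Submodule.subset_span ⟨e, g, ?_, ?_, ?_⟩)
      (Submodule.subset_span ⟨e, g + 1, ?_, ?_, ?_⟩))
      (Submodule.subset_span ⟨e, g - 1, ?_, ?_, ?_⟩))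
      (Submodule.subset_span ⟨e, g, ?_, ?_, ?_⟩) <;> simp [indOps_apply h e g p]

/-- The module induced from the one-dimensional module of weight `(e, g)` and degree `p` over the
subalgebra generated by `E`, `G`, `K`. -/
noncomputable def ind (h : QParam) (e g : ℂ) (p : ZMod 2) : WtMod h where
  carrier := ℂ × ℂ × ℂ × ℂ
  op := indOps h e g
  Γ := indΓ p
  isOps := isOps_ind h e g p

/-- The generator of the induced module. -/
noncomputable def indGen (h : QParam) (e g : ℂ) (p : ZMod 2) : (ind h e g p).carrier :=
  ((1, 0, 0, 0) : ℂ × ℂ × ℂ × ℂ)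

theorem isWt_indGen (h : QParam) (e g : ℂ) (p : ZMod 2) :
    (ind h e g p).IsWt (indGen h e g p) e g (parSign p) := by
  have hE : indOps h e g .E (1, 0, 0, 0) = e • (1, 0, 0, 0) := by simp [indOps_apply h e g p]
  have hG : indOps h e g .G (1, 0, 0, 0) = g • (1, 0, 0, 0) := by simp [indOps_apply h e g p]
  have hΓ : indΓ p (1, 0, 0, 0) = parSign p • (1, 0, 0, 0) := by simp [indOps_apply h e g p]
  exact isWt_of_E_G_Γ hE hG hΓ (parSign_cases p)

section lift

variable {V : WtMod h} {y : V.carrier} {e g : ℂ} {p : ZMod 2}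

/-- The linear map underlying `indLift`. -/
noncomputable def indLin (V : WtMod h) (y : V.carrier) : ℂ × ℂ × ℂ × ℂ →ₗ[ℂ] V.carrier where
  toFun c := c.1 • y + c.2.1 • V.op .X y + c.2.2.1 • V.op .Y y + c.2.2.2 • V.op .Y (V.op .X y)
  map_add' c d := by simp only [Prod.fst_add, Prod.snd_add]; module
  map_smul' a c := by simp only [Prod.smul_fst, Prod.smul_snd, smul_eq_mul, RingHom.id_apply]; module

theorem indLin_apply (V : WtMod h) (y : V.carrier) (c : ℂ × ℂ × ℂ × ℂ) : indLin V y c =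
    c.1 • y + c.2.1 • V.op .X y + c.2.2.1 • V.op .Y y + c.2.2.2 • V.op .Y (V.op .X y) := rfl

theorem indLin_op (hy : V.IsWt y e g (parSign p)) (x : Gen) :
    indLin V y ∘ₗ indOps h e g x = V.op x ∘ₗ indLin V y := by
  refine LinearMap.ext fun c => ?_
  have hX := hy.X V.isOps
  have hY := hy.Y V.isOps
  have hYX := hy.YX V.isOps
  have h1 := XY_apply hy
  have h2 := XY_apply hX
  rw [V.X_X_apply, map_zero, sub_zero] at h2
  cases x
  · simp [indLin_apply, indOps, hy.E, hX.E, hY.E, hYX.E]; module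
  · simp [indLin_apply, indOps, hy.G, hX.G, hY.G, hYX.G]; module
  · simp [indLin_apply, indOps, hy.K, hX.K, hY.K, hYX.K]; module
  · simp [indLin_apply, indOps, hy.Kinv, hX.Kinv, hY.Kinv, hYX.Kinv, h.pow_neg]; module
  · simp [indLin_apply, indOps, h1, h2, V.X_X_apply]; module
  · simp [indLin_apply, indOps, V.Y_Y_apply]

theorem indLin_Γ (hy : V.IsWt y e g (parSign p)) :
    indLin V y ∘ₗ indΓ p = V.Γ ∘ₗ indLin V y := by
  refine LinearMap.ext fun c => ?_
  have hX := hy.X V.isOps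
  have hY := hy.Y V.isOps
  have hYX := hy.YX V.isOps
  simp [indLin_apply, indΓ, hy.Γ, hX.Γ, hY.Γ, hYX.Γ]; module

/-- The morphism from the induced module which sends the generator to a given weight vector. -/
noncomputable def indLift (hy : V.IsWt y e g (parSign p)) : ind h e g p ⟶ V where
  toLin := indLin V y
  op_comm := indLin_op hy
  Γ_comm := indLin_Γ hy

theorem lin_indLift_gen (hy : V.IsWt y e g (parSign p)) :
    lin (indLift hy) (indGen h e g p) = y := by
  change indLin V y (1, 0, 0, 0) = y
  simp [indLin_apply]

/-- The linear map underlying `kacLift`. -/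
noncomputable def kacLin (V : WtMod h) (y : V.carrier) : ℂ × ℂ →ₗ[ℂ] V.carrier where
  toFun c := c.1 • y + c.2 • V.op .Y y
  map_add' c d := by simp only [Prod.fst_add, Prod.snd_add]; module
  map_smul' a c := by simp only [Prod.smul_fst, Prod.smul_snd, smul_eq_mul, RingHom.id_apply]; module

theorem kacLin_apply (V : WtMod h) (y : V.carrier) (c : ℂ × ℂ) : kacLin V y c =
    c.1 • y + c.2 • V.op .Y y := rfl

theorem kacLin_op (hy : V.IsWt y e g (parSign p)) (hX : V.op .X y = 0) (x : Gen) :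
    kacLin V y ∘ₗ kacOps h e g x = V.op x ∘ₗ kacLin V y := by
  refine LinearMap.ext fun c => ?_
  have hY := hy.Y V.isOps
  have h1 := XY_apply hy
  rw [hX, map_zero, sub_zero] at h1
  cases x
  · simp [kacLin_apply, kacOps, hy.E, hY.E]; module
  · simp [kacLin_apply, kacOps, hy.G, hY.G]; module
  · simp [kacLin_apply, kacOps, hy.K, hY.K]; module
  · simp [kacLin_apply, kacOps, hy.Kinv, hY.Kinv, h.pow_neg]; module
  · simp [kacLin_apply, kacOps, h1, hX, QParam.bracket]; module
  · simp [kacLin_apply, kacOps, V.Y_Y_apply]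

theorem kacLin_Γ (hy : V.IsWt y e g (parSign p)) : kacLin V y ∘ₗ
    LinearMap.prodMap (parSign p • 1) (-parSign p • 1) = V.Γ ∘ₗ kacLin V y := by
  refine LinearMap.ext fun c => ?_
  have hY := hy.Y V.isOps
  simp [kacLin_apply, hy.Γ, hY.Γ]; module

/-- The morphism from a Kac module which sends the highest weight vector to a given weight vector
annihilated by `X`. -/
noncomputable def kacLift (hy : V.IsWt y e g (parSign p)) (hX : V.op .X y = 0) :
    kac h e g p ⟶ V where
  toLin := kacLin V y
  op_comm := kacLin_op hy hX
  Γ_comm := kacLin_Γ hy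

end lift

/-- The induced module is generated by its generator. -/
theorem ind_hom_ext {V : WtMod h} {e g : ℂ} {p : ZMod 2} {f f' : ind h e g p ⟶ V}
    (hf : lin f (indGen h e g p) = lin f' (indGen h e g p)) : f = f' := by
  refine hom_ext (LinearMap.ext fun (c : ℂ × ℂ × ℂ × ℂ) => ?_)
  have hc : c = c.1 • (1, 0, 0, 0) + c.2.1 • indOps h e g .X (1, 0, 0, 0) +
      c.2.2.1 • indOps h e g .Y (1, 0, 0, 0) +
      c.2.2.2 • indOps h e g .Y (indOps h e g .X (1, 0, 0, 0)) := by
    simp [indOps_apply h e g p]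
  have hc' : (c : (ind h e g p).carrier) = c.1 • indGen h e g p +
      c.2.1 • (ind h e g p).op .X (indGen h e g p) + c.2.2.1 • (ind h e g p).op .Y (indGen h e g p) +
      c.2.2.2 • (ind h e g p).op .Y ((ind h e g p).op .X (indGen h e g p)) := hc
  rw [hc']
  simp only [map_add, map_smul, f.op_apply, f'.op_apply, hf]

/-- The highest weight vector of a Kac module. -/
noncomputable def kacTop (h : QParam) (α a : ℂ) (p : ZMod 2) : (kac h α a p).carrier :=
  ((1, 0) : ℂ × ℂ)

/-- The lowest weight vector `Yv` of a Kac module with highest weight vector `v`. -/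
noncomputable def kacBot (h : QParam) (α a : ℂ) (p : ZMod 2) : (kac h α a p).carrier :=
  ((0, 1) : ℂ × ℂ)

theorem isWt_kacTop (h : QParam) (α a : ℂ) (p : ZMod 2) :
    (kac h α a p).IsWt (kacTop h α a p) α a (parSign p) := by
  have hE : kacOps h α a .E (1, 0) = α • (1, 0) := by simp [kacOps]
  have hG : kacOps h α a .G (1, 0) = a • (1, 0) := by simp [kacOps]
  have hΓ : LinearMap.prodMap (parSign p • (1 : Module.End ℂ ℂ)) (-parSign p • (1 : Module.End ℂ ℂ))
      (1, 0) = parSign p • ((1 : ℂ), (0 : ℂ)) := by simp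
  exact isWt_of_E_G_Γ hE hG hΓ (parSign_cases p)

theorem kacTop_ne_zero (α a : ℂ) (p : ZMod 2) : kacTop h α a p ≠ 0 := fun h0 =>
  one_ne_zero (congrArg Prod.fst h0 : (1 : ℂ) = 0)

theorem X_kacTop (h : QParam) (α a : ℂ) (p : ZMod 2) :
    (kac h α a p).op .X (kacTop h α a p) = 0 :=
  show kacOps h α a .X (1, 0) = 0 by simp [kacOps]

theorem Y_kacTop (h : QParam) (α a : ℂ) (p : ZMod 2) :
    (kac h α a p).op .Y (kacTop h α a p) = kacBot h α a p := by
  change kacOps h α a .Y (1, 0) = ((0, 1) : ℂ × ℂ)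
  simp [kacOps]

theorem isWt_kacBot (h : QParam) (α a : ℂ) (p : ZMod 2) :
    (kac h α a p).IsWt (kacBot h α a p) α (a - 1) (-parSign p) := by
  rw [← Y_kacTop]
  exact (isWt_kacTop h α a p).Y (kac h α a p).isOps

theorem X_kacBot (h : QParam) (α a : ℂ) (p : ZMod 2) :
    (kac h α a p).op .X (kacBot h α a p) = h.bracket α • kacTop h α a p := by
  have hX : kacOps h α a .X (0, 1) = h.bracket α • (1, 0) := by simp [kacOps, QParam.bracket]
  exact hX

theorem kac_eq_add {α a : ℂ} {p : ZMod 2} (c : (kac h α a p).carrier) :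
    c = (show ℂ × ℂ from c).1 • kacTop h α a p + (show ℂ × ℂ from c).2 • kacBot h α a p :=
  (show ∀ c : ℂ × ℂ, c = c.1 • (1, 0) + c.2 • (0, 1) from fun c => by ext <;> simp) c

/-- A Kac module is generated by its highest weight vector. -/
theorem kac_hom_ext {V : WtMod h} {α a : ℂ} {p : ZMod 2} {f f' : kac h α a p ⟶ V}
    (hf : lin f (kacTop h α a p) = lin f' (kacTop h α a p)) : f = f' := by
  refine hom_ext (LinearMap.ext fun c => ?_)
  rw [kac_eq_add c, ← Y_kacTop]
  simp only [map_add, map_smul, f.op_apply, f'.op_apply, hf]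

theorem lin_kacLift_top {V : WtMod h} {y : V.carrier} {e g : ℂ} {p : ZMod 2}
    (hy : V.IsWt y e g (parSign p)) (hX : V.op .X y = 0) :
    lin (kacLift hy hX) (kacTop h e g p) = y := by
  change kacLin V y (1, 0) = y
  simp [kacLin_apply]

/-! ### Monomorphisms and epimorphisms -/

/-- A weight component of a vector in the kernel of `f` defines a morphism from an induced module
which `f` annihilates. -/
theorem injective_of_mono {V W : WtMod h} (f : V ⟶ W) [Mono f] : Function.Injective (lin f) := by
  rw [← LinearMap.ker_eq_bot, LinearMap.ker_eq_bot']
  intro v hv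
  obtain ⟨t, ht, hsum⟩ := exists_sum_weightProj v
  rw [hsum]
  refine Finset.sum_eq_zero fun w hw => ?_
  obtain ⟨p, hp⟩ := exists_parSign_eq (ht w hw)
  have h1 := isWt_weightProj_singleton w.1 w.2.1 w.2.2 (ht w hw) v
  rw [← hp] at h1
  have h2 : indLift h1 ≫ f = 0 ≫ f := ind_hom_ext (by
    rw [lin_comp, LinearMap.comp_apply, lin_indLift_gen, hp, (isWeightMap_lin f).weightProj_comm, hv,
      map_zero]
    simp)
  have h3 := (cancel_mono f).1 h2
  have h4 := lin_indLift_gen h1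
  rw [h3, hp] at h4
  exact h4.symm

theorem mono_of_injective {V W : WtMod h} (f : V ⟶ W) (hf : Function.Injective (lin f)) : Mono f where
  right_cancellation g g' hg := hom_ext (LinearMap.ext fun v => hf
    (LinearMap.congr_fun (congrArg lin hg) v))

theorem epi_of_surjective {V W : WtMod h} (f : V ⟶ W) (hf : Function.Surjective (lin f)) : Epi f where
  left_cancellation g g' hg := hom_ext (LinearMap.ext fun w => by
    obtain ⟨v, rfl⟩ := hf w
    exact LinearMap.congr_fun (congrArg lin hg) v)

/-- If `f` is not surjective, a weight functional `ξ` vanishes on its range, and the average of `ξ`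
with values in the induced module is a non-zero morphism which vanishes on the range. -/
theorem surjective_of_epi {V W : WtMod h} (f : V ⟶ W) [Epi f] : Function.Surjective (lin f) := by
  rw [← LinearMap.range_eq_top, eq_top_iff, ← W.isOps.span_HW, Submodule.span_le]
  rintro x ⟨e, g, s, hx⟩
  by_contra hxf
  obtain ⟨ξ₀, hξx, hξf⟩ := Submodule.exists_le_ker_of_notMem hxf
  obtain ⟨p, hp⟩ := exists_parSign_eq hx.sq
  have hξ := isWtFunctional_comp_weightProj (V := W) ξ₀ (e := e) (g := g) hx.sq
  rw [← hp] at hξ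
  have hm := hξ.smulRight (isWt_indGen h e g p)
  have hfm : f ≫ avgHom hm = f ≫ 0 := by
    refine hom_ext ?_
    rw [lin_comp, lin_avgHom, ← avg_comp_lin]
    suffices h0 : (ξ₀ ∘ₗ W.weightProj {(e, g, parSign p)}).smulRight (indGen h e g p) ∘ₗ lin f = 0 by
      rw [h0]
      ext1 v
      simp [avg_apply]
    ext1 v
    have : ξ₀ (lin f (V.weightProj {(e, g, parSign p)} v)) = 0 := hξf ⟨_, rfl⟩
    simp [← (isWeightMap_lin f).weightProj_comm, this]
  have h0 := LinearMap.congr_fun (congrArg lin ((cancel_epi f).1 hfm)) x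
  rw [lin_avgHom, avg_apply] at h0
  have hP : W.weightProj {(e, g, parSign p)} x = x := by
    classical
    rw [weightProj_apply _ hx, hp]; simp
  simp only [LinearMap.smulRight_apply, LinearMap.comp_apply, map_smul] at h0
  rw [hP] at h0
  have h4 : ∀ a b c d : ℂ, a • indOps h e g .X (indOps h e g .Y (1, 0, 0, 0)) -
      b • indOps h e g .X (1, 0, 0, 0) + c • indOps h e g .Y (1, 0, 0, 0) - d • (1, 0, 0, 0) =
      (0 : ℂ × ℂ × ℂ × ℂ) → a = 0 := fun a b c d h1 => by
    simp only [indOps_apply h e g p] at h1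
    simpa using congrArg (fun c : ℂ × ℂ × ℂ × ℂ => c.2.2.2) h1
  exact hξx (h4 _ _ _ _ h0)

end WtMod
namespace WtMod
variable {h : QParam}

/-! ### Projective modules -/

/-- A weight map `φ` on `V` whose average is the identity. Such a map is a splitting of `V` relative
to the subalgebra generated by `E`, `G`, `K`; it exists if and only if `V` is projective. -/
structure IsAvgUnit (V : WtMod h) (φ : Module.End ℂ V.carrier) : Prop where
  wt : IsWeightMap V V φ
  avg : avg V V φ = LinearMap.id

theorem IsWeightMap.of_basis {V W : WtMod h} {n : ℕ} (b : Module.Basis (Fin n) ℂ V.carrier)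
    {e g s : Fin n → ℂ} (hb : ∀ i, V.IsWt (b i) (e i) (g i) (s i)) {f : V.carrier →ₗ[ℂ] W.carrier}
    (hf : ∀ i, W.IsWt (f (b i)) (e i) (g i) (s i)) : IsWeightMap V W f where
  E := LinearMap.congr_fun (f := f ∘ₗ V.op .E) (g := W.op .E ∘ₗ f)
    (b.ext fun i => by simp [(hb i).E, (hf i).E])
  G := LinearMap.congr_fun (f := f ∘ₗ V.op .G) (g := W.op .G ∘ₗ f)
    (b.ext fun i => by simp [(hb i).G, (hf i).G])
  Γ := LinearMap.congr_fun (f := f ∘ₗ V.Γ) (g := W.Γ ∘ₗ f)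
    (b.ext fun i => by simp [(hb i).Γ, (hf i).Γ])

/-- A surjective morphism has a section which preserves weights. -/
theorem exists_weight_section {V W : WtMod h} (f : V ⟶ W) (hf : Function.Surjective (lin f)) :
    ∃ s : W.carrier →ₗ[ℂ] V.carrier, IsWeightMap W V s ∧ lin f ∘ₗ s = LinearMap.id := by
  obtain ⟨n, b, e, g, s, hb⟩ := W.exists_weightBasis
  choose m hm using fun i => hf (b i)
  let y := fun i => V.weightProj {(e i, g i, s i)} (m i)
  refine ⟨b.constr ℂ y, .of_basis b hb fun i => ?_, b.ext fun i => ?_⟩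
  · rw [b.constr_basis]
    exact isWt_weightProj_singleton _ _ _ (hb i).sq _
  · classical
    simp [y, (isWeightMap_lin f).weightProj_comm, hm, weightProj_apply _ (hb i)]

/-- The average of `s φ`, for a section `s` which preserves weights, is a section of modules. -/
theorem IsAvgUnit.projective {V : WtMod h} {φ : Module.End ℂ V.carrier} (hφ : V.IsAvgUnit φ) :
    projectives (WtMod h) V := by
  intro M f hf
  obtain ⟨s, hs, hsf⟩ := exists_weight_section f (surjective_of_epi f)
  refine ⟨avgHom (hs.comp hφ.wt), hom_ext ?_⟩
  rw [lin_comp, lin_avgHom, ← avg_lin_comp, ← LinearMap.comp_assoc, hsf, LinearMap.id_comp, hφ.avg,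
    lin_id]

theorem IsAvgUnit.retract {V W : WtMod h} {φ : Module.End ℂ W.carrier} (hφ : W.IsAvgUnit φ)
    {i : V ⟶ W} {p : W ⟶ V} (hip : i ≫ p = 𝟙 V) : V.IsAvgUnit (lin p ∘ₗ φ ∘ₗ lin i) where
  wt := (isWeightMap_lin p).comp (hφ.wt.comp (isWeightMap_lin i))
  avg := by
    rw [avg_lin_comp, avg_comp_lin, hφ.avg, LinearMap.id_comp, ← lin_comp, hip, lin_id]

/-- As `ΔX = X ⊗ K⁻¹ + 1 ⊗ X` and `ΔY = Y ⊗ 1 + K ⊗ Y`, the average of `φ ⊗ K` is the average of `φ`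
tensored with the identity. -/
theorem IsAvgUnit.tens {V : WtMod h} {φ : Module.End ℂ V.carrier} (hφ : V.IsAvgUnit φ)
    (W : WtMod h) : IsAvgUnit (V ⊗ W) (map φ (W.op .K)) where
  wt := .of_map_wt fun v e b s hv => by
    have hE : ∀ t, map φ (W.op .K) (tensorOps V.op V.Γ W.op .E t) =
        tensorOps V.op V.Γ W.op .E (map φ (W.op .K) t) :=
      LinearMap.congr_fun (f := map φ (W.op .K) ∘ₗ tensorOps V.op V.Γ W.op .E)
        (g := tensorOps V.op V.Γ W.op .E ∘ₗ map φ (W.op .K)) (TensorProduct.ext' fun v w => by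
          simp [tensorOps, hφ.wt.E, W.isOps.pw])
    have hG : ∀ t, map φ (W.op .K) (tensorOps V.op V.Γ W.op .G t) =
        tensorOps V.op V.Γ W.op .G (map φ (W.op .K) t) :=
      LinearMap.congr_fun (f := map φ (W.op .K) ∘ₗ tensorOps V.op V.Γ W.op .G)
        (g := tensorOps V.op V.Γ W.op .G ∘ₗ map φ (W.op .K)) (TensorProduct.ext' fun v w => by
          simp [tensorOps, hφ.wt.G, W.isOps.pw])
    have hΓ : ∀ t, map φ (W.op .K) (map V.Γ W.Γ t) = map V.Γ W.Γ (map φ (W.op .K) t) :=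
      LinearMap.congr_fun (f := map φ (W.op .K) ∘ₗ map V.Γ W.Γ)
        (g := map V.Γ W.Γ ∘ₗ map φ (W.op .K)) (TensorProduct.ext' fun v w => by
          simp [hφ.wt.Γ, W.isOps.pw])
    refine isWt_of_E_G_Γ ((hE v).symm.trans ?_) ((hG v).symm.trans ?_) ((hΓ v).symm.trans ?_) hv.sq
    · exact (congrArg _ hv.E).trans (map_smul _ _ _)
    · exact (congrArg _ hv.G).trans (map_smul _ _ _)
    · exact (congrArg _ hv.Γ).trans (map_smul _ _ _)
  avg := by
    refine TensorProduct.ext' fun v w => ?_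
    have h1 := LinearMap.congr_fun hφ.avg v
    rw [avg_apply, LinearMap.id_apply] at h1
    have h2 : φ (V.op .Y (V.op .X v)) = V.op .X (V.op .Y (φ v)) - V.op .X (φ (V.op .Y v)) +
      V.op .Y (φ (V.op .X v)) - v := by
      have h3 := h1
      rw [sub_eq_iff_eq_add] at h3
      rw [h3, add_sub_cancel_left]
    change tensorOps V.op V.Γ W.op .X (tensorOps V.op V.Γ W.op .Y (map φ (W.op .K) (v ⊗ₜ w))) -
      tensorOps V.op V.Γ W.op .X (map φ (W.op .K) (tensorOps V.op V.Γ W.op .Y (v ⊗ₜ w))) +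
      tensorOps V.op V.Γ W.op .Y (map φ (W.op .K) (tensorOps V.op V.Γ W.op .X (v ⊗ₜ w))) -
      map φ (W.op .K) (tensorOps V.op V.Γ W.op .Y (tensorOps V.op V.Γ W.op .X (v ⊗ₜ w))) = v ⊗ₜ w
    simp [tensorOps, ← hφ.wt.Γ, ← hφ.wt.K, ← hφ.wt.Kinv, V.isOps.pw, W.isOps.pw, h2, add_tmul,
      tmul_add, sub_tmul, tmul_sub, neg_tmul, tmul_neg, smul_sub]
    abel

/-- With respect to the basis `w`, `Xw`, `Yw`, `YXw` the weight map `YXw ↦ -w`, which vanishes on the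
other basis vectors, has average `1`. -/
theorem isAvgUnit_ind (h : QParam) (e g : ℂ) (p : ZMod 2) : ∃ φ, (ind h e g p).IsAvgUnit φ := by
  let φ : Module.End ℂ (ℂ × ℂ × ℂ × ℂ) :=
    -(LinearMap.inl ℂ ℂ (ℂ × ℂ × ℂ) ∘ₗ LinearMap.snd ℂ ℂ ℂ ∘ₗ LinearMap.snd ℂ ℂ _ ∘ₗ
      LinearMap.snd ℂ ℂ _)
  have hφ : ∀ x y z t, φ (x, y, z, t) = (-t, 0, 0, 0) := fun x y z t => by simp [φ]; rfl
  have hE : φ ∘ₗ indOps h e g .E = indOps h e g .E ∘ₗ φ := ind_ext fun x y z t => by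
    simp [hφ, indOps_apply h e g p]
  have hG : φ ∘ₗ indOps h e g .G = indOps h e g .G ∘ₗ φ := ind_ext fun x y z t => by
    simp [hφ, indOps_apply h e g p]
  have hΓ : φ ∘ₗ indΓ p = indΓ p ∘ₗ φ := ind_ext fun x y z t => by
    simp [hφ, indOps_apply h e g p]
  have havg : indOps h e g .X ∘ₗ indOps h e g .Y ∘ₗ φ - indOps h e g .X ∘ₗ φ ∘ₗ indOps h e g .Y +
      indOps h e g .Y ∘ₗ φ ∘ₗ indOps h e g .X - φ ∘ₗ indOps h e g .Y ∘ₗ indOps h e g .X =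
      LinearMap.id := ind_ext fun x y z t => by
    simp [hφ, indOps_apply h e g p]
  exact ⟨φ, ⟨LinearMap.congr_fun hE, LinearMap.congr_fun hG, LinearMap.congr_fun hΓ⟩, havg⟩

/-- A projective module `V` is a retract of `P ⊗ V`, where `P` is an induced module which covers the
unit object. -/
theorem projectives_iff {V : WtMod h} : projectives (WtMod h) V ↔ ∃ φ, V.IsAvgUnit φ := by
  refine ⟨fun hV => ?_, fun ⟨φ, hφ⟩ => hφ.projective⟩
  have h1 : HW h (epsOps h 0 0) (parSign 0 • (1 : Module.End ℂ ℂ)) (1 : ℂ) 0 0 (parSign 0) := by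
    constructor <;> simp [epsOps, parSign, h.pow_zero]
  have hy : (𝟙_ (WtMod h)).IsWt (1 : ℂ) 0 0 (parSign 0) := h1
  let f : ind h 0 0 0 ⊗ V ⟶ V := indLift hy ▷ V ≫ (λ_ V).hom
  have hf : Function.Surjective (lin f) := fun v => ⟨indGen h 0 0 0 ⊗ₜ v, by
    have h2 : lin (indLift hy) (indGen h 0 0 0) = (1 : ℂ) := lin_indLift_gen hy
    change TensorProduct.lid ℂ V.carrier (lin (indLift hy) (indGen h 0 0 0) ⊗ₜ v) = v
    rw [h2]
    exact one_smul _ _⟩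
  obtain ⟨g, hg⟩ := hV _ f (epi_of_surjective f hf)
  obtain ⟨φ, hφ⟩ := isAvgUnit_ind h 0 0 0
  exact ⟨_, (hφ.tens V).retract hg⟩

theorem isIdeal_projectives : IsIdeal (projectives (WtMod h)) where
  retract V W f g hW hfg := by
    obtain ⟨φ, hφ⟩ := projectives_iff.1 hW
    exact (hφ.retract hfg).projective
  tensor U V hU := by
    obtain ⟨φ, hφ⟩ := projectives_iff.1 hU
    exact (hφ.tens V).projective

/-- If `[α] ≠ 0`, the projection of `V(α, a)` to its highest weight space has average `[α]`. -/
theorem isAvgUnit_kac {α : ℂ} (hα : h.bracket α ≠ 0) (a : ℂ) (p : ZMod 2) :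
    (kac h α a p).IsAvgUnit
      ((h.bracket α)⁻¹ • (LinearMap.inl ℂ ℂ ℂ ∘ₗ LinearMap.fst ℂ ℂ ℂ : Module.End ℂ (ℂ × ℂ))) := by
  let φ : Module.End ℂ (ℂ × ℂ) := (h.bracket α)⁻¹ • (LinearMap.inl ℂ ℂ ℂ ∘ₗ LinearMap.fst ℂ ℂ ℂ)
  have hE : φ ∘ₗ kacOps h α a .E = kacOps h α a .E ∘ₗ φ := by ext <;> simp [φ, kacOps, mul_comm]
  have hG : φ ∘ₗ kacOps h α a .G = kacOps h α a .G ∘ₗ φ := by ext <;> simp [φ, kacOps, mul_comm]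
  have hΓ : φ ∘ₗ LinearMap.prodMap (parSign p • 1) (-parSign p • 1) =
    LinearMap.prodMap (parSign p • 1) (-parSign p • 1) ∘ₗ φ := by ext <;> simp [φ, mul_comm]
  have havg : kacOps h α a .X ∘ₗ kacOps h α a .Y ∘ₗ φ - kacOps h α a .X ∘ₗ φ ∘ₗ kacOps h α a .Y +
      kacOps h α a .Y ∘ₗ φ ∘ₗ kacOps h α a .X - φ ∘ₗ kacOps h α a .Y ∘ₗ kacOps h α a .X =
      LinearMap.id := by
    have : h.diff⁻¹ * (h.pow α - h.pow (-α)) = h.bracket α := rfl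
    ext <;> simp [φ, kacOps, this, hα]
  exact ⟨⟨LinearMap.congr_fun hE, LinearMap.congr_fun hG, LinearMap.congr_fun hΓ⟩, havg⟩

/-! ### The modified trace -/

/-- The super trace. -/
noncomputable def superTrace (V : WtMod h) : Module.End ℂ V.carrier →ₗ[ℂ] ℂ :=
  LinearMap.trace ℂ V.carrier ∘ₗ LinearMap.mulLeft ℂ V.Γ

theorem superTrace_apply (V : WtMod h) (A : Module.End ℂ V.carrier) :
    V.superTrace A = LinearMap.trace ℂ V.carrier (V.Γ * A) := rfl

/-- Averaging is self-adjoint for the super trace form. -/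
theorem superTrace_mul_avg {V : WtMod h} {φ χ : Module.End ℂ V.carrier} (hφ : IsWeightMap V V φ) :
    V.superTrace (φ * avg V V χ) = V.superTrace (avg V V φ * χ) := by
  have hΓφ : V.Γ * φ = φ * V.Γ := LinearMap.ext fun v => (hφ.Γ v).symm
  have c1 : LinearMap.trace ℂ V.carrier (V.Γ * φ * V.op .X * χ * V.op .Y) =
      -LinearMap.trace ℂ V.carrier (V.Γ * V.op .Y * φ * V.op .X * χ) := by
    rw [LinearMap.trace_mul_comm, ← map_neg]
    congr 1
    simp only [← mul_assoc]
    rw [V.isOps.Γ_Y]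
    simp only [neg_mul, neg_neg]
  have c2 : LinearMap.trace ℂ V.carrier (V.Γ * φ * V.op .Y * χ * V.op .X) =
      -LinearMap.trace ℂ V.carrier (V.Γ * V.op .X * φ * V.op .Y * χ) := by
    rw [LinearMap.trace_mul_comm, ← map_neg]
    congr 1
    simp only [← mul_assoc]
    rw [V.isOps.Γ_X]
    simp only [neg_mul, neg_neg]
  have c3 : LinearMap.trace ℂ V.carrier (V.Γ * φ * χ * V.op .Y * V.op .X) =
      LinearMap.trace ℂ V.carrier (V.Γ * V.op .Y * V.op .X * φ * χ) := by
    rw [mul_assoc _ (V.op .Y), LinearMap.trace_mul_comm]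
    congr 1
    simp only [← mul_assoc]
    congr 2
    have hYX : V.Γ * V.op .Y * V.op .X = V.op .Y * V.op .X * V.Γ := by
      rw [V.isOps.Γ_Y, neg_mul, mul_assoc (V.op .Y) V.Γ, V.isOps.Γ_X, mul_neg, neg_neg, mul_assoc]
    exact hYX.symm
  have c4 : LinearMap.trace ℂ V.carrier (V.Γ * φ * V.op .X * V.op .Y * χ) =
      LinearMap.trace ℂ V.carrier (V.Γ * V.op .X * V.op .Y * φ * χ) +
      LinearMap.trace ℂ V.carrier (V.Γ * V.op .Y * V.op .X * φ * χ) -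
      LinearMap.trace ℂ V.carrier (V.Γ * φ * V.op .Y * V.op .X * χ) := by
    rw [← map_add, ← map_sub]
    congr 1
    have hK : φ * (V.op .X * V.op .Y + V.op .Y * V.op .X) =
        (V.op .X * V.op .Y + V.op .Y * V.op .X) * φ := by
      rw [V.isOps.X_Y]
      ext v
      simp [hφ.K, hφ.Kinv]
    have := congrArg (fun T => V.Γ * T * χ) hK
    simp only [mul_add, add_mul, ← mul_assoc] at this
    rw [← this, add_sub_cancel_right]
  rw [superTrace_apply, superTrace_apply]
  have e1 : avg V V χ = V.op .X * V.op .Y * χ - V.op .X * χ * V.op .Y + V.op .Y * χ * V.op .X -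
    χ * V.op .Y * V.op .X := rfl
  have e2 : avg V V φ = V.op .X * V.op .Y * φ - V.op .X * φ * V.op .Y + V.op .Y * φ * V.op .X -
    φ * V.op .Y * V.op .X := rfl
  rw [e1, e2]
  simp only [mul_add, mul_sub, sub_mul, add_mul, map_add, map_sub, ← mul_assoc, c1, c2, c3, c4]
  ring

theorem superTrace_comm {V W : WtMod h} {f : V.carrier →ₗ[ℂ] W.carrier}
    {g : W.carrier →ₗ[ℂ] V.carrier} (hg : ∀ w, g (W.Γ w) = V.Γ (g w)) :
    V.superTrace (g ∘ₗ f) = W.superTrace (f ∘ₗ g) := by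
  rw [superTrace_apply, superTrace_apply]
  have h1 : V.Γ * (g ∘ₗ f) = g ∘ₗ (W.Γ ∘ₗ f) := LinearMap.ext fun v => (hg _).symm
  rw [h1, LinearMap.trace_comp_comm']
  rfl

/-- With `φ` and `ψ` of average `1`, the morphism `fg` is the average of `f ψ g`, and averaging can be
moved over to `φ`. For `W = V` and `f = 1` this shows that the super trace of `φ g` does not depend
on the choice of `φ`. -/
theorem superTrace_avgUnit_cyclic {V W : WtMod h} {φ : Module.End ℂ V.carrier}
    {ψ : Module.End ℂ W.carrier} (hφ : V.IsAvgUnit φ) (hψ : W.IsAvgUnit ψ) (f : W ⟶ V) (g : V ⟶ W) :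
    V.superTrace (φ * lin (g ≫ f)) = W.superTrace (ψ * lin (f ≫ g)) := by
  have h1 : lin (g ≫ f) = avg V V (lin f ∘ₗ ψ ∘ₗ lin g) := by
    rw [avg_lin_comp, avg_comp_lin, hψ.avg]
    rfl
  rw [h1, superTrace_mul_avg hφ.wt, hφ.avg]
  change V.superTrace (lin f ∘ₗ (ψ ∘ₗ lin g)) = _
  rw [superTrace_comm f.Γ_apply]
  rfl

/-- The partial trace, in terms of a basis of the second factor. -/
theorem lin_ptr {V W : WtMod h} {ι : Type} [Fintype ι] (b : Module.Basis ι ℂ W.carrier)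
    (f : V ⊗ W ⟶ V ⊗ W) (v : V.carrier) : lin (ptr W f) v =
      ∑ i, TensorProduct.rid ℂ V.carrier (map LinearMap.id (b.coord i ∘ₗ W.Γ ∘ₗ W.op .K)
        (lin f (v ⊗ₜ[ℂ] b i : V.carrier ⊗[ℂ] W.carrier))) := by
  have hco : coevaluation ℂ W.carrier 1 = ∑ i, b i ⊗ₜ[ℂ] b.coord i := by
    refine coev_inj ?_
    rw [dualTensorHom_coev]
    ext w
    simp [map_sum, dualTensorHom_apply, b.sum_repr]
  have hev : ∀ (T : W.carrier ⊗[ℂ] Module.Dual ℂ W.carrier →ₗ[ℂ] ℂ)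
      (_ : ∀ w η, T (w ⊗ₜ η) = η (W.Γ (W.op .K w))) (η : Module.Dual ℂ W.carrier)
      (t : V.carrier ⊗[ℂ] W.carrier),
      TensorProduct.rid ℂ V.carrier (map LinearMap.id T
        (TensorProduct.assoc ℂ V.carrier W.carrier (Module.Dual ℂ W.carrier) (t ⊗ₜ η))) =
      TensorProduct.rid ℂ V.carrier (map LinearMap.id (η ∘ₗ W.Γ ∘ₗ W.op .K) t) := by
    intro T hT η t
    induction t using TensorProduct.induction_on with
    | zero => simp
    | add x y hx hy => simp only [add_tmul, map_add, hx, hy]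
    | tmul x y => simp [hT]
  have h1 : ∀ (T : W.carrier ⊗[ℂ] Module.Dual ℂ W.carrier →ₗ[ℂ] ℂ)
      (F : Module.End ℂ (V.carrier ⊗[ℂ] W.carrier))
      (_ : ∀ w η, T (w ⊗ₜ η) = η (W.Γ (W.op .K w))),
      TensorProduct.rid ℂ V.carrier (map LinearMap.id T
        (TensorProduct.assoc ℂ V.carrier W.carrier (Module.Dual ℂ W.carrier)
        (map F LinearMap.id ((TensorProduct.assoc ℂ V.carrier W.carrier
          (Module.Dual ℂ W.carrier)).symm (v ⊗ₜ coevaluation ℂ W.carrier 1))))) =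
      ∑ i, TensorProduct.rid ℂ V.carrier (map LinearMap.id (b.coord i ∘ₗ W.Γ ∘ₗ W.op .K)
        (F (v ⊗ₜ[ℂ] b i))) := by
    intro T F hT
    rw [hco, tmul_sum]
    simp only [map_sum, TensorProduct.assoc_symm_tmul, map_tmul]
    exact Finset.sum_congr rfl fun i _ => hev T hT _ _
  exact h1 (lin (evR W)) (lin f) (evR_tmul W)

theorem trace_eq_sum_coord {A ι : Type} [AddCommGroup A] [Module ℂ A] [Fintype ι]
    (b : Module.Basis ι ℂ A) (T : Module.End ℂ A) :
    LinearMap.trace ℂ A T = ∑ i, b.coord i (T (b i)) := by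
  classical
  rw [LinearMap.trace_eq_matrix_trace ℂ b, Matrix.trace]
  simp [LinearMap.toMatrix_apply]

/-- The partial trace is the super trace over `W` weighted by `K`, and `φ ⊗ K` has average `1` if `φ`
has. -/
theorem superTrace_ptr {V W : WtMod h} {φ : Module.End ℂ V.carrier}
    {Φ : Module.End ℂ (V ⊗ W).carrier} (hΦ : Φ = map φ (W.op .K)) (f : V ⊗ W ⟶ V ⊗ W) :
    superTrace (V ⊗ W) (Φ * lin f) = V.superTrace (φ * lin (ptr W f)) := by
  obtain ⟨n, b, -⟩ := V.exists_weightBasis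
  obtain ⟨m, c, -⟩ := W.exists_weightBasis
  subst hΦ
  have key : ∀ F : Module.End ℂ (V.carrier ⊗[ℂ] W.carrier),
      LinearMap.trace ℂ (V.carrier ⊗[ℂ] W.carrier) (map V.Γ W.Γ * (map φ (W.op .K) * F)) =
      ∑ i, b.coord i (V.Γ (φ (∑ j, TensorProduct.rid ℂ V.carrier (map LinearMap.id
        (c.coord j ∘ₗ W.Γ ∘ₗ W.op .K) (F (b i ⊗ₜ[ℂ] c j)))))) := by
    intro F
    rw [trace_eq_sum_coord (b.tensorProduct c), Fintype.sum_prod_type]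
    refine Finset.sum_congr rfl fun i _ => ?_
    simp only [map_sum, Module.End.mul_apply]
    refine Finset.sum_congr rfl fun j _ => ?_
    rw [Module.Basis.tensorProduct_apply]
    induction F (b i ⊗ₜ[ℂ] c j) using TensorProduct.induction_on with
    | zero => simp
    | add x y hx hy => simp only [map_add, hx, hy]
    | tmul x y => simp [mul_comm]
  rw [superTrace_apply V, trace_eq_sum_coord b]
  simp only [Module.End.mul_apply, lin_ptr c]
  exact key (lin f)

open Classical in
/-- The modified trace of a projective module, normalised by `d(V(1,0)_0) = (q - q⁻¹)⁻¹`: the super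
trace of `φ f`, where `φ` is any weight map with average `1`. Its value is `0` on endomorphisms of
modules which are not projective. -/
noncomputable def modifiedTrace (h : QParam) : ModifiedTrace ℂ (projectives (WtMod h)) where
  tr V :=
    { toFun := fun f => if hV : ∃ φ, V.IsAvgUnit φ then h.diff⁻¹ * V.superTrace (hV.choose * lin f) else 0
      map_add' := fun f g => by
        split_ifs
        · rw [lin_add, mul_add, map_add, mul_add]
        · simp
      map_smul' := fun a f => by
        split_ifs
        · rw [lin_smul, mul_smul_comm, map_smul, smul_eq_mul, smul_eq_mul, RingHom.id_apply,
            mul_left_comm]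
        · simp }
  cyclic V W hV hW f g := by
    have h1 := projectives_iff.1 hV
    have h2 := projectives_iff.1 hW
    simp only [LinearMap.coe_mk, AddHom.coe_mk, dif_pos h1, dif_pos h2]
    rw [superTrace_avgUnit_cyclic h1.choose_spec h2.choose_spec]
  partial_trace V W hV f := by
    have h1 := projectives_iff.1 hV
    have h2 := projectives_iff.1 (isIdeal_projectives.tensor V W hV)
    simp only [LinearMap.coe_mk, AddHom.coe_mk, dif_pos h1, dif_pos h2]
    rw [← superTrace_ptr rfl]
    have := superTrace_avgUnit_cyclic h2.choose_spec (h1.choose_spec.tens W) f (𝟙 _)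
    rw [Category.id_comp, Category.comp_id] at this
    rw [this]

open Classical in
theorem modifiedTrace_tr {V : WtMod h} {φ : Module.End ℂ V.carrier} (hφ : V.IsAvgUnit φ)
    (f : V ⟶ V) : (modifiedTrace h).tr V f = h.diff⁻¹ * V.superTrace (φ * lin f) := by
  have h1 : ∃ φ, V.IsAvgUnit φ := ⟨φ, hφ⟩
  have h2 : (modifiedTrace h).tr V f = if hV : ∃ φ, V.IsAvgUnit φ then
    h.diff⁻¹ * V.superTrace (hV.choose * lin f) else 0 := rfl
  rw [h2, dif_pos h1]
  have := superTrace_avgUnit_cyclic h1.choose_spec hφ f (𝟙 V)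
  rw [Category.id_comp, Category.comp_id] at this
  rw [this]

theorem modifiedTrace_dim_kac {α : ℂ} (hα : h.bracket α ≠ 0) (a : ℂ) (p : ZMod 2) :
    (modifiedTrace h).dim (kac h α a p) = parSign p * (h.pow α - h.pow (-α))⁻¹ := by
  rw [ModifiedTrace.dim, modifiedTrace_tr (isAvgUnit_kac hα a p), ← h.diff_mul_bracket]
  have h1 : ∀ Φ : Module.End ℂ (kac h α a p).carrier,
      Φ = (h.bracket α)⁻¹ • (LinearMap.inl ℂ ℂ ℂ ∘ₗ LinearMap.fst ℂ ℂ ℂ : Module.End ℂ (ℂ × ℂ)) →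
      superTrace (kac h α a p) (Φ * lin (𝟙 (kac h α a p))) =
      LinearMap.trace ℂ (ℂ × ℂ) (LinearMap.prodMap (parSign p • 1) (-parSign p • 1) *
        ((h.bracket α)⁻¹ • (LinearMap.inl ℂ ℂ ℂ ∘ₗ LinearMap.fst ℂ ℂ ℂ))) := by
    rintro _ rfl
    rfl
  have h2 : (LinearMap.prodMap (parSign p • (1 : Module.End ℂ ℂ)) (-parSign p • (1 : Module.End ℂ ℂ)) *
        ((h.bracket α)⁻¹ • (LinearMap.inl ℂ ℂ ℂ ∘ₗ LinearMap.fst ℂ ℂ ℂ)) : Module.End ℂ (ℂ × ℂ)) =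
      LinearMap.prodMap ((parSign p * (h.bracket α)⁻¹) • LinearMap.id) 0 := by
    ext <;> simp [mul_comm]
  rw [h1 _ rfl, h2, LinearMap.trace_prodMap']
  simp [mul_inv]
  ring

end WtMod
namespace WtMod
variable {h : QParam}

/-! ### Domination -/

@[simp] theorem lin_sum {V W : WtMod h} {ι : Type*} (t : Finset ι) (f : ι → (V ⟶ W)) :
    lin (∑ i ∈ t, f i) = ∑ i ∈ t, lin (f i) := by
  classical
  induction t using Finset.induction_on with
  | empty => simp
  | insert a t ha ih => rw [Finset.sum_insert ha, Finset.sum_insert ha, lin_add, ih]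

/-- The identity of `V` is a finite sum of morphisms which factor through objects with the property
`P`. -/
def IsDominatedBy (P : WtMod h → Prop) (V : WtMod h) : Prop :=
  ∃ (ι : Type) (_ : Fintype ι) (W : ι → WtMod h) (s : ∀ i, V ⟶ W i) (t : ∀ i, W i ⟶ V),
    (∀ i, P (W i)) ∧ 𝟙 V = ∑ i, s i ≫ t i

theorem IsDominatedBy.trans {P P' : WtMod h → Prop} {V : WtMod h} (hV : IsDominatedBy P V)
    (hP : ∀ W, P W → IsDominatedBy P' W) : IsDominatedBy P' V := by
  obtain ⟨ι, _, W, s, t, hW, hst⟩ := hV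
  choose κ hκ W' s' t' hW' hst' using fun i => hP (W i) (hW i)
  refine ⟨Σ i, κ i, inferInstance, fun x => W' x.1 x.2, fun x => s x.1 ≫ s' x.1 x.2,
    fun x => t' x.1 x.2 ≫ t x.1, fun x => hW' _ _, ?_⟩
  rw [hst, Fintype.sum_sigma]
  refine Finset.sum_congr rfl fun i _ => ?_
  calc s i ≫ t i = s i ≫ 𝟙 (W i) ≫ t i := by rw [Category.id_comp]
    _ = _ := by
      rw [hst' i, Preadditive.sum_comp, Preadditive.comp_sum]
      simp only [Category.assoc]

theorem IsDominatedBy.isDominating {S : ObjectProperty (WtMod h)} {J : Type*} {E : J → WtMod h}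
    (hE : ∀ j, S (E j))
    (hS : ∀ V, S V → IsDominatedBy (fun W => ∃ j, Nonempty (W ≅ E j)) V) : IsDominating S E := by
  refine ⟨hE, fun V hV => ?_⟩
  obtain ⟨ι, _, W, s, t, hW, hst⟩ := hS V hV
  choose j hj using hW
  let φ := Fintype.equivFin ι
  refine ⟨_, fun k => j (φ.symm k), fun k => (hj (φ.symm k)).some.inv ≫ t (φ.symm k),
    fun k => s (φ.symm k) ≫ (hj (φ.symm k)).some.hom, ?_⟩
  rw [hst, ← φ.symm.sum_comp]
  simp

/-- The object is an induced module, whose generator has the weight of a non-zero vector of `V`. -/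
def IsIndOf (V W : WtMod h) : Prop :=
  ∃ (e g : ℂ) (p : ZMod 2), W = ind h e g p ∧ ∃ v, v ≠ 0 ∧ V.IsWt v e g (parSign p)

/-- The object is a Kac module, whose highest weight is the weight of a non-zero vector of `V`. -/
def IsKacOf (V W : WtMod h) : Prop :=
  ∃ (e g : ℂ) (p : ZMod 2), W = kac h e g p ∧ ∃ v, v ≠ 0 ∧ V.IsWt v e g (parSign p)

/-- If `φ` has average `1`, it is a sum of weight maps of rank one, and the average of a map of rank one
factors through an induced module. -/
theorem isDominatedBy_ind {V : WtMod h} {φ : Module.End ℂ V.carrier} (hφ : V.IsAvgUnit φ) :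
    IsDominatedBy (IsIndOf V) V := by
  obtain ⟨n, b, e, g, s, hb⟩ := V.exists_weightBasis
  choose p hp using fun i => exists_parSign_eq (hb i).sq
  obtain rfl : (fun i => parSign (p i)) = s := funext hp
  have hy : ∀ i, V.IsWt (φ (b i)) (e i) (g i) (parSign (p i)) := fun i => hφ.wt.map_wt (hb i)
  have hξ := fun i => (isWtFunctional_coord b hb i).smulRight (isWt_indGen h (e i) (g i) (p i))
  refine ⟨Fin n, inferInstance, fun i => ind h (e i) (g i) (p i), fun i => avgHom (hξ i),
    fun i => indLift (hy i), fun i => ⟨_, _, _, rfl, b i, b.ne_zero i, hb i⟩, hom_ext ?_⟩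
  rw [lin_sum, lin_id, ← hφ.avg]
  simp only [lin_comp, lin_avgHom, ← avg_lin_comp, ← avg_sum]
  congr 1
  refine b.ext fun i => ?_
  rw [LinearMap.sum_apply, Finset.sum_eq_single i (fun j _ hj => by simp [hj.symm]) (by simp)]
  simp [lin_indLift_gen]

/-- If `[e] ≠ 0` for all weights `e` of `V`, the weight map of average `1` can be chosen with values in
the kernel of `X`, so that Kac modules suffice. -/
theorem isDominatedBy_kac {V : WtMod h}
    (hV : ∀ v e g s, v ≠ 0 → V.IsWt v e g s → h.bracket e ≠ 0) : IsDominatedBy (IsKacOf V) V := by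
  obtain ⟨n, b, e, g, s, hb⟩ := V.exists_weightBasis
  choose p hp using fun i => exists_parSign_eq (hb i).sq
  obtain rfl : (fun i => parSign (p i)) = s := funext hp
  -- with `φ x = [e]⁻² XYx` on vectors of weight `e`, the average of `φ` is the identity
  let y := fun i => (h.bracket (e i))⁻¹ ^ 2 • V.op .X (V.op .Y (b i))
  have hXX := V.X_X_apply
  have hYY := V.Y_Y_apply
  have hX : ∀ i, V.op .X (y i) = 0 := fun i => by simp [y, hXX]
  have hy : ∀ i, V.IsWt (y i) (e i) (g i) (parSign (p i)) := fun i => by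
    have h1 := ((hb i).Y V.isOps).X V.isOps
    refine isWt_of_E_G_Γ ?_ ?_ ?_ (hb i).sq
    · simp only [y, map_smul, h1.E, smul_comm (e i)]
    · simp only [y, map_smul, h1.G, sub_add_cancel, smul_comm (g i)]
    · simp only [y, map_smul, h1.Γ, neg_neg, smul_comm (parSign (p i))]
  let φ : Module.End ℂ V.carrier := b.constr ℂ y
  have hφ : ∀ v e g s, V.IsWt v e g s → φ v = (h.bracket e)⁻¹ ^ 2 • V.op .X (V.op .Y v) := by
    intro v e' g' s' hv
    have h1 : V.op .X (V.op .Y v) = ∑ i, b.repr v i • V.op .X (V.op .Y (b i)) := by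
      have h2 := congrArg (fun v => V.op .X (V.op .Y v)) (b.sum_repr v)
      simp only [map_sum, map_smul] at h2
      exact h2.symm
    rw [h1, Finset.smul_sum, Module.Basis.constr_apply_fintype]
    refine Finset.sum_congr rfl fun i _ => ?_
    rcases eq_or_ne (b.repr v i) 0 with h0 | h0
    · simp [h0]
    · rw [(weight_eq_of_repr_ne_zero hb hv h0).1.symm, smul_comm]
      simp [y]
  have havg : avg V V φ = LinearMap.id := by
    refine b.ext fun i => ?_
    have hbi := hb i
    have hne := hV _ _ _ _ (b.ne_zero i) hbi
    have h2 := XY_apply (hbi.YX V.isOps)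
    have h3 := XY_apply (hbi.X V.isOps)
    rw [hXX, map_zero, sub_zero] at h3
    rw [avg_apply, hφ _ _ _ _ hbi, hφ _ _ _ _ (hbi.Y V.isOps), hφ _ _ _ _ (hbi.X V.isOps),
      hφ _ _ _ _ (hbi.YX V.isOps)]
    simp only [hYY, hXX, h3, map_smul, map_zero, smul_zero, XY_apply hbi, map_sub, sub_zero,
      LinearMap.id_apply, smul_sub, smul_smul]
    match_scalars <;> field_simp <;> ring
  have hξ := fun i => (isWtFunctional_coord b hb i).smulRight (isWt_kacTop h (e i) (g i) (p i))
  refine ⟨Fin n, inferInstance, fun i => kac h (e i) (g i) (p i), fun i => avgHom (hξ i),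
    fun i => kacLift (hy i) (hX i), fun i => ⟨_, _, _, rfl, b i, b.ne_zero i, hb i⟩, hom_ext ?_⟩
  rw [lin_sum, lin_id, ← havg]
  simp only [lin_comp, lin_avgHom, ← avg_lin_comp, ← avg_sum]
  congr 1
  refine b.ext fun i => ?_
  rw [LinearMap.sum_apply, Finset.sum_eq_single i (fun j _ hj => by simp [hj.symm]) (by simp)]
  simp [lin_kacLift_top, φ]

/-! ### Idempotents and indecomposable modules -/

/-- The image of a morphism. -/
noncomputable def rangeObj {V W : WtMod h} (f : V ⟶ W) : WtMod h where
  carrier := LinearMap.range (lin f)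
  op x := (W.op x).restrict (by rintro _ ⟨v, rfl⟩; exact ⟨V.op x v, f.op_apply x v⟩)
  Γ := W.Γ.restrict (by rintro _ ⟨v, rfl⟩; exact ⟨V.Γ v, f.Γ_apply v⟩)
  isOps :=
    { K_Kinv := LinearMap.ext fun v => Subtype.ext (W.isOps.pw.1 _)
      Kinv_K := LinearMap.ext fun v => Subtype.ext (W.isOps.pw.2.1 _)
      K_E := LinearMap.ext fun v => Subtype.ext (LinearMap.congr_fun W.isOps.K_E v.1)
      K_G := LinearMap.ext fun v => Subtype.ext (LinearMap.congr_fun W.isOps.K_G v.1)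
      K_X := LinearMap.ext fun v => Subtype.ext (LinearMap.congr_fun W.isOps.K_X v.1)
      K_Y := LinearMap.ext fun v => Subtype.ext (LinearMap.congr_fun W.isOps.K_Y v.1)
      E_X := LinearMap.ext fun v => Subtype.ext (LinearMap.congr_fun W.isOps.E_X v.1)
      E_Y := LinearMap.ext fun v => Subtype.ext (LinearMap.congr_fun W.isOps.E_Y v.1)
      E_G := LinearMap.ext fun v => Subtype.ext (LinearMap.congr_fun W.isOps.E_G v.1)
      G_X := LinearMap.ext fun v => Subtype.ext (LinearMap.congr_fun W.isOps.G_X v.1)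
      G_Y := LinearMap.ext fun v => Subtype.ext (LinearMap.congr_fun W.isOps.G_Y v.1)
      X_Y := LinearMap.ext fun v => Subtype.ext (LinearMap.congr_fun W.isOps.X_Y v.1)
      X_X := LinearMap.ext fun v => Subtype.ext (LinearMap.congr_fun W.isOps.X_X v.1)
      Y_Y := LinearMap.ext fun v => Subtype.ext (LinearMap.congr_fun W.isOps.Y_Y v.1)
      Γ_Γ := LinearMap.ext fun v => Subtype.ext (LinearMap.congr_fun W.isOps.Γ_Γ v.1)
      Γ_E := LinearMap.ext fun v => Subtype.ext (LinearMap.congr_fun W.isOps.Γ_E v.1)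
      Γ_G := LinearMap.ext fun v => Subtype.ext (LinearMap.congr_fun W.isOps.Γ_G v.1)
      Γ_K := LinearMap.ext fun v => Subtype.ext (LinearMap.congr_fun W.isOps.Γ_K v.1)
      Γ_X := LinearMap.ext fun v => Subtype.ext (LinearMap.congr_fun W.isOps.Γ_X v.1)
      Γ_Y := LinearMap.ext fun v => Subtype.ext (LinearMap.congr_fun W.isOps.Γ_Y v.1)
      span := by
        have h1 : (⊤ : Submodule ℂ (LinearMap.range (lin f))) =
            (Submodule.span ℂ {v | ∃ e g s, V.IsWt v e g s}).map (lin f).rangeRestrict := by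
          rw [V.isOps.span_HW, Submodule.map_top, LinearMap.range_rangeRestrict]
        rw [eq_top_iff, h1, Submodule.map_span, Submodule.span_le]
        rintro _ ⟨v, ⟨e, g, s, hv⟩, rfl⟩
        have hfv := (isWeightMap_lin f).map_wt hv
        exact Submodule.subset_span ⟨e, g, Subtype.ext hfv.E, Subtype.ext hfv.G, Subtype.ext hfv.K⟩ }

/-- The inclusion of the image of a morphism. -/
noncomputable def rangeι {V W : WtMod h} (f : V ⟶ W) : rangeObj f ⟶ W where
  toLin := (LinearMap.range (lin f)).subtype
  op_comm _ := rfl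
  Γ_comm := rfl

/-- The corestriction of a morphism to its image. -/
noncomputable def rangeπ {V W : WtMod h} (f : V ⟶ W) : V ⟶ rangeObj f where
  toLin := (lin f).rangeRestrict
  op_comm x := LinearMap.ext fun v => Subtype.ext (f.op_apply x v)
  Γ_comm := LinearMap.ext fun v => Subtype.ext (f.Γ_apply v)

theorem rangeπ_ι {V W : WtMod h} (f : V ⟶ W) : rangeπ f ≫ rangeι f = f := rfl

theorem isDirectSum_range {V : WtMod h} {n : ℕ} {e : Fin n → (V ⟶ V)} (hsum : 𝟙 V = ∑ i, e i)
    (horth : ∀ i j, i ≠ j → e i ≫ e j = 0) : IsDirectSum V fun i => rangeObj (e i) := by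
  have hid : ∀ i, e i ≫ e i = e i := fun i => by
    have h1 : e i = ∑ j, e i ≫ e j := by rw [← Preadditive.comp_sum, ← hsum, Category.comp_id]
    rw [Finset.sum_eq_single i (fun j _ hj => horth i j hj.symm) (by simp)] at h1
    exact h1.symm
  refine ⟨fun i => rangeι (e i), fun i => rangeπ (e i), by simpa only [rangeπ_ι] using hsum,
    fun i => hom_ext (LinearMap.ext ?_), fun i j hij => hom_ext (LinearMap.ext ?_)⟩
  · rintro ⟨_, v, rfl⟩
    exact Subtype.ext (LinearMap.congr_fun (congrArg lin (hid i)) v)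
  · rintro ⟨_, v, rfl⟩
    exact Subtype.ext (LinearMap.congr_fun (congrArg lin (horth i j hij)) v)

theorem idem_eq_zero_or_one_of_isIndecomposable {V : WtMod h} (hV : IsIndecomposable V)
    {e : V ⟶ V} (he : e ≫ e = e) : e = 0 ∨ e = 𝟙 V := by
  let f : Fin 2 → (V ⟶ V) := ![e, 𝟙 V - e]
  have hf : IsDirectSum V fun i => rangeObj (f i) := by
    refine isDirectSum_range (by simp [f]) fun i j hij => ?_
    fin_cases i <;> fin_cases j <;> simp [f, he] at hij ⊢
  have hz : ∀ i, Limits.IsZero (rangeObj (f i)) → f i = 0 := fun i hi => by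
    rw [← rangeπ_ι (f i), hi.eq_of_src (rangeι (f i)) 0, Limits.comp_zero]
  obtain ⟨i, ⟨-, hi⟩, -⟩ := hV 2 _ hf
  fin_cases i
  · exact Or.inr (sub_eq_zero.1 (hz 1 (hi 1 (by simp)))).symm
  · exact Or.inl (hz 0 (hi 0 (by simp)))

/-- A non-zero module without idempotent endomorphisms other than `0` and `1` is indecomposable. -/
theorem isIndecomposable_of_idem {V : WtMod h} (hV : 𝟙 V ≠ 0)
    (he : ∀ e : V ⟶ V, e ≫ e = e → e = 0 ∨ e = 𝟙 V) : IsIndecomposable V := by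
  rintro n W ⟨t, s, hsum, hid, horth⟩
  obtain ⟨i, hi⟩ : ∃ i, s i ≫ t i ≠ 0 := by
    by_contra! h0
    exact hV (by rw [hsum]; exact Finset.sum_eq_zero fun i _ => h0 i)
  have hi1 : s i ≫ t i = 𝟙 V := (he _ (by
    rw [Category.assoc, ← Category.assoc (t i), hid, Category.id_comp])).resolve_left hi
  have hz : ∀ j, j ≠ i → Limits.IsZero (W j) := fun j hj => by
    rw [Limits.IsZero.iff_id_eq_zero, ← hid j]
    have h1 : s i ≫ t i ≫ s j = s j := by rw [← Category.assoc, hi1, Category.id_comp]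
    rw [horth i j hj.symm, Limits.comp_zero] at h1
    rw [← h1, Limits.comp_zero]
  refine ⟨i, ⟨⟨⟨s i, t i, hi1, hid i⟩⟩, hz⟩, ?_⟩
  rintro j ⟨⟨φ⟩, -⟩
  by_contra hj
  have h1 := (hz j hj).of_iso φ
  exact hV ((Limits.IsZero.iff_id_eq_zero V).1 h1)

theorem isIso_of_bijective {V W : WtMod h} (f : V ⟶ W) (hf : Function.Bijective (lin f)) :
    IsIso f := by
  let φ : V ≅ W := isoOfLinearEquiv (LinearEquiv.ofBijective (lin f) hf) f.op_comm f.Γ_comm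
  exact ⟨φ.inv, φ.hom_inv_id, φ.inv_hom_id⟩

theorem id_ne_zero_of_isIndecomposable {V : WtMod h} (hV : IsIndecomposable V) : 𝟙 V ≠ 0 := by
  intro h0
  obtain ⟨i, -⟩ := hV 0 Fin.elim0 ⟨fun i => i.elim0, fun i => i.elim0, by simpa using h0,
    fun i => i.elim0, fun i => i.elim0⟩
  exact i.elim0

/-- The Fitting lemma. -/
theorem isNilpotent_or_isIso {V : WtMod h} (hV : IsIndecomposable V) (f : V ⟶ V) :
    IsNilpotent (lin f : Module.End ℂ V.carrier) ∨ IsIso f := by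
  have hop : ∀ (T : Module.End ℂ V.carrier), (∀ v, lin f (T v) = T (lin f v)) → ∀ (n : ℕ) (v),
      ((lin f : Module.End ℂ V.carrier) ^ n) (T v) = T (((lin f : Module.End ℂ V.carrier) ^ n) v) := by
    intro T hT n
    induction n with
    | zero => intro v; rfl
    | succ n ih => intro v; rw [pow_succ, Module.End.mul_apply, hT, ih]; rfl
  obtain ⟨n, hn, hc⟩ : ∃ n, 0 < n ∧ IsCompl (LinearMap.ker ((lin f : Module.End ℂ V.carrier) ^ n))
      (LinearMap.range ((lin f : Module.End ℂ V.carrier) ^ n)) :=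
    ((Filter.eventually_gt_atTop 0).and
      (LinearMap.eventually_isCompl_ker_pow_range_pow (lin f))).exists
  have hproj : ∀ (T : Module.End ℂ V.carrier), (∀ v, lin f (T v) = T (lin f v)) →
      Submodule.projection _ _ hc ∘ₗ T = T ∘ₗ Submodule.projection _ _ hc := by
    intro T hT
    ext v
    obtain ⟨a, b, ha, hb, rfl⟩ := Submodule.codisjoint_iff_exists_add_eq.1 hc.codisjoint v
    have ha' : T a ∈ LinearMap.ker ((lin f : Module.End ℂ V.carrier) ^ n) := by
      rw [LinearMap.mem_ker, hop T hT, LinearMap.mem_ker.1 ha, map_zero]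
    have hb' : T b ∈ LinearMap.range ((lin f : Module.End ℂ V.carrier) ^ n) := by
      obtain ⟨c, rfl⟩ := hb
      exact ⟨T c, hop T hT n c⟩
    simp only [LinearMap.comp_apply, map_add, Submodule.projection_apply_of_mem_left hc ha,
      Submodule.projection_apply_of_mem_left hc ha', Submodule.projection_apply_of_mem_right hc hb,
      Submodule.projection_apply_of_mem_right hc hb', map_zero]
  let e : V ⟶ V := ⟨Submodule.projection _ _ hc, fun x => hproj _ (f.op_apply x), hproj _ f.Γ_apply⟩
  have he : e ≫ e = e := hom_ext (LinearMap.ext fun v =>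
    Submodule.projection_apply_of_mem_left hc (Submodule.projection_apply_mem hc v))
  rcases idem_eq_zero_or_one_of_isIndecomposable hV he with h0 | h1
  · right
    have hker : LinearMap.ker (lin f) = ⊥ := by
      rw [LinearMap.ker_eq_bot']
      intro v hv
      have hv' : v ∈ LinearMap.ker ((lin f : Module.End ℂ V.carrier) ^ n) := by
        obtain ⟨m, rfl⟩ := Nat.exists_eq_succ_of_ne_zero hn.ne'
        rw [LinearMap.mem_ker, pow_succ, Module.End.mul_apply, hv, map_zero]
      rw [← Submodule.projection_apply_of_mem_left hc hv']
      exact LinearMap.congr_fun (congrArg lin h0) v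
    exact isIso_of_bijective f ⟨LinearMap.ker_eq_bot.1 hker,
      LinearMap.injective_iff_surjective.1 (LinearMap.ker_eq_bot.1 hker)⟩
  · left
    refine ⟨n, LinearMap.ext fun v => ?_⟩
    have h2 : Submodule.projection _ _ hc v = v := LinearMap.congr_fun (congrArg lin h1) v
    have h3 := Submodule.projection_apply_mem hc v
    rw [h2] at h3
    exact h3

/-- If an indecomposable module is dominated by some modules, it is a retract of one of them: not
all of the summands of the identity are nilpotent, because its trace is not zero. -/
theorem exists_retract_of_isDominatedBy {P : WtMod h → Prop} {V : WtMod h} (hV : IsIndecomposable V)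
    (hP : IsDominatedBy P V) : ∃ (W : WtMod h) (s : V ⟶ W) (t : W ⟶ V), P W ∧ s ≫ t = 𝟙 V := by
  obtain ⟨ι, _, W, s, t, hW, hst⟩ := hP
  by_cases hi : ∃ i, IsIso (s i ≫ t i)
  · obtain ⟨i, hi⟩ := hi
    exact ⟨W i, s i, t i ≫ inv (s i ≫ t i), hW i, by rw [← Category.assoc, IsIso.hom_inv_id]⟩
  · push Not at hi
    exfalso
    have h1 : LinearMap.trace ℂ V.carrier (lin (𝟙 V)) = 0 := by
      rw [hst, lin_sum, map_sum]
      exact Finset.sum_eq_zero fun i _ => (LinearMap.isNilpotent_trace_of_isNilpotent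
        ((isNilpotent_or_isIso hV _).resolve_right (hi i))).eq_zero
    rw [lin_id, LinearMap.trace_id, Nat.cast_eq_zero, Module.finrank_zero_iff] at h1
    exact id_ne_zero_of_isIndecomposable hV (hom_ext (LinearMap.ext fun v => Subsingleton.elim _ _))

theorem iso_of_retract {V W : WtMod h} (hV : 𝟙 V ≠ 0)
    (hW : ∀ e : W ⟶ W, e ≫ e = e → e = 0 ∨ e = 𝟙 W) {s : V ⟶ W} {t : W ⟶ V} (hst : s ≫ t = 𝟙 V) :
    Nonempty (V ≅ W) := by
  have h1 : (t ≫ s) ≫ t ≫ s = t ≫ s := by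
    rw [Category.assoc, ← Category.assoc s, hst, Category.id_comp]
  rcases hW _ h1 with h2 | h2
  · refine absurd ?_ hV
    calc 𝟙 V = (s ≫ t) ≫ s ≫ t := by rw [hst, Category.comp_id]
      _ = s ≫ (t ≫ s) ≫ t := by simp only [Category.assoc]
      _ = 0 := by rw [h2, Limits.zero_comp, Limits.comp_zero]
  · exact ⟨⟨s, t, hst, h2⟩⟩

/-- Projective modules are dominated by projective indecomposable ones. -/
theorem isDominatedBy_indecomposable {V : WtMod h} (hV : projectives (WtMod h) V) :
    IsDominatedBy (fun P => projectives (WtMod h) P ∧ IsIndecomposable P) V := by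
  induction hn : Module.finrank ℂ V.carrier using Nat.strong_induction_on generalizing V with
  | _ n ih =>
    subst hn
    by_cases hi : IsIndecomposable V
    · exact ⟨Unit, inferInstance, fun _ => V, fun _ => 𝟙 V, fun _ => 𝟙 V, fun _ => ⟨hV, hi⟩, by simp⟩
    by_cases h0 : 𝟙 V = 0
    · exact ⟨Empty, inferInstance, Empty.elim, fun i => i.elim, fun i => i.elim, fun i => i.elim,
        by simpa using h0⟩
    unfold IsIndecomposable at hi
    push Not at hi
    obtain ⟨m, W, hW, hne⟩ := hi
    obtain ⟨t, s, hsum, hid, horth⟩ := hW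
    have hinj : ∀ i, Function.Injective (lin (t i)) := fun i =>
      Function.LeftInverse.injective (g := lin (s i)) (LinearMap.congr_fun (congrArg lin (hid i)))
    have hlt : ∀ i, Module.finrank ℂ (W i).carrier < Module.finrank ℂ V.carrier := by
      intro i
      refine lt_of_le_of_ne (LinearMap.finrank_le_finrank_of_injective (hinj i)) fun heq => hne ?_
      have hiso : IsIso (t i) := isIso_of_bijective _ ⟨hinj i,
        (LinearMap.injective_iff_surjective_of_finrank_eq_finrank heq).1 (hinj i)⟩
      have hz : ∀ j, j ≠ i → Limits.IsZero (W j) := fun j hj => by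
        rw [Limits.IsZero.iff_id_eq_zero, ← hid j, (cancel_epi (t i)).1
          ((horth i j hj.symm).trans Limits.comp_zero.symm), Limits.comp_zero]
      refine ⟨i, ⟨⟨(asIso (t i)).symm⟩, hz⟩, ?_⟩
      rintro j ⟨⟨φ⟩, -⟩
      by_contra hj
      exact h0 ((Limits.IsZero.iff_id_eq_zero V).1 ((hz j hj).of_iso φ))
    have hdom : IsDominatedBy (fun P => ∃ i, P = W i) V :=
      ⟨Fin m, inferInstance, W, s, t, fun i => ⟨i, rfl⟩, hsum⟩
    refine hdom.trans ?_
    rintro _ ⟨i, rfl⟩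
    exact ih _ (hlt i) (isIdeal_projectives.retract _ _ _ _ hV (hid i)) rfl

theorem exists_eq_smul_kacTop {α a : ℂ} {p : ZMod 2} {x : (kac h α a p).carrier}
    (hx : (kac h α a p).op .G x = a • x) : ∃ c : ℂ, x = c • kacTop h α a p := by
  have key : ∀ y : ℂ × ℂ, kacOps h α a .G y = a • y → ∃ c : ℂ, y = c • ((1, 0) : ℂ × ℂ) := by
    rintro ⟨c, d⟩ hy
    have h1 : (a - 1) * d = a * d := by simpa [kacOps] using congrArg Prod.snd hy
    have hd : d = 0 := by linear_combination -h1
    exact ⟨c, by simp [hd]⟩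
  exact key x hx

theorem exists_eq_smul_id_kac {α a : ℂ} {p : ZMod 2} (f : kac h α a p ⟶ kac h α a p) :
    ∃ c : ℂ, f = c • 𝟙 _ := by
  obtain ⟨c, hc⟩ := exists_eq_smul_kacTop ((isWeightMap_lin f).map_wt (isWt_kacTop h α a p)).G
  exact ⟨c, kac_hom_ext hc⟩

theorem idem_kac {α a : ℂ} {p : ZMod 2} (f : kac h α a p ⟶ kac h α a p) (hf : f ≫ f = f) :
    f = 0 ∨ f = 𝟙 _ := by
  obtain ⟨c, rfl⟩ := exists_eq_smul_id_kac f
  have h1 : c * c = c := by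
    have h2 := LinearMap.congr_fun (congrArg lin hf) (kacTop h α a p)
    rw [lin_comp, lin_smul, lin_id, LinearMap.comp_apply, LinearMap.smul_apply,
      LinearMap.smul_apply, LinearMap.id_apply, LinearMap.id_apply, smul_smul] at h2
    exact smul_left_injective ℂ (kacTop_ne_zero α a p) h2
  rcases (IsIdempotentElem.iff_eq_zero_or_one (p := c)).1 h1 with rfl | rfl
  · left; rw [zero_smul]
  · right; rw [one_smul]

theorem exists_eq_smul_indGen_add {e g : ℂ} {p : ZMod 2} {x : (ind h e g p).carrier}
    (hx : (ind h e g p).op .G x = g • x) : ∃ c d : ℂ, x = c • indGen h e g p +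
      d • (ind h e g p).op .Y ((ind h e g p).op .X (indGen h e g p)) := by
  have key : ∀ y : ℂ × ℂ × ℂ × ℂ, indOps h e g .G y = g • y → ∃ c d : ℂ,
      y = c • ((1, 0, 0, 0) : ℂ × ℂ × ℂ × ℂ) +
        d • indOps h e g .Y (indOps h e g .X (1, 0, 0, 0)) := by
    rintro ⟨x, y, z, t⟩ hy
    have h1 : (g + 1) * y = g * y := by simpa [indOps] using congrArg (fun u => u.2.1) hy
    have h2 : (g - 1) * z = g * z := by simpa [indOps] using congrArg (fun u => u.2.2.1) hy
    have h3 : y = 0 := by linear_combination h1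
    have h4 : z = 0 := by linear_combination -h2
    exact ⟨x, t, by simp [indOps, h3, h4]⟩
  exact key x hx

/-- The induced module of weight `e` with `[e] = 0` has a local endomorphism ring, spanned by the
identity and a nilpotent endomorphism. -/
theorem idem_ind {e g : ℂ} {p : ZMod 2} (he : h.bracket e = 0) (f : ind h e g p ⟶ ind h e g p)
    (hf : f ≫ f = f) : f = 0 ∨ f = 𝟙 _ := by
  have hw := isWt_indGen h e g p
  obtain ⟨c, d, hc⟩ := exists_eq_smul_indGen_add ((isWeightMap_lin f).map_wt hw).G
  have h3 := LinearMap.congr_fun (congrArg lin hf) (indGen h e g p)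
  have hXX := (ind h e g p).X_X_apply
  have hYX : (ind h e g p).op .Y ((ind h e g p).op .X ((ind h e g p).op .Y
      ((ind h e g p).op .X (indGen h e g p)))) = 0 := by
    rw [XY_apply (hw.X (ind h e g p).isOps), he, hXX, zero_smul, map_zero, sub_zero, map_zero]
  rw [lin_comp, LinearMap.comp_apply, hc, map_add, map_smul, map_smul, f.op_apply, f.op_apply,
    hc] at h3
  simp only [map_add, map_smul, hYX, smul_zero, add_zero] at h3
  have key : ∀ c d c' d' : ℂ, c • ((1, 0, 0, 0) : ℂ × ℂ × ℂ × ℂ) +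
      d • indOps h e g .Y (indOps h e g .X (1, 0, 0, 0)) = c' • ((1, 0, 0, 0) : ℂ × ℂ × ℂ × ℂ) +
      d' • indOps h e g .Y (indOps h e g .X (1, 0, 0, 0)) → c = c' ∧ d = d' := by
    intro c d c' d' hcd
    simpa [indOps] using hcd
  have h4 : (c * c) • indGen h e g p + (2 * (c * d)) •
      (ind h e g p).op .Y ((ind h e g p).op .X (indGen h e g p)) = c • indGen h e g p +
        d • (ind h e g p).op .Y ((ind h e g p).op .X (indGen h e g p)) := by
    rw [← h3]; module
  obtain ⟨h5, h6⟩ := key _ _ _ _ h4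
  rcases (IsIdempotentElem.iff_eq_zero_or_one (p := c)).1 h5 with rfl | rfl
  · left
    have hd : d = 0 := by linear_combination -h6
    exact ind_hom_ext (by rw [hc, hd]; simp)
  · right
    have hd : d = 0 := by linear_combination h6
    exact ind_hom_ext (by rw [hc, hd]; simp)

end WtMod
namespace WtMod
variable {h : QParam}

/-! ### Loops coloured by Kac modules -/

theorem parSign_zero : parSign 0 = 1 := if_pos rfl

theorem hw_kac_fst (h : QParam) (α a : ℂ) : HW h (kacOps h α a)
    (LinearMap.prodMap (parSign 0 • 1) (-parSign 0 • 1)) (1, 0) α a 1 := by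
  have h1 := isWt_kacTop h α a 0
  rw [parSign_zero] at h1
  exact h1

theorem hw_kac_snd (h : QParam) (α a : ℂ) : HW h (kacOps h α a)
    (LinearMap.prodMap (parSign 0 • 1) (-parSign 0 • 1)) (0, 1) α (a - 1) (-1) := by
  have h1 := isWt_kacBot h α a 0
  rw [parSign_zero] at h1
  exact h1

theorem kacOps_basis (h : QParam) (α a : ℂ) : kacOps h α a .X (1, 0) = 0 ∧
    kacOps h α a .Y (1, 0) = (0, 1) ∧ kacOps h α a .X (0, 1) = h.bracket α • (1, 0) ∧
    kacOps h α a .Y (0, 1) = 0 := by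
  simp [kacOps, QParam.bracket]

/-- A loop coloured by `V(α, a)` around a vector of weight `(e, g)`, computed for the bare operators: the
carrier of the bundled Kac module is only definitionally equal to `ℂ × ℂ`. -/
theorem raw_posLoop {A : Type} [AddCommGroup A] [Module ℂ A] [FiniteDimensional ℂ A]
    {ρ : Gen → Module.End ℂ A} {Γ : Module.End ℂ A} (o : IsOps h ρ Γ) {v : A} {e g s : ℂ}
    (hv : HW h ρ Γ v e g s) (α a : ℂ) :
    ∑ i, TensorProduct.rid ℂ A (map LinearMap.id ((Module.Basis.finTwoProd ℂ).coord i ∘ₗ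
        LinearMap.prodMap (parSign 0 • 1) (-parSign 0 • 1) ∘ₗ kacOps h α a .K)
      (braidMap h (kacOps h α a) (LinearMap.prodMap (parSign 0 • 1) (-parSign 0 • 1)) ρ Γ
        (braidMap h ρ Γ (kacOps h α a) (LinearMap.prodMap (parSign 0 • 1) (-parSign 0 • 1))
          (v ⊗ₜ[ℂ] Module.Basis.finTwoProd ℂ i)))) =
    ((h.pow (e * a) * h.pow (g * α))⁻¹ ^ 2) • (h.diff * h.pow e * (h.pow α - (h.pow α)⁻¹)) •
        ρ .Y (ρ .X v) -
      ((h.pow (e * a) * h.pow (g * α))⁻¹ ^ 2) •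
        (h.pow α * (h.pow e * (h.pow e - (h.pow e)⁻¹))) • v := by
  have hT := hw_kac_fst h α a
  have hB := hw_kac_snd h α a
  have oW := isOps_kac h α a 0
  have hd := h.diff_ne_zero
  have p1 := h.pow_ne_zero e
  have p2 := h.pow_ne_zero α
  have p3 := h.pow_ne_zero (e * a)
  have p4 := h.pow_ne_zero (g * α)
  have e1 : h.pow (a * e) = h.pow (e * a) := by rw [mul_comm]
  have e2 : h.pow (α * g) = h.pow (g * α) := by rw [mul_comm]
  have e3 : h.pow (α * e) = h.pow (e * α) := by rw [mul_comm]
  have p5 := h.pow_ne_zero (e * α)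
  obtain ⟨k1, k2, k3, k4⟩ := kacOps_basis h α a
  simp only [Fin.sum_univ_two, Module.Basis.finTwoProd_zero, Module.Basis.finTwoProd_one,
    braidMap_apply o oW hv hT, braidMap_apply o oW hv hB, k1, k2, k3, k4, zero_tmul, tmul_zero,
    smul_zero, add_zero, map_add, map_smul, braidMap_apply oW o hT hv, braidMap_apply oW o hB hv,
    braidMap_apply oW o hB (hv.X o), map_tmul, LinearMap.comp_apply, LinearMap.id_apply,
    hT.K, hB.K, hT.Γ, hB.Γ, TensorProduct.rid_tmul, ← smul_tmul', tmul_smul,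
    Module.Basis.coord_apply]
  have b1 : (Module.Basis.finTwoProd ℂ).repr (1, 0) 0 = 1 := by simp
  have b2 : (Module.Basis.finTwoProd ℂ).repr (1, 0) 1 = 0 := by simp
  have b3 : (Module.Basis.finTwoProd ℂ).repr (0, 1) 0 = 0 := by simp
  have b4 : (Module.Basis.finTwoProd ℂ).repr (0, 1) 1 = 1 := by simp
  simp only [b1, b2, b3, b4, map_smul, Finsupp.smul_apply, smul_eq_mul, QParam.bracket, h.pow_neg,
    mul_sub, sub_mul, mul_add, add_mul, mul_one, one_mul, h.pow_add, h.pow_sub, e1, e2, e3, smul_smul]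
  rcases hv.sq with rfl | rfl <;>
    match_scalars <;> field_simp <;> ring

theorem raw_negLoop {A : Type} [AddCommGroup A] [Module ℂ A] [FiniteDimensional ℂ A]
    {ρ : Gen → Module.End ℂ A} {Γ : Module.End ℂ A} (o : IsOps h ρ Γ) {v : A} {e g s : ℂ}
    (hv : HW h ρ Γ v e g s) (α a : ℂ) :
    ∑ i, TensorProduct.rid ℂ A (map LinearMap.id ((Module.Basis.finTwoProd ℂ).coord i ∘ₗ
        LinearMap.prodMap (parSign 0 • 1) (-parSign 0 • 1) ∘ₗ kacOps h α a .K)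
      (braidInv h ρ Γ (kacOps h α a) (LinearMap.prodMap (parSign 0 • 1) (-parSign 0 • 1))
        (braidInv h (kacOps h α a) (LinearMap.prodMap (parSign 0 • 1) (-parSign 0 • 1)) ρ Γ
          (v ⊗ₜ[ℂ] Module.Basis.finTwoProd ℂ i)))) =
    ((h.pow (e * a) * h.pow (g * α)) ^ 2) •
        (h.pow α * ((h.pow e)⁻¹ * (h.pow e - (h.pow e)⁻¹))) • v -
      ((h.pow (e * a) * h.pow (g * α)) ^ 2) •
        (h.diff * (h.pow e)⁻¹ * (h.pow α - (h.pow α)⁻¹)) • ρ .X (ρ .Y v) := by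
  have hT := hw_kac_fst h α a
  have hB := hw_kac_snd h α a
  have oW := isOps_kac h α a 0
  have hd := h.diff_ne_zero
  have p1 := h.pow_ne_zero e
  have p2 := h.pow_ne_zero α
  have p3 := h.pow_ne_zero (e * a)
  have p4 := h.pow_ne_zero (g * α)
  have e1 : h.pow (a * e) = h.pow (e * a) := by rw [mul_comm]
  have e2 : h.pow (α * g) = h.pow (g * α) := by rw [mul_comm]
  have e3 : h.pow (α * e) = h.pow (e * α) := by rw [mul_comm]
  have p5 := h.pow_ne_zero (e * α)
  obtain ⟨k1, k2, k3, k4⟩ := kacOps_basis h α a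
  simp only [Fin.sum_univ_two, Module.Basis.finTwoProd_zero, Module.Basis.finTwoProd_one,
    braidInv_apply oW o hT hv, braidInv_apply oW o hB hv, k1, k2, k3, k4, zero_tmul, tmul_zero,
    smul_zero, add_zero, sub_zero, map_sub, map_smul, braidInv_apply o oW hv hT,
    braidInv_apply o oW hv hB,
    braidInv_apply o oW (hv.Y o) hT, map_tmul, LinearMap.comp_apply, LinearMap.id_apply,
    hT.K, hB.K, hT.Γ, hB.Γ, TensorProduct.rid_tmul, ← smul_tmul', tmul_smul,
    Module.Basis.coord_apply]
  have b1 : (Module.Basis.finTwoProd ℂ).repr (1, 0) 0 = 1 := by simp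
  have b2 : (Module.Basis.finTwoProd ℂ).repr (1, 0) 1 = 0 := by simp
  have b3 : (Module.Basis.finTwoProd ℂ).repr (0, 1) 0 = 0 := by simp
  have b4 : (Module.Basis.finTwoProd ℂ).repr (0, 1) 1 = 1 := by simp
  simp only [b1, b2, b3, b4, map_smul, Finsupp.smul_apply, smul_eq_mul, QParam.bracket, h.pow_neg,
    mul_sub, sub_mul, mul_add, add_mul, mul_one, one_mul, h.pow_add, h.pow_sub, e1, e2, e3, smul_smul]
  rcases hv.sq with rfl | rfl <;>
    match_scalars <;> field_simp <;> ring

/-- A loop coloured by `V(α, a)`, with two positive crossings, acts on vectors of weight `(e, g)` by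
`q ^ (-2 (e a + g α))` times a linear combination of `YX` and the identity. -/
theorem lin_posLoop_kac {V : WtMod h} {v : V.carrier} {e g s : ℂ} (hv : V.IsWt v e g s)
    {α a c : ℂ} {f : kac h α a 0 ⟶ kac h α a 0} (hf : f = c • 𝟙 _) :
    lin (posLoop (kac h α a 0) V f) v = (c * (h.pow (e * a) * h.pow (g * α))⁻¹ ^ 2) •
      ((h.diff * h.pow e * (h.pow α - (h.pow α)⁻¹)) • V.op .Y (V.op .X v) -
        (h.pow α * (h.pow e * (h.pow e - (h.pow e)⁻¹))) • v) := by
  have h1 : posLoop (kac h α a 0) V f = c • posLoop (kac h α a 0) V (𝟙 _) := by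
    rw [hf]
    simp [posLoop, ptr]
  rw [h1, lin_smul, LinearMap.smul_apply, mul_smul, smul_sub (_ ^ 2 : ℂ),
    ← raw_posLoop V.isOps hv α a, posLoop, lin_ptr (Module.Basis.finTwoProd ℂ)]
  congr 1

theorem lin_negLoop_kac {V : WtMod h} {v : V.carrier} {e g s : ℂ} (hv : V.IsWt v e g s)
    {α a c : ℂ} {f : kac h α a 0 ⟶ kac h α a 0} (hf : f = c • 𝟙 _) :
    lin (negLoop (kac h α a 0) V f) v = (c * (h.pow (e * a) * h.pow (g * α)) ^ 2) •
      ((h.pow α * ((h.pow e)⁻¹ * (h.pow e - (h.pow e)⁻¹))) • v -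
        (h.diff * (h.pow e)⁻¹ * (h.pow α - (h.pow α)⁻¹)) • V.op .X (V.op .Y v)) := by
  have h1 : negLoop (kac h α a 0) V f = c • negLoop (kac h α a 0) V (𝟙 _) := by
    rw [hf]
    simp [negLoop, ptr]
  rw [h1, lin_smul, LinearMap.smul_apply, mul_smul, smul_sub (_ ^ 2 : ℂ),
    ← raw_negLoop V.isOps hv α a, negLoop, lin_ptr (Module.Basis.finTwoProd ℂ)]
  congr 1

/-- The twist of a Kac module is a scalar. -/
theorem twist_kac_hom (h : QParam) (α a : ℂ) (p : ZMod 2) : (θ_ (kac h α a p)).hom =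
    ((h.pow (α * a))⁻¹ ^ 2 * h.pow α) • 𝟙 _ := by
  refine kac_hom_ext ?_
  refine (twistMap_apply (kac h α a p).isOps (isWt_kacTop h α a p)).trans ?_
  rw [X_kacTop, map_zero, smul_zero, sub_zero, ← pow_two]
  rfl

theorem twist_kac_inv (h : QParam) (α a : ℂ) (p : ZMod 2) : (θ_ (kac h α a p)).inv =
    (h.pow (α * a) ^ 2 * (h.pow α)⁻¹) • 𝟙 _ := by
  refine kac_hom_ext ?_
  refine (twistInv_apply (kac h α a p).isOps (isWt_kacTop h α a p)).trans ?_
  rw [X_kacTop, map_zero, smul_zero, add_zero, ← pow_two]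
  rfl

end WtMod
/-! ### Sums of powers of the root of unity -/

theorem CmodZ_eq_iff {x y : ℂ} : (x : CmodZ) = y ↔ ∃ n : ℤ, x = y + n := by
  rw [QuotientAddGroup.eq_iff_sub_mem, AddSubgroup.mem_zmultiples_iff]
  refine exists_congr fun n => ?_
  rw [zsmul_one, eq_comm, sub_eq_iff_eq_add']

theorem root_pow_eq_one_iff {r : ℕ} {hr : 3 ≤ r} {z : ℂ} :
    (root r hr).pow z = 1 ↔ ∃ n : ℤ, z = n * r := by
  have h0 : (r : ℂ) ≠ 0 := by exact_mod_cast (by omega : r ≠ 0)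
  rw [QParam.pow, Complex.exp_eq_one_iff]
  refine exists_congr fun n => ?_
  have h1 := Complex.two_pi_I_ne_zero
  rw [root, div_mul_eq_mul_div, div_eq_iff h0]
  exact ⟨fun h => mul_left_cancel₀ h1 (by linear_combination h), by rintro rfl; ring⟩

theorem root_pow_intCast_eq_one_iff {r : ℕ} {hr : 3 ≤ r} {n : ℤ} :
    (root r hr).pow n = 1 ↔ (r : ℤ) ∣ n := by
  rw [root_pow_eq_one_iff, dvd_def]
  refine exists_congr fun k => ?_
  rw [mul_comm]
  exact_mod_cast Iff.rfl

theorem QParam.pow_natCast_mul (h : QParam) (z : ℂ) (n : ℕ) : h.pow (z * n) = h.pow z ^ n := by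
  rw [pow, pow, ← Complex.exp_nat_mul]
  ring_nf

/-- As `r` is odd, `2` is invertible modulo `r` and the geometric sum vanishes unless `r ∣ m`. -/
theorem sum_root_pow {r : ℕ} {hr : 3 ≤ r} (hodd : Odd r) {ε : ℤ} (hε : ε = 1 ∨ ε = -1) (m : ℤ) :
    ∑ j : Fin r, (root r hr).pow ((ε * 2 * m : ℤ) * (j : ℕ)) = if (r : ℤ) ∣ m then (r : ℂ) else 0 := by
  have h1 : (r : ℤ) ∣ ε * 2 * m ↔ (r : ℤ) ∣ m := by
    refine ⟨fun hd => ?_, fun hd => Dvd.dvd.mul_left hd _⟩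
    refine IsCoprime.dvd_of_dvd_mul_left ?_ hd
    have h2 : IsCoprime (r : ℤ) 2 := by
      have := Nat.Coprime.symm (Nat.coprime_two_left.2 hodd)
      exact_mod_cast Nat.isCoprime_iff_coprime.2 this
    rcases hε with rfl | rfl
    · simpa using h2
    · simpa using h2.neg_right
  simp only [QParam.pow_natCast_mul]
  rw [Fin.sum_univ_eq_sum_range (fun j => (root r hr).pow (ε * 2 * m : ℤ) ^ j) r]
  split_ifs with hd
  · rw [root_pow_intCast_eq_one_iff.2 (h1.2 hd)]
    simp
  · have h2 : (root r hr).pow (ε * 2 * m : ℤ) - 1 ≠ 0 := fun h3 =>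
      hd (h1.1 (root_pow_intCast_eq_one_iff.1 (sub_eq_zero.1 h3)))
    refine (mul_eq_zero.1 ?_).resolve_left h2
    rw [mul_geom_sum, ← QParam.pow_natCast_mul, root_pow, sub_self]

/-- Among `r` consecutive integers exactly one is divisible by `r`. -/
theorem exists_unique_dvd {r : ℕ} (hr : 3 ≤ r) (n : ℤ) :
    ∃ i₀ : Fin r, ∀ i : Fin r, (r : ℤ) ∣ n + (i : ℕ) ↔ i = i₀ := by
  have hr0 : (r : ℤ) ≠ 0 := by omega
  have h0 := Int.emod_nonneg (-n) hr0
  have h1 := Int.emod_lt_of_pos (-n) (by omega : (0 : ℤ) < r)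
  refine ⟨⟨((-n) % r).toNat, by omega⟩, fun i => ?_⟩
  have h2 := Int.mul_ediv_add_emod (-n) r
  have hi := i.2
  rw [Fin.ext_iff]
  constructor
  · rintro ⟨k, hk⟩
    have h3 : (-n) % r = (i : ℕ) := by
      have : -n = (i : ℕ) + r * (-k) := by linarith
      rw [this, Int.add_mul_emod_self_left]
      exact Int.emod_eq_of_lt (by omega) (by omega)
    show (i : ℕ) = ((-n) % r).toNat
    omega
  · intro h3
    have h3' : (i : ℕ) = ((-n) % r).toNat := h3
    refine ⟨-(-n / r), ?_⟩
    rw [mul_neg]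
    omega

/-- The resonance which underlies the stabilisation: among the weights `α₀ + i`, the sum over
the weights `a₀ + j` selects the one with the same power of `q` as `e`. -/
theorem sum_resonance {r : ℕ} {hr : 3 ≤ r} (hodd : Odd r) {ε : ℤ} (hε : ε = 1 ∨ ε = -1)
    {α₀ a₀ e g : ℂ} {n m : ℤ} (he : α₀ = e + n) (hg : g = a₀ + m)
    {M : Type} [AddCommGroup M] [Module ℂ M] {u : ℂ → M}
    (hu : ∀ α, (root r hr).pow α = (root r hr).pow e → u α = u e) :
    ∑ i : Fin r × Fin r, (root r hr).pow (ε * 2 * ((α₀ + (i.1 : ℕ)) * (a₀ + (i.2 : ℕ)) -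
      e * (a₀ + (i.2 : ℕ)) - g * (α₀ + (i.1 : ℕ)))) • u (α₀ + (i.1 : ℕ)) =
    ((r : ℂ) * (root r hr).pow (-(ε * 2 * (e * g)))) • u e := by
  obtain ⟨i₀, hi₀⟩ := exists_unique_dvd hr n
  have h1 : ∀ i : Fin r, ∑ j : Fin r, (root r hr).pow (ε * 2 * ((α₀ + (i : ℕ)) *
      (a₀ + (j : ℕ)) - e * (a₀ + (j : ℕ)) - g * (α₀ + (i : ℕ)))) • u (α₀ + (i : ℕ)) =
      if i = i₀ then ((r : ℂ) * (root r hr).pow (-(ε * 2 * (e * g)))) • u e else 0 := by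
    intro i
    have h2 : ∀ j : Fin r, (root r hr).pow (ε * 2 * ((α₀ + (i : ℕ)) *
        (a₀ + (j : ℕ)) - e * (a₀ + (j : ℕ)) - g * (α₀ + (i : ℕ)))) =
        (root r hr).pow (ε * 2 * ((n + (i : ℕ)) * a₀ - g * (α₀ + (i : ℕ)))) *
          (root r hr).pow ((ε * 2 * (n + (i : ℕ)) : ℤ) * (j : ℕ)) := by
      intro j
      rw [← QParam.pow_add, he]
      congr 1
      push_cast
      ring
    simp only [h2]
    rw [← Finset.sum_smul, ← Finset.mul_sum, sum_root_pow hodd hε]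
    simp only [hi₀]
    split_ifs with hi
    · obtain ⟨k, hk⟩ := (hi₀ i).2 hi
      have hk' : (n : ℂ) + (i : ℕ) = k * r := by
        have : ((n + (i : ℕ) : ℤ) : ℂ) = ((r * k : ℤ) : ℂ) := by rw [hk]
        push_cast at this
        rw [this, mul_comm]
      have hα : α₀ + (i : ℕ) = e + k * r := by rw [he, ← hk']; ring
      have h3 : u (α₀ + (i : ℕ)) = u e := hu _ (by
        rw [hα, QParam.pow_add, root_pow, mul_one])
      have h4 : ε * 2 * (((n : ℂ) + (i : ℕ)) * a₀ - g * (α₀ + (i : ℕ))) =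
          -(ε * 2 * (e * g)) + ((-(ε * 2 * m * k) : ℤ) : ℂ) * r := by
        rw [hk', hα, hg]
        push_cast
        ring
      rw [h3, h4, QParam.pow_add, root_pow, mul_one, mul_comm]
    · rw [mul_zero, zero_smul]
  rw [Fintype.sum_prod_type]
  simp only [h1]
  simp

/-- The quantum number `[α]` vanishes only if `2α` is a multiple of `r`, hence only if the class of `α`
is that of `0` or of `1 / 2`. -/
theorem typical_of_notMem_critical {r : ℕ} {hr : 3 ≤ r} {g : CmodZ × CmodZ} (hg : g ∉ critical)
    {α : ℂ} (hα : (α : CmodZ) = g.1) : (root r hr).bracket α ≠ 0 := by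
  intro h0
  have hq := (root r hr).diff_mul_bracket α
  have hp := (root r hr).pow_ne_zero α
  rw [h0, mul_zero, QParam.pow_neg, eq_comm, sub_eq_zero, ← mul_eq_one_iff_eq_inv₀ hp,
    ← QParam.pow_add, root_pow_eq_one_iff] at hq
  obtain ⟨n, hn⟩ := hq
  have h2 : α = ((n * r : ℤ) : ℂ) / 2 := by push_cast; linear_combination hn / 2
  refine hg ?_
  rw [critical, Set.mem_ofPred_eq, ← hα, CmodZ_eq_iff, CmodZ_eq_iff, h2]
  rcases Int.even_or_odd' (n * r) with ⟨k, hk | hk⟩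
  · left; exact ⟨k, by rw [hk]; push_cast; ring⟩
  · right; exact ⟨k, by rw [hk]; push_cast; ring⟩

namespace WtMod

theorem weightDegree_apply {h : QParam} {g : CmodZ × CmodZ} {V : WtMod h} (hV : weightDegree h g V)
    {v : V.carrier} (hv0 : v ≠ 0) {e b s : ℂ} (hv : V.IsWt v e b s) :
    (e : CmodZ) = g.1 ∧ (b : CmodZ) = g.2 := by
  have := hV e b v hv0 hv.E hv.G
  exact ⟨congrArg Prod.fst this, congrArg Prod.snd this⟩

end WtMod

/-! ### Stabilisation -/

section
variable {r : ℕ} {hr : 3 ≤ r} {lift : CmodZ × CmodZ → ℂ × ℂ}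

theorem lift_weight (hlift : ∀ g, (((lift g).1 : CmodZ), ((lift g).2 : CmodZ)) = g)
    {g : CmodZ × CmodZ} {V : WtMod (root r hr)} (hV : weightDegree (root r hr) g V) {v : V.carrier} (hv0 : v ≠ 0) {e b s : ℂ} (hv : V.IsWt v e b s) :
    (∃ n : ℤ, (lift g).1 = e + n) ∧ ∃ m : ℤ, b = (lift g).2 + m := by
  obtain ⟨h1, h2⟩ := WtMod.weightDegree_apply hV hv0 hv
  have h3 := hlift g
  have h4 : ((lift g).1 : CmodZ) = g.1 := congrArg Prod.fst h3
  have h5 : ((lift g).2 : CmodZ) = g.2 := congrArg Prod.snd h3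
  exact ⟨CmodZ_eq_iff.1 (h4.trans h1.symm), CmodZ_eq_iff.1 (h2.trans h5.symm)⟩

theorem bracket_generic (hlift : ∀ g, (((lift g).1 : CmodZ), ((lift g).2 : CmodZ)) = g)
    {g : CmodZ × CmodZ} (hg : g ∉ critical) (n : ℕ) :
    (root r hr).bracket ((lift g).1 + n) ≠ 0 := by
  refine typical_of_notMem_critical hg ?_
  have h4 : ((lift g).1 : CmodZ) = g.1 := congrArg Prod.fst (hlift g)
  exact (CmodZ_eq_iff.2 ⟨n, by simp⟩).trans h4

theorem generic_dim (hlift : ∀ g, (((lift g).1 : CmodZ), ((lift g).2 : CmodZ)) = g)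
    {g : CmodZ × CmodZ} (hg : g ∉ critical) (i : Fin r × Fin r) :
    (WtMod.modifiedTrace (root r hr)).dim (generic r hr lift g i) =
      ((root r hr).pow ((lift g).1 + (i.1 : ℕ)) -
        ((root r hr).pow ((lift g).1 + (i.1 : ℕ)))⁻¹)⁻¹ := by
  rw [generic, WtMod.modifiedTrace_dim_kac (bracket_generic hlift hg i.1), WtMod.parSign_zero,
    one_mul, QParam.pow_neg]

theorem sub_inv_ne_zero_of_bracket {h : QParam} {z : ℂ} (hz : h.bracket z ≠ 0) :
    h.pow z - (h.pow z)⁻¹ ≠ 0 := by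
  rw [← h.pow_neg, ← h.diff_mul_bracket]
  exact mul_ne_zero h.diff_ne_zero hz

/-- The loop coloured by `V(α₀ + i, a₀ + j)` acts on a vector of weight `(e, b)` with a power of `q`
which is, as a function of `j`, a non-trivial character of `ℤ / r` unless `q ^ (α₀ + i) = q ^ e`. The
remaining summand is the twist up to the factor `-r`. -/
theorem stabilisation_minus (hodd : Odd r)
    (hlift : ∀ g, (((lift g).1 : CmodZ), ((lift g).2 : CmodZ)) = g) {g : CmodZ × CmodZ}
    (hg : g ∉ critical) {V : WtMod (root r hr)} (hV : weightDegree (root r hr) g V) :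
    (∑ i : Fin r × Fin r, (WtMod.modifiedTrace (root r hr)).dim (generic r hr lift g i) •
      posLoop (generic r hr lift g i) V (θ_ (generic r hr lift g i)).inv) ≫ (θ_ V).inv =
      (-(r : ℂ)) • 𝟙 V := by
  rw [Iso.comp_inv_eq, Linear.smul_comp, Category.id_comp]
  refine WtMod.hom_ext (ext_HW V.isOps fun v e b s hv => ?_)
  rcases eq_or_ne v 0 with rfl | hv0
  · rw [map_zero, map_zero]
  obtain ⟨⟨n, hn⟩, m, hm⟩ := lift_weight hlift hV hv0 hv
  have hte := sub_inv_ne_zero_of_bracket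
    (typical_of_notMem_critical (hr := hr) hg (WtMod.weightDegree_apply hV hv0 hv).1)
  let u : ℂ → V.carrier := fun α => ((root r hr).pow α - ((root r hr).pow α)⁻¹)⁻¹ • ((root r hr).pow α)⁻¹ •
    (((root r hr).diff * (root r hr).pow e * ((root r hr).pow α - ((root r hr).pow α)⁻¹)) • V.op .Y (V.op .X v) -
      ((root r hr).pow α * ((root r hr).pow e * ((root r hr).pow e - ((root r hr).pow e)⁻¹))) • v)
  have key := sum_resonance (hr := hr) hodd (Or.inl rfl) hn hm (u := u) (fun α hα => by
    simp only [u, hα])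
  have hsum : WtMod.lin (∑ i : Fin r × Fin r,
      (WtMod.modifiedTrace (root r hr)).dim (generic r hr lift g i) •
        posLoop (generic r hr lift g i) V (θ_ (generic r hr lift g i)).inv) v =
      ((r : ℂ) * (root r hr).pow (-((1 : ℤ) * 2 * (e * b)))) • u e := by
    rw [← key, WtMod.lin_sum, LinearMap.sum_apply]
    refine Finset.sum_congr rfl fun i _ => ?_
    rw [WtMod.lin_smul, LinearMap.smul_apply, generic_dim hlift hg, generic,
      WtMod.lin_posLoop_kac hv (WtMod.twist_kac_inv _ _ _ _)]
    simp only [u, smul_smul, ← mul_sub, ← smul_sub]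
    congr 1
    have hpow : (root r hr).pow ((1 : ℤ) * 2 * (((lift g).1 + (i.1 : ℕ)) * ((lift g).2 + (i.2 : ℕ)) -
        e * ((lift g).2 + (i.2 : ℕ)) - b * ((lift g).1 + (i.1 : ℕ)))) =
        (root r hr).pow (((lift g).1 + (i.1 : ℕ)) * ((lift g).2 + (i.2 : ℕ))) ^ 2 *
        ((root r hr).pow (e * ((lift g).2 + (i.2 : ℕ))) * (root r hr).pow (b * ((lift g).1 + (i.1 : ℕ))))⁻¹ ^ 2 := by
      rw [← (root r hr).pow_add, ← (root r hr).pow_neg, ← (root r hr).pow_natCast_mul, ← (root r hr).pow_natCast_mul, ← (root r hr).pow_add]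
      congr 1
      push_cast
      ring
    rw [hpow]
    ring
  refine hsum.trans ?_
  refine Eq.trans ?_ (congrArg (fun w => -(r : ℂ) • w) (twistMap_apply V.isOps hv)).symm
  have hpow : (root r hr).pow (-((1 : ℤ) * 2 * (e * b))) = ((root r hr).pow (e * b))⁻¹ * ((root r hr).pow (e * b))⁻¹ := by
    rw [← (root r hr).pow_neg, ← (root r hr).pow_add]
    congr 1
    push_cast
    ring
  have p1 := (root r hr).pow_ne_zero e
  have p2 := (root r hr).pow_ne_zero (e * b)
  have p3 : (root r hr).pow e ^ 2 - 1 ≠ 0 := fun h0 => hte (by field_simp; rw [mul_zero]; exact h0)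
  simp only [u, hpow, smul_sub, smul_smul]
  match_scalars
  · field_simp
  · field_simp

theorem stabilisation_plus (hodd : Odd r)
    (hlift : ∀ g, (((lift g).1 : CmodZ), ((lift g).2 : CmodZ)) = g) {g : CmodZ × CmodZ}
    (hg : g ∉ critical) {V : WtMod (root r hr)} (hV : weightDegree (root r hr) g V) :
    (∑ i : Fin r × Fin r, (WtMod.modifiedTrace (root r hr)).dim (generic r hr lift g i) •
      negLoop (generic r hr lift g i) V (θ_ (generic r hr lift g i)).hom) ≫ (θ_ V).hom =
      (r : ℂ) • 𝟙 V := by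
  rw [← Iso.eq_comp_inv, Linear.smul_comp, Category.id_comp]
  refine WtMod.hom_ext (ext_HW V.isOps fun v e b s hv => ?_)
  rcases eq_or_ne v 0 with rfl | hv0
  · rw [map_zero, map_zero]
  obtain ⟨⟨n, hn⟩, m, hm⟩ := lift_weight hlift hV hv0 hv
  have hte := sub_inv_ne_zero_of_bracket
    (typical_of_notMem_critical (hr := hr) hg (WtMod.weightDegree_apply hV hv0 hv).1)
  let u : ℂ → V.carrier := fun α => ((root r hr).pow α - ((root r hr).pow α)⁻¹)⁻¹ • (root r hr).pow α •
    (((root r hr).pow α * (((root r hr).pow e)⁻¹ * ((root r hr).pow e - ((root r hr).pow e)⁻¹))) • v -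
      ((root r hr).diff * ((root r hr).pow e)⁻¹ * ((root r hr).pow α - ((root r hr).pow α)⁻¹)) • V.op .X (V.op .Y v))
  have key := sum_resonance (hr := hr) hodd (Or.inr rfl) hn hm (u := u) (fun α hα => by
    simp only [u, hα])
  have hsum : WtMod.lin (∑ i : Fin r × Fin r,
      (WtMod.modifiedTrace (root r hr)).dim (generic r hr lift g i) •
        negLoop (generic r hr lift g i) V (θ_ (generic r hr lift g i)).hom) v =
      ((r : ℂ) * (root r hr).pow (-((-1 : ℤ) * 2 * (e * b)))) • u e := by
    rw [← key, WtMod.lin_sum, LinearMap.sum_apply]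
    refine Finset.sum_congr rfl fun i _ => ?_
    rw [WtMod.lin_smul, LinearMap.smul_apply, generic_dim hlift hg, generic,
      WtMod.lin_negLoop_kac hv (WtMod.twist_kac_hom _ _ _ _)]
    simp only [u, smul_smul, ← mul_sub, ← smul_sub]
    congr 1
    have hpow : (root r hr).pow ((-1 : ℤ) * 2 * (((lift g).1 + (i.1 : ℕ)) * ((lift g).2 + (i.2 : ℕ)) -
        e * ((lift g).2 + (i.2 : ℕ)) - b * ((lift g).1 + (i.1 : ℕ)))) =
        ((root r hr).pow (((lift g).1 + (i.1 : ℕ)) * ((lift g).2 + (i.2 : ℕ))))⁻¹ ^ 2 *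
        ((root r hr).pow (e * ((lift g).2 + (i.2 : ℕ))) * (root r hr).pow (b * ((lift g).1 + (i.1 : ℕ)))) ^ 2 := by
      rw [← (root r hr).pow_add, ← (root r hr).pow_neg, ← (root r hr).pow_natCast_mul, ← (root r hr).pow_natCast_mul, ← (root r hr).pow_add]
      congr 1
      push_cast
      ring
    rw [hpow]
    ring
  refine hsum.trans ?_
  refine Eq.trans ?_ (congrArg (fun w => (r : ℂ) • w) (twistInv_apply V.isOps hv)).symm
  have hpow : (root r hr).pow (-((-1 : ℤ) * 2 * (e * b))) = ((root r hr).pow (e * b)) * ((root r hr).pow (e * b)) := by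
    rw [← (root r hr).pow_add]
    congr 1
    push_cast
    ring
  have p1 := (root r hr).pow_ne_zero e
  have p2 := (root r hr).pow_ne_zero (e * b)
  have p3 : (root r hr).pow e ^ 2 - 1 ≠ 0 := fun h0 => hte (by field_simp; rw [mul_zero]; exact h0)
  have hd := (root r hr).diff_ne_zero
  have hbr : (root r hr).bracket e = (root r hr).diff⁻¹ * ((root r hr).pow e - ((root r hr).pow e)⁻¹) := by
    rw [QParam.bracket, QParam.pow_neg]
  simp only [u, hpow, WtMod.XY_apply hv, hbr, smul_sub, smul_smul]
  match_scalars
  · field_simp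
    ring
  · field_simp

end
/-! ### Modularity -/

namespace WtMod

theorem hw_kac_dual_fst (h : QParam) (α a : ℂ) : HW h
    (dualOps (kacOps h α a) (LinearMap.prodMap (parSign 0 • 1) (-parSign 0 • 1)))
    (LinearMap.dualMap (LinearMap.prodMap (parSign 0 • 1) (-parSign 0 • 1)))
    (LinearMap.fst ℂ ℂ ℂ) (-α) (-a) 1 := by
  constructor
  case sq => simp
  all_goals refine LinearMap.ext fun x => ?_
  all_goals simp [dualOps, kacOps, parSign_zero, h.pow_neg]

theorem hw_kac_dual_snd (h : QParam) (α a : ℂ) : HW h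
    (dualOps (kacOps h α a) (LinearMap.prodMap (parSign 0 • 1) (-parSign 0 • 1)))
    (LinearMap.dualMap (LinearMap.prodMap (parSign 0 • 1) (-parSign 0 • 1)))
    (LinearMap.snd ℂ ℂ ℂ) (-α) (1 - a) (-1) := by
  constructor
  case sq => simp
  all_goals refine LinearMap.ext fun x => ?_
  all_goals simp [dualOps, kacOps, parSign_zero, h.pow_neg]
  ring

theorem dualOps_kac_basis (h : QParam) (α a : ℂ) :
    dualOps (kacOps h α a) (LinearMap.prodMap (parSign 0 • 1) (-parSign 0 • 1)) .X
      (LinearMap.fst ℂ ℂ ℂ) = (-(h.pow α * h.bracket α)) • LinearMap.snd ℂ ℂ ℂ ∧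
    dualOps (kacOps h α a) (LinearMap.prodMap (parSign 0 • 1) (-parSign 0 • 1)) .X
      (LinearMap.snd ℂ ℂ ℂ) = 0 ∧
    dualOps (kacOps h α a) (LinearMap.prodMap (parSign 0 • 1) (-parSign 0 • 1)) .Y
      (LinearMap.fst ℂ ℂ ℂ) = 0 ∧
    dualOps (kacOps h α a) (LinearMap.prodMap (parSign 0 • 1) (-parSign 0 • 1)) .Y
      (LinearMap.snd ℂ ℂ ℂ) = (h.pow α)⁻¹ • LinearMap.fst ℂ ℂ ℂ := by
  refine ⟨?_, ?_, ?_, ?_⟩ <;> refine LinearMap.ext fun x => ?_ <;>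
    simp [dualOps, kacOps, parSign_zero, h.pow_neg, QParam.bracket] <;> ring

/-- On `V(α, a) ⊗ V(α, a')*` the operator `YX` vanishes on the vectors whose weights are not
`(0, a - a')`. -/
theorem raw_YX_kac (h : QParam) (α a a' : ℂ) :
    let ρ := tensorOps (kacOps h α a) (LinearMap.prodMap (parSign 0 • 1) (-parSign 0 • 1))
      (dualOps (kacOps h α a') (LinearMap.prodMap (parSign 0 • 1) (-parSign 0 • 1)))
    ρ .Y (ρ .X ((1, 0) ⊗ₜ LinearMap.snd ℂ ℂ ℂ)) = 0 ∧
    ρ .Y (ρ .X ((0, 1) ⊗ₜ LinearMap.fst ℂ ℂ ℂ)) = 0 ∧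
    ρ .Y (ρ .X ((1, 0) ⊗ₜ LinearMap.fst ℂ ℂ ℂ)) = (-h.bracket α) • h.pow α •
      ((1, 0) ⊗ₜ LinearMap.fst ℂ ℂ ℂ + (0, 1) ⊗ₜ LinearMap.snd ℂ ℂ ℂ) ∧
    ρ .Y (ρ .X ((0, 1) ⊗ₜ LinearMap.snd ℂ ℂ ℂ)) = (-h.bracket α) • (-h.pow α) •
      ((1, 0) ⊗ₜ LinearMap.fst ℂ ℂ ℂ + (0, 1) ⊗ₜ LinearMap.snd ℂ ℂ ℂ) := by
  intro ρ
  have hT := hw_kac_fst h α a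
  have hB := hw_kac_snd h α a
  have hT' := hw_kac_dual_fst h α a'
  have hB' := hw_kac_dual_snd h α a'
  obtain ⟨k1, k2, k3, k4⟩ := kacOps_basis h α a
  obtain ⟨d1, d2, d3, d4⟩ := dualOps_kac_basis h α a'
  have p2 := h.pow_ne_zero α
  simp only [ρ, tensorOps, LinearMap.add_apply, map_tmul, k1, k2, k3, k4, d1, d2, d3, d4, hT.K, hT.Γ,
    hB.K, hB.Γ, hT'.Kinv, hB'.Kinv, Module.End.mul_apply, Module.End.one_apply, map_smul, map_add,
    zero_tmul, tmul_zero, map_zero, ← smul_tmul', tmul_smul, smul_zero, add_zero, zero_add,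
    smul_smul, h.pow_neg, inv_inv]
  refine ⟨?_, ?_, ?_, ?_⟩
  · trivial
  · match_scalars <;> field_simp <;> ring
  · match_scalars <;> field_simp
  · match_scalars <;> field_simp

theorem raw_YX_kac_eq_zero (h : QParam) {α α' : ℂ} (hα : α = α') (a a' : ℂ) :
    let ρ := tensorOps (kacOps h α a) (LinearMap.prodMap (parSign 0 • 1) (-parSign 0 • 1))
      (dualOps (kacOps h α' a') (LinearMap.prodMap (parSign 0 • 1) (-parSign 0 • 1)))
    ρ .Y (ρ .X ((1, 0) ⊗ₜ LinearMap.snd ℂ ℂ ℂ)) = 0 ∧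
    ρ .Y (ρ .X ((0, 1) ⊗ₜ LinearMap.fst ℂ ℂ ℂ)) = 0 := by
  subst hα
  exact ⟨(raw_YX_kac h α a a').1, (raw_YX_kac h α a a').2.1⟩

theorem coevaluation_prod : coevaluation ℂ (ℂ × ℂ) 1 =
    (1, 0) ⊗ₜ LinearMap.fst ℂ ℂ ℂ + (0, 1) ⊗ₜ LinearMap.snd ℂ ℂ ℂ := by
  refine coev_inj ?_
  rw [dualTensorHom_coev]
  ext <;> simp [dualTensorHom_apply]

theorem ext_prod_dual {M : Type} [AddCommGroup M] [Module ℂ M]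
    {F F' : (ℂ × ℂ) ⊗[ℂ] Module.Dual ℂ (ℂ × ℂ) →ₗ[ℂ] M}
    (h1 : F ((1, 0) ⊗ₜ LinearMap.fst ℂ ℂ ℂ) = F' ((1, 0) ⊗ₜ LinearMap.fst ℂ ℂ ℂ))
    (h2 : F ((1, 0) ⊗ₜ LinearMap.snd ℂ ℂ ℂ) = F' ((1, 0) ⊗ₜ LinearMap.snd ℂ ℂ ℂ))
    (h3 : F ((0, 1) ⊗ₜ LinearMap.fst ℂ ℂ ℂ) = F' ((0, 1) ⊗ₜ LinearMap.fst ℂ ℂ ℂ))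
    (h4 : F ((0, 1) ⊗ₜ LinearMap.snd ℂ ℂ ℂ) = F' ((0, 1) ⊗ₜ LinearMap.snd ℂ ℂ ℂ)) : F = F' := by
  refine TensorProduct.ext' fun x f => ?_
  have hx : x = x.1 • ((1, 0) : ℂ × ℂ) + x.2 • ((0, 1) : ℂ × ℂ) := by simp
  have hf : f = (f (1, 0) : ℂ) • LinearMap.fst ℂ ℂ ℂ + (f (0, 1) : ℂ) • LinearMap.snd ℂ ℂ ℂ := by
    refine LinearMap.ext fun y => ?_
    have hy : y = y.1 • ((1, 0) : ℂ × ℂ) + y.2 • ((0, 1) : ℂ × ℂ) := by simp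
    conv_lhs => rw [hy]
    simp only [map_add, map_smul, LinearMap.add_apply, LinearMap.smul_apply, smul_eq_mul,
      LinearMap.fst_apply, LinearMap.snd_apply]
    ring
  rw [hx, hf]
  simp only [add_tmul, tmul_add, ← smul_tmul', tmul_smul, map_add, map_smul, h1, h2, h3, h4]

theorem lin_evR_coevL_kac (h : QParam) (α a : ℂ) (x : ℂ × ℂ) (f : Module.Dual ℂ (ℂ × ℂ)) :
    lin (evR (kac h α a 0) ≫ coevL (kac h α a 0))
      (x ⊗ₜ[ℂ] f : (ℂ × ℂ) ⊗[ℂ] Module.Dual ℂ (ℂ × ℂ)) =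
    (h.pow α * f (x.1, -x.2)) •
      ((1, 0) ⊗ₜ LinearMap.fst ℂ ℂ ℂ + (0, 1) ⊗ₜ LinearMap.snd ℂ ℂ ℂ :
        (ℂ × ℂ) ⊗[ℂ] Module.Dual ℂ (ℂ × ℂ)) := by
  have h1 : f ((LinearMap.prodMap (parSign 0 • 1) (-parSign 0 • 1) : Module.End ℂ (ℂ × ℂ))
      (kacOps h α a .K x)) =
      h.pow α * f (x.1, -x.2) := by
    rw [← smul_eq_mul, ← map_smul]
    congr 1
    simp [kacOps, parSign_zero]
  refine (congrArg (lin (coevL (kac h α a 0))) ((evR_tmul (kac h α a 0) x f).trans h1)).trans ?_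
  rw [← coevaluation_prod, ← map_smul, smul_eq_mul, mul_one]
  rfl

end WtMod

section
variable {r : ℕ} {hr : 3 ≤ r} {lift : CmodZ × CmodZ → ℂ × ℂ}

/-- The endomorphism of a module given by a loop which carries the Kirby colour of index `g`. -/
noncomputable def kirby (r : ℕ) (hr : 3 ≤ r) (lift : CmodZ × CmodZ → ℂ × ℂ) (g : CmodZ × CmodZ)
    (V : WtMod (root r hr)) : V ⟶ V :=
  ∑ l : Fin r × Fin r, (WtMod.modifiedTrace (root r hr)).dim (generic r hr lift g l) •
    posLoop (generic r hr lift g l) V (𝟙 (generic r hr lift g l))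

/-- On vectors of integral weight `(n, m)` the Kirby colour acts by a multiple of `YX`, and it acts
by zero unless both `n` and `m` are divisible by `r`. -/
theorem lin_kirby (hodd : Odd r)
    (hlift : ∀ g, (((lift g).1 : CmodZ), ((lift g).2 : CmodZ)) = g) {g : CmodZ × CmodZ}
    (hg : g ∉ critical) {V : WtMod (root r hr)} {v : V.carrier} {n m : ℤ} {s : ℂ}
    (hv : V.IsWt v n m s) :
    WtMod.lin (kirby r hr lift g V) v = (if (r : ℤ) ∣ n ∧ (r : ℤ) ∣ m then
      (r : ℂ) ^ 2 * (root r hr).diff *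
        (root r hr).pow (-(2 * (n * (lift g).2 + m * (lift g).1))) else 0) •
      V.op .Y (V.op .X v) := by
  have hterm : ∀ l : Fin r × Fin r, WtMod.lin ((WtMod.modifiedTrace (root r hr)).dim
      (generic r hr lift g l) • posLoop (generic r hr lift g l) V
        (𝟙 (generic r hr lift g l))) v =
      (root r hr).pow (-(2 * (n * (lift g).2 + m * (lift g).1))) •
      (root r hr).pow (((-1) * 2 * m : ℤ) * (l.1 : ℕ)) •
      (root r hr).pow (((-1) * 2 * n : ℤ) * (l.2 : ℕ)) •
      ((root r hr).pow ((lift g).1 + (l.1 : ℕ)) - ((root r hr).pow ((lift g).1 + (l.1 : ℕ)))⁻¹)⁻¹ •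
      (((root r hr).diff * (root r hr).pow n * ((root r hr).pow ((lift g).1 + (l.1 : ℕ)) -
        ((root r hr).pow ((lift g).1 + (l.1 : ℕ)))⁻¹)) • V.op .Y (V.op .X v) -
        ((root r hr).pow ((lift g).1 + (l.1 : ℕ)) * ((root r hr).pow n *
          ((root r hr).pow n - ((root r hr).pow n)⁻¹))) • v) := by
    intro l
    rw [WtMod.lin_smul, LinearMap.smul_apply, generic_dim hlift hg, generic,
      WtMod.lin_posLoop_kac hv (one_smul ℂ _).symm]
    have hpow : ((root r hr).pow (n * ((lift g).2 + (l.2 : ℕ))) *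
        (root r hr).pow (m * ((lift g).1 + (l.1 : ℕ))))⁻¹ ^ 2 =
        (root r hr).pow (-(2 * (n * (lift g).2 + m * (lift g).1))) *
        ((root r hr).pow (((-1) * 2 * m : ℤ) * (l.1 : ℕ)) *
        (root r hr).pow (((-1) * 2 * n : ℤ) * (l.2 : ℕ))) := by
      rw [← QParam.pow_add, ← QParam.pow_neg, ← QParam.pow_natCast_mul, ← QParam.pow_add,
        ← QParam.pow_add]
      congr 1
      push_cast
      ring
    rw [hpow]
    simp only [smul_smul]
    congr 1
    ring
  rw [kirby, WtMod.lin_sum, LinearMap.sum_apply]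
  simp only [hterm]
  rw [← Finset.smul_sum, Fintype.sum_prod_type]
  by_cases hn : (r : ℤ) ∣ n
  · have hpn : (root r hr).pow n = 1 := root_pow_intCast_eq_one_iff.2 hn
    have hred : ∀ i : Fin r, ((root r hr).pow ((lift g).1 + (i : ℕ)) -
        ((root r hr).pow ((lift g).1 + (i : ℕ)))⁻¹)⁻¹ •
      (((root r hr).diff * (root r hr).pow n * ((root r hr).pow ((lift g).1 + (i : ℕ)) -
        ((root r hr).pow ((lift g).1 + (i : ℕ)))⁻¹)) • V.op .Y (V.op .X v) -
        ((root r hr).pow ((lift g).1 + (i : ℕ)) * ((root r hr).pow n *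
          ((root r hr).pow n - ((root r hr).pow n)⁻¹))) • v) =
        (root r hr).diff • V.op .Y (V.op .X v) := by
      intro i
      have hte := sub_inv_ne_zero_of_bracket (bracket_generic (hr := hr) hlift hg i)
      rw [hpn]
      simp only [inv_one, sub_self, mul_zero, zero_smul, sub_zero, smul_smul, mul_one]
      congr 1
      rw [mul_comm, mul_assoc, mul_inv_cancel₀ hte, mul_one]
    simp only [hred, ← Finset.sum_smul, ← Finset.smul_sum]
    simp only [smul_smul, ← Finset.sum_mul]
    rw [sum_root_pow hodd (Or.inr rfl), sum_root_pow hodd (Or.inr rfl)]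
    simp only [hn, true_and, if_true]
    congr 1
    split_ifs <;> ring
  · simp only [← Finset.sum_smul, ← Finset.smul_sum]
    rw [sum_root_pow hodd (Or.inr rfl)]
    simp [hn]

theorem not_dvd_sub {i j : Fin r} (hij : i ≠ j) : ¬ (r : ℤ) ∣ (i : ℕ) - (j : ℕ) := by
  intro hd
  have h1 := Int.eq_zero_of_abs_lt_dvd hd (by
    have := i.2
    have := j.2
    rw [abs_lt]
    omega)
  exact hij (Fin.ext (by omega))

/-- On `V(α, a) ⊗ V(α, a)*` the Kirby colour acts by `r² (q - q⁻¹) YX` on vectors of weight zero and by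
zero on the others, and `YX` is the composition of evaluation and coevaluation, up to the factor
`-[α]`. -/
theorem modularity_diag (hodd : Odd r)
    (hlift : ∀ g, (((lift g).1 : CmodZ), ((lift g).2 : CmodZ)) = g) {g g' : CmodZ × CmodZ}
    (hg : g ∉ critical) (hg' : g' ∉ critical) (i : Fin r × Fin r) :
    (WtMod.modifiedTrace (root r hr)).dim (generic r hr lift g i) •
      kirby r hr lift g' (generic r hr lift g i ⊗ (generic r hr lift g i)ᘁ) =
    (-(r : ℂ) ^ 2) • (evR (generic r hr lift g i) ≫ coevL (generic r hr lift g i)) := by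
  have hbr := bracket_generic (hr := hr) hlift hg i.1
  have hte := sub_inv_ne_zero_of_bracket hbr
  rw [generic_dim hlift hg]
  rw [generic]
  generalize (lift g).1 + ((i.1 : ℕ) : ℂ) = α at hbr hte
  generalize (lift g).2 + ((i.2 : ℕ) : ℂ) = a
  have hT := WtMod.hw_kac_fst (root r hr) α a
  have hB := WtMod.hw_kac_snd (root r hr) α a
  have hT' := WtMod.hw_kac_dual_fst (root r hr) α a
  have hB' := WtMod.hw_kac_dual_snd (root r hr) α a
  obtain ⟨y1, y2, y3, y4⟩ := WtMod.raw_YX_kac (root r hr) α a a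
  let V := WtMod.kac (root r hr) α a 0 ⊗ (WtMod.kac (root r hr) α a 0)ᘁ
  have hd := (root r hr).diff_ne_zero
  have hb : (root r hr).bracket α = (root r hr).diff⁻¹ *
      ((root r hr).pow α - ((root r hr).pow α)⁻¹) := by
    rw [QParam.bracket, QParam.pow_neg]
  have key : ∀ (v w : V.carrier) (e b s c d : ℂ) (m : ℤ) (_ : V.IsWt v e b s)
      (_ : V.op .Y (V.op .X v) = (-(root r hr).bracket α) • c • w)
      (_ : WtMod.lin (evR (WtMod.kac (root r hr) α a 0) ≫ coevL (WtMod.kac (root r hr) α a 0)) v =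
        d • w) (_ : e = 0) (_ : b = m) (_ : d = c) (_ : m = 0 ∨ c = 0),
      WtMod.lin (((root r hr).pow α - ((root r hr).pow α)⁻¹)⁻¹ • kirby r hr lift g' V) v =
      WtMod.lin ((-(r : ℂ) ^ 2) • (evR (WtMod.kac (root r hr) α a 0) ≫
        coevL (WtMod.kac (root r hr) α a 0))) v := by
    intro v w e b s c d m hv hyx hev he hb' hc hm
    rw [he, hb', ← Int.cast_zero] at hv
    rw [WtMod.lin_smul, LinearMap.smul_apply, lin_kirby hodd hlift hg' hv, hyx, WtMod.lin_smul,
      LinearMap.smul_apply, hev, hc, smul_smul, smul_smul, smul_smul, smul_smul]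
    congr 1
    rcases hm with rfl | rfl
    · rw [if_pos ⟨dvd_zero _, dvd_zero _⟩, hb]
      simp only [Int.cast_zero, zero_mul, add_zero, mul_zero, neg_zero, QParam.pow_zero]
      generalize (root r hr).pow α - ((root r hr).pow α)⁻¹ = z at hte
      field_simp
    · simp
  have hz : ∀ w : V.carrier, (0 : V.carrier) = (-(root r hr).bracket α) • (0 : ℂ) • w := fun w => by
    simp
  refine WtMod.hom_ext (WtMod.ext_prod_dual ?_ ?_ ?_ ?_)
  · exact key _ _ _ _ _ _ _ 0 (hT.tmul hT') y3 (WtMod.lin_evR_coevL_kac _ _ _ _ _) (by ring)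
      (by simp) (by simp) (Or.inl rfl)
  · exact key _ _ _ _ _ 0 _ 1 (hT.tmul hB') (y1.trans (hz _))
      (WtMod.lin_evR_coevL_kac _ _ _ _ _) (by ring) (by push_cast; ring) (by simp) (Or.inr rfl)
  · exact key _ _ _ _ _ 0 _ (-1) (hB.tmul hT') (y2.trans (hz _))
      (WtMod.lin_evR_coevL_kac _ _ _ _ _) (by ring) (by push_cast; ring) (by simp) (Or.inr rfl)
  · exact key _ _ _ _ _ _ _ 0 (hB.tmul hB') y4 (WtMod.lin_evR_coevL_kac _ _ _ _ _) (by ring)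
      (by simp) (by simp) (Or.inl rfl)

/-- A vector of `V_i ⊗ V_j*` on which the Kirby colour could be non-zero has a weight divisible by `r`.
For `i ≠ j` this excludes the vectors of weight `i - j`, and it leaves the two others only if the
first components of `i` and `j` agree; but then `YX` annihilates them. -/
theorem modularity_off_diag (hodd : Odd r)
    (hlift : ∀ g, (((lift g).1 : CmodZ), ((lift g).2 : CmodZ)) = g) {g g' : CmodZ × CmodZ}
    (hg' : g' ∉ critical) {i j : Fin r × Fin r} (hij : i ≠ j) :
    kirby r hr lift g' (generic r hr lift g i ⊗ (generic r hr lift g j)ᘁ) = 0 := by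
  let V := generic r hr lift g i ⊗ (generic r hr lift g j)ᘁ
  have key : ∀ (v : V.carrier) (e b s : ℂ) (n m : ℤ) (_ : V.IsWt v e b s)
      (_ : e = n) (_ : b = m)
      (_ : (r : ℤ) ∣ n → (r : ℤ) ∣ m → V.op .Y (V.op .X v) = 0),
      WtMod.lin (kirby r hr lift g' V) v = WtMod.lin 0 v := by
    intro v e b s n m hv he hb h0
    rw [he, hb] at hv
    rw [lin_kirby hodd hlift hg' hv]
    split_ifs with hd
    · rw [h0 hd.1 hd.2, smul_zero]
      rfl
    · rw [zero_smul]
      rfl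
  have hdvd : (r : ℤ) ∣ ((i.1 : ℕ) : ℤ) - (j.1 : ℕ) → i.1 = j.1 := fun hd => by
    by_contra hne
    exact not_dvd_sub hne hd
  have hT := WtMod.hw_kac_fst (root r hr) ((lift g).1 + (i.1 : ℕ)) ((lift g).2 + (i.2 : ℕ))
  have hB := WtMod.hw_kac_snd (root r hr) ((lift g).1 + (i.1 : ℕ)) ((lift g).2 + (i.2 : ℕ))
  have hT' := WtMod.hw_kac_dual_fst (root r hr) ((lift g).1 + (j.1 : ℕ)) ((lift g).2 + (j.2 : ℕ))
  have hB' := WtMod.hw_kac_dual_snd (root r hr) ((lift g).1 + (j.1 : ℕ)) ((lift g).2 + (j.2 : ℕ))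
  have hY := fun hα => WtMod.raw_YX_kac_eq_zero (root r hr)
    (α := (lift g).1 + (i.1 : ℕ)) (α' := (lift g).1 + (j.1 : ℕ)) hα ((lift g).2 + (i.2 : ℕ))
    ((lift g).2 + (j.2 : ℕ))
  have h2 : i.1 = j.1 → ¬ (r : ℤ) ∣ ((i.2 : ℕ) : ℤ) - (j.2 : ℕ) := fun h1 =>
    not_dvd_sub fun h2 => hij (Prod.ext h1 h2)
  refine WtMod.hom_ext (WtMod.ext_prod_dual ?_ ?_ ?_ ?_)
  · exact key _ _ _ _ ((i.1 : ℕ) - (j.1 : ℕ)) ((i.2 : ℕ) - (j.2 : ℕ)) (hT.tmul hT')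
      (by push_cast; ring) (by push_cast; ring) fun h1 h3 => absurd h3 (h2 (hdvd h1))
  · refine key _ _ _ _ ((i.1 : ℕ) - (j.1 : ℕ)) ((i.2 : ℕ) - (j.2 : ℕ) + 1) (hT.tmul hB')
      (by push_cast; ring) (by push_cast; ring) fun h1 _ => ?_
    exact (hY (by rw [hdvd h1])).1
  · refine key _ _ _ _ ((i.1 : ℕ) - (j.1 : ℕ)) ((i.2 : ℕ) - (j.2 : ℕ) - 1) (hB.tmul hT')
      (by push_cast; ring) (by push_cast; ring) fun h1 _ => ?_
    exact (hY (by rw [hdvd h1])).2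
  · exact key _ _ _ _ ((i.1 : ℕ) - (j.1 : ℕ)) ((i.2 : ℕ) - (j.2 : ℕ)) (hB.tmul hB')
      (by push_cast; ring) (by push_cast; ring) fun h1 h3 => absurd h3 (h2 (hdvd h1))

end
/-! ### The critical degrees -/

theorem isSymmetric_critical : IsSymmetric critical := by
  have h1 : ∀ g ∈ critical, -g ∈ critical := by
    rintro ⟨x, y⟩ (h0 | h0)
    · left
      show -x = _
      rw [show x = _ from h0, ← QuotientAddGroup.mk_neg, neg_zero]
    · right
      show -x = _
      rw [show x = _ from h0, ← QuotientAddGroup.mk_neg, CmodZ_eq_iff]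
      exact ⟨-1, by push_cast; ring⟩
  exact fun g => ⟨h1 g, fun hg => by simpa using h1 _ hg⟩

theorem isSmall_critical : IsSmall critical := by
  intro n s hs
  have hinf : Infinite CmodZ := by
    refine Infinite.of_injective (fun k : ℕ => ((k * Complex.I : ℂ) : CmodZ)) fun k l hkl => ?_
    obtain ⟨m, hm⟩ := CmodZ_eq_iff.1 hkl
    have := congrArg Complex.im hm
    simpa using this
  have hfin : (⋃ i, {(s i).1 + ((0 : ℂ) : CmodZ), (s i).1 + ((1 / 2 : ℂ) : CmodZ)} : Set CmodZ).Finite :=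
    Set.finite_iUnion fun i => by simp
  obtain ⟨x, hx⟩ := hfin.exists_notMem
  have h1 : ((x, 0) : CmodZ × CmodZ) ∈ ⋃ i, (fun y => s i + y) '' critical := by
    rw [hs]; exact Set.mem_univ _
  obtain ⟨i, y, hy, hxy⟩ := Set.mem_iUnion.1 h1
  refine hx (Set.mem_iUnion.2 ⟨i, ?_⟩)
  have h2 : (s i).1 + y.1 = x := congrArg Prod.fst hxy
  rcases hy with hy | hy
  · left; rw [← h2, hy]
  · right; rw [← h2, hy]; rfl

namespace WtMod
variable {h : QParam}

/-! ### Simple and regular modules -/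

/-- Monomorphisms are injective, hence it suffices that non-zero morphisms to `V` are surjective. -/
theorem simple_of_surjective {V : WtMod h} (h0 : 𝟙 V ≠ 0)
    (hV : ∀ (W : WtMod h) (f : W ⟶ V), f ≠ 0 → Function.Surjective (lin f)) : Simple V where
  mono_isIso_iff_nonzero {W} f _ := by
    refine ⟨?_, fun hf => isIso_of_bijective f ⟨injective_of_mono f, hV W f hf⟩⟩
    rintro hf rfl
    refine h0 ?_
    rw [← IsIso.inv_hom_id (0 : W ⟶ V), Limits.comp_zero]

theorem exists_ne_zero_of_ne_zero {V W : WtMod h} {f : V ⟶ W} (hf : f ≠ 0) : ∃ v, lin f v ≠ 0 := by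
  by_contra! h0
  exact hf (hom_ext (LinearMap.ext h0))

theorem isScalarUnit : IsScalarUnit ℂ (WtMod h) where
  simple := by
    refine simple_of_surjective (fun h0 => one_ne_zero (α := ℂ) ?_) fun W f hf => ?_
    · exact LinearMap.congr_fun (congrArg lin h0) (1 : ℂ)
    · obtain ⟨v, hv⟩ := exists_ne_zero_of_ne_zero hf
      have key : ∀ F : W.carrier →ₗ[ℂ] ℂ, F v ≠ 0 → Function.Surjective F := fun F hF c =>
        ⟨(c / F v) • v, by rw [map_smul, smul_eq_mul, div_mul_cancel₀ c hF]⟩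
      exact key (lin f) hv
  bijective := by
    constructor
    · intro a b hab
      have h1 : a * 1 = b * 1 := LinearMap.congr_fun (congrArg lin hab) (1 : ℂ)
      simpa using h1
    · intro f
      refine ⟨(lin f (1 : ℂ) : ℂ), hom_ext ?_⟩
      have key : ∀ F : ℂ →ₗ[ℂ] ℂ, (F 1) • (LinearMap.id : ℂ →ₗ[ℂ] ℂ) = F := fun F => by
        ext; simp
      exact key (lin f)

theorem kac_id_ne_zero (α a : ℂ) (p : ZMod 2) : 𝟙 (kac h α a p) ≠ 0 := fun h0 =>
  kacTop_ne_zero α a p (LinearMap.congr_fun (congrArg lin h0) (kacTop h α a p))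

theorem simple_kac {α : ℂ} (hα : h.bracket α ≠ 0) (a : ℂ) (p : ZMod 2) : Simple (kac h α a p) := by
  refine simple_of_surjective (kac_id_ne_zero α a p) fun W f hf => ?_
  obtain ⟨v, hv⟩ := exists_ne_zero_of_ne_zero hf
  have hop : ∀ x w, w ∈ LinearMap.range (lin f) →
      (kac h α a p).op x w ∈ LinearMap.range (lin f) := by
    rintro x _ ⟨w, rfl⟩
    exact ⟨W.op x w, f.op_apply x w⟩
  have htop : kacTop h α a p ∈ LinearMap.range (lin f) := by
    have h1 : lin f v ∈ LinearMap.range (lin f) := ⟨v, rfl⟩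
    have hc := kac_eq_add (lin f v)
    generalize (show ℂ × ℂ from lin f v).1 = c at hc
    generalize (show ℂ × ℂ from lin f v).2 = d at hc
    rcases eq_or_ne d 0 with rfl | hd
    · rw [zero_smul, add_zero] at hc
      have hc0 : c ≠ 0 := by rintro rfl; exact hv (by rw [hc, zero_smul])
      rw [hc] at h1
      exact (Submodule.smul_mem_iff _ hc0).1 h1
    · have h2 := hop .X _ h1
      rw [hc, map_add, map_smul, map_smul, X_kacTop, X_kacBot, smul_zero, zero_add] at h2
      exact (Submodule.smul_mem_iff _ hα).1 ((Submodule.smul_mem_iff _ hd).1 h2)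
  have hbot : kacBot h α a p ∈ LinearMap.range (lin f) := by
    have h1 := hop .Y _ htop
    rwa [Y_kacTop] at h1
  intro w
  have hw := kac_eq_add w
  have h1 : w ∈ LinearMap.range (lin f) := by
    rw [hw]
    exact add_mem (Submodule.smul_mem _ _ htop) (Submodule.smul_mem _ _ hbot)
  exact h1

theorem isRegular_kac (α a : ℂ) (p : ZMod 2) : IsRegular (kac h α a p) := by
  refine epi_of_surjective _ fun (c : ℂ) => ?_
  refine ⟨(c • LinearMap.fst ℂ ℂ ℂ ⊗ₜ ((1, 0) : ℂ × ℂ) :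
    Module.Dual ℂ (ℂ × ℂ) ⊗[ℂ] (ℂ × ℂ)), ?_⟩
  have h1 : contractLeft ℂ (ℂ × ℂ) (c • LinearMap.fst ℂ ℂ ℂ ⊗ₜ ((1, 0) : ℂ × ℂ)) = c := by
    simp [contractLeft_apply]
  exact h1

/-! ### The grading by weights modulo integers -/

/-- It suffices to test the degree on weight vectors which are homogeneous for the `ℤ / 2`-grading. -/
theorem weightDegree_iff {g : CmodZ × CmodZ} {V : WtMod h} : weightDegree h g V ↔
    ∀ v e b s, v ≠ 0 → V.IsWt v e b s → ((e : CmodZ), (b : CmodZ)) = g := by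
  refine ⟨fun hV v e b s hv0 hv => hV e b v hv0 hv.E hv.G, fun hV e b v hv0 hE hG => ?_⟩
  have hev : ∀ s : ℂ, s = 1 ∨ s = -1 → V.IsWt (v + s • V.Γ v) e b s := by
    intro s hs
    have hE' : V.op .E (V.Γ v) = e • V.Γ v := by
      rw [← map_smul, ← hE]; exact (LinearMap.congr_fun V.isOps.Γ_E v).symm
    have hG' : V.op .G (V.Γ v) = b • V.Γ v := by
      rw [← map_smul, ← hG]; exact (LinearMap.congr_fun V.isOps.Γ_G v).symm
    have hΓ : V.Γ (V.Γ v) = v := LinearMap.congr_fun V.isOps.Γ_Γ v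
    refine isWt_of_E_G_Γ ?_ ?_ ?_ hs
    · rw [map_add, map_smul, hE, hE', smul_add, smul_comm]
    · rw [map_add, map_smul, hG, hG', smul_add, smul_comm]
    · rw [map_add, map_smul, hΓ, smul_add, smul_smul, add_comm]
      rcases hs with rfl | rfl <;> simp
  by_contra hne
  have h1 : v + (1 : ℂ) • V.Γ v = 0 := by
    by_contra h0; exact hne (hV _ _ _ _ h0 (hev 1 (Or.inl rfl)))
  have h2 : v + (-1 : ℂ) • V.Γ v = 0 := by
    by_contra h0; exact hne (hV _ _ _ _ h0 (hev (-1) (Or.inr rfl)))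
  refine hv0 ?_
  have h3 : v = (2 : ℂ)⁻¹ • ((v + (1 : ℂ) • V.Γ v) + (v + (-1 : ℂ) • V.Γ v)) := by module
  rw [h3, h1, h2, add_zero, smul_zero]

/-- The degree of a module can be tested on any family of weight vectors which spans it. -/
theorem weightDegree_of_ext {g : CmodZ × CmodZ} {V : WtMod h}
    (hV : ∀ F : Module.End ℂ V.carrier, (∀ v e b s, V.IsWt v e b s →
      ((e : CmodZ), (b : CmodZ)) = g → F v = 0) → F = 0) : weightDegree h g V := by
  classical
  rw [weightDegree_iff]
  intro v e b s hv0 hv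
  by_contra hne
  have h1 : V.weightProj {(e, b, s)} = 0 := hV _ fun w e' b' s' hw hg => by
    rw [weightProj_apply _ hw, if_neg]
    intro heq
    simp only [Set.mem_singleton_iff, Prod.mk.injEq] at heq
    rw [heq.1, heq.2.1] at hg
    exact hne hg
  refine hv0 ?_
  have h2 := weightProj_apply {(e, b, s)} hv
  rw [if_pos (Set.mem_singleton _), h1] at h2
  exact h2.symm

theorem class_add_one (x : ℂ) : ((x + 1 : ℂ) : CmodZ) = x := CmodZ_eq_iff.2 ⟨1, by simp⟩

theorem class_sub_one (x : ℂ) : ((x - 1 : ℂ) : CmodZ) = x :=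
  CmodZ_eq_iff.2 ⟨-1, by push_cast; ring⟩

theorem weightDegree_kac (α a : ℂ) (p : ZMod 2) :
    weightDegree h ((α : CmodZ), (a : CmodZ)) (kac h α a p) := by
  refine weightDegree_of_ext fun F hF => LinearMap.ext fun c => ?_
  rw [kac_eq_add c, map_add, map_smul, map_smul, hF _ _ _ _ (isWt_kacTop h α a p) rfl,
    hF _ _ _ _ (isWt_kacBot h α a p) (by rw [class_sub_one])]
  simp

theorem ind_eq_add {e g : ℂ} {p : ZMod 2} (c : (ind h e g p).carrier) : ∃ x y z t : ℂ,
    c = x • indGen h e g p + y • (ind h e g p).op .X (indGen h e g p) +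
      z • (ind h e g p).op .Y (indGen h e g p) +
      t • (ind h e g p).op .Y ((ind h e g p).op .X (indGen h e g p)) := by
  have key : ∀ c : ℂ × ℂ × ℂ × ℂ, ∃ x y z t : ℂ, c = x • ((1, 0, 0, 0) : ℂ × ℂ × ℂ × ℂ) +
      y • indOps h e g .X (1, 0, 0, 0) + z • indOps h e g .Y (1, 0, 0, 0) +
      t • indOps h e g .Y (indOps h e g .X (1, 0, 0, 0)) := fun ⟨x, y, z, t⟩ =>
    ⟨x, y, z, t, by simp [indOps]⟩
  exact key c

theorem weightDegree_ind (e g : ℂ) (p : ZMod 2) :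
    weightDegree h ((e : CmodZ), (g : CmodZ)) (ind h e g p) := by
  have hw := isWt_indGen h e g p
  refine weightDegree_of_ext fun F hF => LinearMap.ext fun c => ?_
  obtain ⟨x, y, z, t, rfl⟩ := ind_eq_add c
  simp only [map_add, map_smul, hF _ _ _ _ hw rfl,
    hF _ _ _ _ (hw.X (ind h e g p).isOps) (by rw [class_add_one]),
    hF _ _ _ _ (hw.Y (ind h e g p).isOps) (by rw [class_sub_one]),
    hF _ _ _ _ (hw.YX (ind h e g p).isOps) rfl]
  simp

theorem weightDegree_eps (e g : ℂ) (p : ZMod 2) (he : h.pow e * h.pow e = 1) :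
    weightDegree h ((e : CmodZ), (g : CmodZ)) (eps h e g p he) := by
  intro e' g' v hv0 hE hG
  have key : ∀ c x y : ℂ, c ≠ 0 → x * c = y * c → x = y := fun c x y => mul_right_cancel₀
  rw [key v e e' hv0 hE, key v g g' hv0 hG]

/-- The direct sum of a finite family of modules. -/
noncomputable def piObj {n : ℕ} (W : Fin n → WtMod h) : WtMod h where
  carrier := ∀ i, (W i).carrier
  op x := LinearMap.pi fun i => (W i).op x ∘ₗ LinearMap.proj i
  Γ := LinearMap.pi fun i => (W i).Γ ∘ₗ LinearMap.proj i
  isOps :=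
    { K_Kinv := LinearMap.ext fun v => funext fun i => (W i).isOps.pw.1 _
      Kinv_K := LinearMap.ext fun v => funext fun i => (W i).isOps.pw.2.1 _
      K_E := LinearMap.ext fun v => funext fun i => LinearMap.congr_fun (W i).isOps.K_E (v i)
      K_G := LinearMap.ext fun v => funext fun i => LinearMap.congr_fun (W i).isOps.K_G (v i)
      K_X := LinearMap.ext fun v => funext fun i => LinearMap.congr_fun (W i).isOps.K_X (v i)
      K_Y := LinearMap.ext fun v => funext fun i => LinearMap.congr_fun (W i).isOps.K_Y (v i)
      E_X := LinearMap.ext fun v => funext fun i => LinearMap.congr_fun (W i).isOps.E_X (v i)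
      E_Y := LinearMap.ext fun v => funext fun i => LinearMap.congr_fun (W i).isOps.E_Y (v i)
      E_G := LinearMap.ext fun v => funext fun i => LinearMap.congr_fun (W i).isOps.E_G (v i)
      G_X := LinearMap.ext fun v => funext fun i => LinearMap.congr_fun (W i).isOps.G_X (v i)
      G_Y := LinearMap.ext fun v => funext fun i => LinearMap.congr_fun (W i).isOps.G_Y (v i)
      X_Y := LinearMap.ext fun v => funext fun i => LinearMap.congr_fun (W i).isOps.X_Y (v i)
      X_X := LinearMap.ext fun v => funext fun i => LinearMap.congr_fun (W i).isOps.X_X (v i)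
      Y_Y := LinearMap.ext fun v => funext fun i => LinearMap.congr_fun (W i).isOps.Y_Y (v i)
      Γ_Γ := LinearMap.ext fun v => funext fun i => LinearMap.congr_fun (W i).isOps.Γ_Γ (v i)
      Γ_E := LinearMap.ext fun v => funext fun i => LinearMap.congr_fun (W i).isOps.Γ_E (v i)
      Γ_G := LinearMap.ext fun v => funext fun i => LinearMap.congr_fun (W i).isOps.Γ_G (v i)
      Γ_K := LinearMap.ext fun v => funext fun i => LinearMap.congr_fun (W i).isOps.Γ_K (v i)
      Γ_X := LinearMap.ext fun v => funext fun i => LinearMap.congr_fun (W i).isOps.Γ_X (v i)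
      Γ_Y := LinearMap.ext fun v => funext fun i => LinearMap.congr_fun (W i).isOps.Γ_Y (v i)
      span := by
        have hs : ∀ i (T : Module.End ℂ (W i).carrier) (c : ℂ) (v : (W i).carrier), T v = c • v →
            ∀ (A : ∀ j, Module.End ℂ (W j).carrier), A i = T →
            LinearMap.pi (fun j => A j ∘ₗ LinearMap.proj j)
              (LinearMap.single ℂ (fun j => (W j).carrier) i v) =
            c • LinearMap.single ℂ (fun j => (W j).carrier) i v := by
          rintro i T c v hv A rfl
          refine funext fun j => ?_
          rcases eq_or_ne j i with rfl | hj
          · simpa using hv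
          · simp [hj]
        rw [eq_top_iff]
        intro v _
        rw [← LinearMap.sum_single_apply (fun j => (W j).carrier) v]
        refine Submodule.sum_mem _ fun i _ => ?_
        have h1 : ∀ P : Submodule ℂ (∀ i, (W i).carrier), (∀ w e g s, (W i).IsWt w e g s →
            LinearMap.single ℂ (fun j => (W j).carrier) i w ∈ P) →
            ∀ w, LinearMap.single ℂ (fun j => (W j).carrier) i w ∈ P := by
          intro P hP w
          have h2 : ⊤ ≤ P.comap (LinearMap.single ℂ (fun j => (W j).carrier) i) := by
            rw [← (W i).isOps.span_HW, Submodule.span_le]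
            rintro w ⟨e, g, s, hw⟩
            exact hP w e g s hw
          exact h2 (Submodule.mem_top (x := w))
        refine h1 _ (fun w e g s hw => ?_) (v i)
        exact Submodule.subset_span ⟨e, g,
          hs i _ _ _ hw.E (fun j => (W j).op .E) rfl, hs i _ _ _ hw.G (fun j => (W j).op .G) rfl,
          hs i _ _ _ hw.K (fun j => (W j).op .K) rfl⟩ }

theorem isDirectSum_piObj {n : ℕ} (W : Fin n → WtMod h) : IsDirectSum (piObj W) W := by
  have hop : ∀ (i : Fin n) (A : ∀ j, Module.End ℂ (W j).carrier),
      LinearMap.single ℂ (fun j => (W j).carrier) i ∘ₗ A i =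
      LinearMap.pi (fun j => A j ∘ₗ LinearMap.proj j) ∘ₗ
        LinearMap.single ℂ (fun j => (W j).carrier) i := by
    intro i A
    refine LinearMap.ext fun v => funext fun j => ?_
    rcases eq_or_ne j i with rfl | hj
    · simp
    · simp [hj]
  refine ⟨fun i => ⟨LinearMap.single ℂ (fun j => (W j).carrier) i,
    fun x => hop i fun j => (W j).op x, hop i fun j => (W j).Γ⟩,
    fun i => ⟨LinearMap.proj i, fun x => rfl, rfl⟩, hom_ext ?_, fun i => hom_ext ?_,
    fun i j hij => hom_ext ?_⟩
  · rw [lin_sum]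
    refine LinearMap.ext fun v => ?_
    rw [LinearMap.sum_apply]
    exact (LinearMap.sum_single_apply (fun j => (W j).carrier) v).symm
  · exact LinearMap.ext fun v => Pi.single_eq_same (M := fun j => (W j).carrier) i v
  · exact LinearMap.ext fun v => Pi.single_eq_of_ne (M := fun j => (W j).carrier) hij.symm v

/-- The weights of degree `c`. -/
def degreeSet (c : CmodZ × CmodZ) : Set (ℂ × ℂ × ℂ) := {w | ((w.1 : CmodZ), (w.2.1 : CmodZ)) = c}

theorem weightProj_degreeSet_op (V : WtMod h) (c : CmodZ × CmodZ) (x : Gen) {v : V.carrier}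
    {e g s : ℂ} (hv : V.IsWt v e g s) :
    V.weightProj (degreeSet c) (V.op x v) = V.op x (V.weightProj (degreeSet c) v) := by
  classical
  have key : ∀ x e' g' s', V.IsWt (V.op x v) e' g' s' → (e' : CmodZ) = e → (g' : CmodZ) = g →
      V.weightProj (degreeSet c) (V.op x v) = V.op x (V.weightProj (degreeSet c) v) := by
    intro x e' g' s' hv' he hg
    have h1 : (e', g', s') ∈ degreeSet c ↔ (e, g, s) ∈ degreeSet c := by
      simp only [degreeSet, Set.mem_ofPred_eq, he, hg]
    rw [weightProj_apply _ hv, weightProj_apply _ hv']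
    simp only [h1]
    split_ifs
    · rfl
    · rw [map_zero]
  have hw := isWeightMap_weightProj V (degreeSet c)
  cases x with
  | X => exact key _ _ _ _ (hv.X V.isOps) rfl (class_add_one g)
  | Y => exact key _ _ _ _ (hv.Y V.isOps) rfl (class_sub_one g)
  | E => exact hw.E v
  | G => exact hw.G v
  | K => exact hw.K v
  | Kinv => exact hw.Kinv v

/-- The projection to the sum of the weight spaces of degree `c`. -/
noncomputable def degreeProj (V : WtMod h) (c : CmodZ × CmodZ) : V ⟶ V where
  toLin := V.weightProj (degreeSet c)
  op_comm x := ext_HW V.isOps fun v e g s hv => weightProj_degreeSet_op V c x hv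
  Γ_comm := LinearMap.ext fun v => (isWeightMap_weightProj V (degreeSet c)).Γ v

open Classical in
theorem lin_degreeProj {V : WtMod h} (c : CmodZ × CmodZ) {v : V.carrier} {e g s : ℂ}
    (hv : V.IsWt v e g s) :
    lin (degreeProj V c) v = if ((e : CmodZ), (g : CmodZ)) = c then v else 0 :=
  (weightProj_apply (degreeSet c) hv).trans (if_congr Iff.rfl rfl rfl)

theorem exists_weight_of_dual {V : WtMod h} {f : Module.Dual ℂ V.carrier} (hf : f ≠ 0) {e b : ℂ}
    (hE : ∀ v, -(f (V.op .E v)) = e * f v) (hG : ∀ v, -(f (V.op .G v)) = b * f v) :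
    ∃ v e' b' s', v ≠ 0 ∧ V.IsWt v e' b' s' ∧ e = -e' ∧ b = -b' := by
  by_contra! hne
  refine hf (ext_HW V.isOps fun v e' b' s' hv => ?_)
  by_contra h0
  have hv0 : v ≠ 0 := by rintro rfl; exact h0 (map_zero f)
  have h1 := hE v
  have h2 := hG v
  rw [hv.E, map_smul, smul_eq_mul, ← neg_mul] at h1
  rw [hv.G, map_smul, smul_eq_mul, ← neg_mul] at h2
  exact hne v e' b' s' hv0 hv (mul_right_cancel₀ h0 h1).symm (mul_right_cancel₀ h0 h2).symm

theorem isGrading : IsGrading (weightDegree h) where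
  of_iso g V W hV φ := by
    intro e b w hw0 hE hG
    refine hV e b (lin φ.inv w) (fun h0 => hw0 ?_) ?_ ?_
    · have h1 := LinearMap.congr_fun (congrArg lin φ.inv_hom_id) w
      rw [lin_comp, LinearMap.comp_apply, h0, map_zero] at h1
      exact h1.symm
    · rw [← φ.inv.op_apply, hE, map_smul]
    · rw [← φ.inv.op_apply, hG, map_smul]
  hom_eq_zero g g' V W hV hW hne f := by
    refine hom_ext (ext_HW V.isOps fun v e b s hv => ?_)
    by_contra h0
    have h1 : lin f v ≠ 0 := h0
    have hv0 : v ≠ 0 := by rintro rfl; exact h1 (map_zero _)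
    have hfv := (isWeightMap_lin f).map_wt hv
    exact hne ((hV _ _ _ hv0 hv.E hv.G).symm.trans (hW _ _ _ h1 hfv.E hfv.G))
  exists_decomposition V := by
    classical
    obtain ⟨n, b, e, g, s, hb⟩ := V.exists_weightBasis
    let c : Fin n → CmodZ × CmodZ := fun i => ((e i : CmodZ), (g i : CmodZ))
    let t : Finset (CmodZ × CmodZ) := Finset.univ.image c
    let φ := t.equivFin
    refine ⟨t.card, fun i => (φ.symm i).1, fun i => rangeObj (degreeProj V (φ.symm i).1),
      fun i j hij => φ.symm.injective (Subtype.ext hij), fun i => ?_,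
      isDirectSum_range (hom_ext (b.ext fun i => ?_)) fun i j hij => hom_ext (b.ext fun k => ?_)⟩
    · rw [weightDegree_iff]
      rintro ⟨_, v, rfl⟩ e' b' s' hv0 hv
      have hw : V.IsWt (lin (degreeProj V (φ.symm i).1) v) e' b' s' :=
        (isWeightMap_lin (rangeι (degreeProj V (φ.symm i).1))).map_wt hv
      have h1 : lin (degreeProj V (φ.symm i).1) (lin (degreeProj V (φ.symm i).1) v) =
          lin (degreeProj V (φ.symm i).1) v := by
        rw [← LinearMap.comp_apply]
        refine LinearMap.congr_fun (b.ext fun k => ?_) v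
        rw [LinearMap.comp_apply, lin_degreeProj _ (hb k)]
        split_ifs with hk
        · rw [lin_degreeProj _ (hb k), if_pos hk]
        · rw [map_zero]
      rw [lin_degreeProj _ hw] at h1
      by_contra hne
      rw [if_neg hne] at h1
      exact hv0 (Subtype.ext h1.symm)
    · have hmem : c i ∈ t := Finset.mem_image_of_mem c (Finset.mem_univ i)
      rw [lin_sum, LinearMap.sum_apply, lin_id, LinearMap.id_apply,
        Finset.sum_eq_single (φ ⟨c i, hmem⟩), lin_degreeProj _ (hb i), if_pos]
      · rw [Equiv.symm_apply_apply]
      · intro j _ hj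
        rw [lin_degreeProj _ (hb i), if_neg]
        intro heq
        exact hj (by rw [← φ.apply_symm_apply j]; congr 1; exact Subtype.ext heq.symm)
      · simp
    · rw [lin_comp, LinearMap.comp_apply, lin_degreeProj _ (hb k)]
      split_ifs with hk
      · rw [lin_degreeProj _ (hb k), if_neg]
        · rfl
        · exact fun heq => hij (φ.symm.injective (Subtype.ext (hk.symm.trans heq)))
      · rw [map_zero]; rfl
  exists_sum n g W _ _ := ⟨_, isDirectSum_piObj W⟩
  unit := weightDegree_eps 0 0 0 (by simp [h.pow_zero])
  dual g V hV := by
    intro e b f hf0 hE hG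
    obtain ⟨v, e', b', s', hv0, hv, rfl, rfl⟩ := exists_weight_of_dual (V := V) (f := f) hf0
      (LinearMap.congr_fun hE) (LinearMap.congr_fun hG)
    rw [← hV _ _ _ hv0 hv.E hv.G]
    rfl
  tensor g g' V W hV hW := by
    refine weightDegree_of_ext fun F hF => ?_
    have key : ∀ F : Module.End ℂ (V.carrier ⊗[ℂ] W.carrier), (∀ v e g s, V.IsWt v e g s →
        ∀ w e' g' s', W.IsWt w e' g' s' → F (v ⊗ₜ w) = 0) → F = 0 := fun F hF =>
      ext_HW2 V.isOps W.isOps hF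
    refine key F fun v e b s hv w e' b' s' hw => ?_
    rcases eq_or_ne v 0 with rfl | hv0
    · rw [zero_tmul]; exact map_zero F
    rcases eq_or_ne w 0 with rfl | hw0
    · rw [tmul_zero]; exact map_zero F
    refine hF _ _ _ _ (hv.tmul hw) ?_
    rw [← hV _ _ _ hv0 hv.E hv.G, ← hW _ _ _ hw0 hw.E hw.G]
    rfl

end WtMod
namespace WtMod
variable {h : QParam}

/-! ### Tensor products with one-dimensional modules -/

theorem raw_shift_kac (h : QParam) (α a b : ℂ) (p : ZMod 2) {e : ℂ} (he : h.pow e = 1) (x : Gen) :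
    (TensorProduct.rid ℂ (ℂ × ℂ)).toLinearMap ∘ₗ tensorOps (kacOps h α a)
      (LinearMap.prodMap (parSign p • 1) (-parSign p • 1)) (epsOps h e b) x =
    kacOps h (α + e) (a + b) x ∘ₗ (TensorProduct.rid ℂ (ℂ × ℂ)).toLinearMap := by
  cases x <;> ext <;> simp [tensorOps, kacOps, epsOps, h.pow_add, h.pow_neg, he] <;> ring

/-- Tensoring with `ε(e, b)` shifts the highest weight of a Kac module, provided that `q ^ e = 1`. -/
noncomputable def shiftKac (h : QParam) (α a b : ℂ) (p p' : ZMod 2) {e : ℂ} (he : h.pow e = 1)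
    (he' : h.pow e * h.pow e = 1) : kac h α a p ⊗ eps h e b p' he' ≅ kac h (α + e) (a + b) (p + p') :=
  isoOfLinearEquiv (V := tens (kac h α a p) (eps h e b p' he')) (TensorProduct.rid ℂ (ℂ × ℂ))
    (raw_shift_kac h α a b p he) (by
      have key : (TensorProduct.rid ℂ (ℂ × ℂ)).toLinearMap ∘ₗ
          map (LinearMap.prodMap (parSign p • 1) (-parSign p • 1)) (parSign p' • 1) =
          (LinearMap.prodMap (parSign (p + p') • 1) (-parSign (p + p') • 1) : Module.End ℂ (ℂ × ℂ)) ∘ₗ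
            (TensorProduct.rid ℂ (ℂ × ℂ)).toLinearMap := by
        ext <;> simp [parSign_add] <;> ring
      exact key)

theorem raw_shift_ind (h : QParam) (e g b : ℂ) (p : ZMod 2) {e' : ℂ} (he : h.pow e' = 1) (x : Gen) :
    (TensorProduct.rid ℂ (ℂ × ℂ × ℂ × ℂ)).toLinearMap ∘ₗ tensorOps (indOps h e g)
      (indΓ p) (epsOps h e' b) x =
    indOps h (e + e') (g + b) x ∘ₗ (TensorProduct.rid ℂ (ℂ × ℂ × ℂ × ℂ)).toLinearMap := by
  have hbr : h.bracket (e + e') = h.bracket e := by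
    simp [QParam.bracket, h.pow_add, h.pow_neg, he]
  refine TensorProduct.ext (ind_ext fun a y z t => LinearMap.ext_ring ?_)
  cases x <;> simp [tensorOps, epsOps, indOps_apply h _ _ 0, h.pow_add, h.pow_neg, he, hbr]
  · exact ⟨by ring, by ring, by ring, by ring⟩
  · exact ⟨by ring, by ring, by ring, by ring⟩

/-- Tensoring with `ε(e', b)` shifts the weight of the generator of an induced module, provided that
`q ^ e' = 1`. -/
noncomputable def shiftInd (h : QParam) (e g b : ℂ) (p p' : ZMod 2) {e' : ℂ} (he : h.pow e' = 1)
    (he' : h.pow e' * h.pow e' = 1) :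
    ind h e g p ⊗ eps h e' b p' he' ≅ ind h (e + e') (g + b) (p + p') :=
  isoOfLinearEquiv (V := tens (ind h e g p) (eps h e' b p' he'))
    (TensorProduct.rid ℂ (ℂ × ℂ × ℂ × ℂ)) (raw_shift_ind h e g b p he) (by
      have key : (TensorProduct.rid ℂ (ℂ × ℂ × ℂ × ℂ)).toLinearMap ∘ₗ
          map (indΓ p) (parSign p' • 1) =
          indΓ (p + p') ∘ₗ (TensorProduct.rid ℂ (ℂ × ℂ × ℂ × ℂ)).toLinearMap := by
        refine TensorProduct.ext (ind_ext fun a y z t => LinearMap.ext_ring ?_)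
        simp [indOps_apply h 0 0, parSign_add]
        exact ⟨by ring, by ring, by ring, by ring⟩
      exact key)

theorem coevaluation_self : coevaluation ℂ ℂ 1 = 1 ⊗ₜ LinearMap.id := by
  refine coev_inj ?_
  rw [dualTensorHom_coev]
  ext
  simp [dualTensorHom_apply]

theorem qdim_eps (e b : ℂ) (p : ZMod 2) (he : h.pow e = 1) (he' : h.pow e * h.pow e = 1) :
    qdim (eps h e b p he') = parSign p • 𝟙 (𝟙_ (WtMod h)) := by
  have key : ∀ F F' : Module.End ℂ ℂ, F 1 = F' 1 → F = F' := fun F F' h0 => LinearMap.ext_ring h0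
  refine hom_ext (key _ _ ?_)
  have h1 : lin (evR (eps h e b p he')) ((1 : ℂ) ⊗ₜ[ℂ] LinearMap.id : ℂ ⊗[ℂ] Module.Dual ℂ ℂ) =
      parSign p * (h.pow e * 1) := evR_tmul (eps h e b p he') (1 : ℂ) (LinearMap.id : Module.Dual ℂ ℂ)
  rw [he, mul_one] at h1
  refine (congrArg (lin (evR (eps h e b p he'))) coevaluation_self).trans (h1.trans ?_)
  rfl

theorem isWt_eps (e b : ℂ) (p : ZMod 2) (he : h.pow e * h.pow e = 1) :
    HW h (epsOps h e b) (parSign p • 1) (1 : ℂ) e b (parSign p) := by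
  refine isWt_of_E_G_Γ (V := eps h e b p he) (v := (1 : ℂ)) rfl rfl rfl (parSign_cases p)

theorem twist_eps (e b : ℂ) (p : ZMod 2) (he : h.pow e = 1) (he' : h.pow e * h.pow e = 1)
    (heb : h.pow (e * b) = 1) : (θ_ (eps h e b p he')).hom = 𝟙 _ := by
  have key : ∀ F F' : Module.End ℂ ℂ, F 1 = F' 1 → F = F' := fun F F' h0 => LinearMap.ext_ring h0
  refine hom_ext (key _ _ ?_)
  refine (twistMap_apply (isOps_eps h e b p he') (isWt_eps e b p he')).trans ?_
  simp only [epsOps, he, heb, LinearMap.zero_apply, smul_zero, sub_zero, inv_one, mul_one, one_smul]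
  rfl

/-- The double braiding with `ε(e, b)`. -/
theorem raw_monodromy_eps {A : Type} [AddCommGroup A] [Module ℂ A] [FiniteDimensional ℂ A]
    {ρ : Gen → Module.End ℂ A} {Γ : Module.End ℂ A} (o : IsOps h ρ Γ) {v : A} {e g s : ℂ}
    (hv : HW h ρ Γ v e g s) (e' b : ℂ) (p : ZMod 2) (he : h.pow e' * h.pow e' = 1) :
    braidMap h (epsOps h e' b) (parSign p • 1) ρ Γ
      (braidMap h ρ Γ (epsOps h e' b) (parSign p • 1) (v ⊗ₜ (1 : ℂ))) =
      h.pow (-2 * (e * b + g * e')) • v ⊗ₜ (1 : ℂ) := by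
  have hw := isWt_eps e' b p he
  have oW := isOps_eps h e' b p he
  have k1 : epsOps h e' b .X 1 = 0 := rfl
  have k2 : epsOps h e' b .Y 1 = 0 := rfl
  have e1 : h.pow (b * e) = h.pow (e * b) := by rw [mul_comm]
  have e2 : h.pow (e' * g) = h.pow (g * e') := by rw [mul_comm]
  have e3 : h.pow (-2 * (e * b + g * e')) = (h.pow (e * b))⁻¹ * (h.pow (e * b))⁻¹ *
      ((h.pow (g * e'))⁻¹ * (h.pow (g * e'))⁻¹) := by
    rw [← h.pow_neg, ← h.pow_neg, ← h.pow_add, ← h.pow_add, ← h.pow_add]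
    congr 1
    ring
  simp only [braidMap_apply o oW hv hw, k1, k2, zero_tmul, tmul_zero, smul_zero, add_zero, map_smul,
    braidMap_apply oW o hw hv, smul_smul, e1, e2, e3]
  rcases hv.sq with rfl | rfl <;> rcases hw.sq with hs | hs <;> rw [hs] <;> congr 1 <;> ring

theorem monodromy_eps {V : WtMod h} (e' b c : ℂ) (p : ZMod 2) (he : h.pow e' * h.pow e' = 1)
    (hV : ∀ v e g s, v ≠ 0 → V.IsWt v e g s → h.pow (-2 * (e * b + g * e')) = c) :
    (β_ V (eps h e' b p he)).hom ≫ (β_ (eps h e' b p he) V).hom = c • 𝟙 _ := by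
  have key : ∀ F F' : V.carrier ⊗[ℂ] ℂ →ₗ[ℂ] V.carrier ⊗[ℂ] ℂ, (∀ v e g s, V.IsWt v e g s →
      F (v ⊗ₜ 1) = F' (v ⊗ₜ 1)) → F = F' := fun F F' hF => TensorProduct.ext
    (ext_HW V.isOps fun v e g s hv => LinearMap.ext_ring (hF v e g s hv))
  refine hom_ext (key _ _ fun v e g s hv => ?_)
  refine (raw_monodromy_eps V.isOps hv e' b p he).trans ?_
  rcases eq_or_ne v 0 with rfl | hv0
  · rw [zero_tmul, smul_zero]
    exact (map_zero (c • (LinearMap.id : V.carrier ⊗[ℂ] ℂ →ₗ[ℂ] _))).symm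
  · rw [hV v e g s hv0 hv]
    rfl

end WtMod

/-! ### The realisation of the translation group -/

section
variable {r : ℕ} {hr : 3 ≤ r}

theorem sigma_obj (z : ℤ × ℤ × ZMod 2) : (sigma r hr).obj ⟨z⟩ =
    WtMod.eps (root r hr) (z.1 * r) (z.2.1 * r) z.2.2 (by rw [root_pow, one_mul]) := rfl

theorem lin_sigma_map {x y : Discrete (ℤ × ℤ × ZMod 2)} (f : x ⟶ y) :
    (WtMod.lin ((sigma r hr).map f) : ℂ →ₗ[ℂ] ℂ) = LinearMap.id := by
  obtain ⟨x⟩ := x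
  obtain ⟨y⟩ := y
  obtain rfl : x = y := Discrete.eq_of_hom f
  have h1 : f = 𝟙 _ := Subsingleton.elim _ _
  rw [h1, CategoryTheory.Functor.map_id]
  rfl

theorem raw_sigma (h : QParam) (e e' b b' : ℂ) (Γ : Module.End ℂ ℂ) (x : Gen) :
    (TensorProduct.lid ℂ ℂ).toLinearMap ∘ₗ tensorOps (WtMod.epsOps h e b) Γ (WtMod.epsOps h e' b') x =
      WtMod.epsOps h (e + e') (b + b') x ∘ₗ (TensorProduct.lid ℂ ℂ).toLinearMap := by
  cases x <;> ext <;> simp [tensorOps, WtMod.epsOps, h.pow_add] <;> ring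

theorem epsOps_sigma_add (z z' : ℤ × ℤ × ZMod 2) (x : Gen) :
    (TensorProduct.lid ℂ ℂ).toLinearMap ∘ₗ tensorOps (WtMod.epsOps (root r hr) (z.1 * r) (z.2.1 * r))
      (parSign z.2.2 • 1) (WtMod.epsOps (root r hr) (z'.1 * r) (z'.2.1 * r)) x =
    WtMod.epsOps (root r hr) ((z + z').1 * r) ((z + z').2.1 * r) x ∘ₗ
      (TensorProduct.lid ℂ ℂ).toLinearMap := by
  have h1 : (((z + z').1 : ℤ) : ℂ) * r = z.1 * r + z'.1 * r := by
    rw [Prod.fst_add]; push_cast; ring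
  have h2 : (((z + z').2.1 : ℤ) : ℂ) * r = z.2.1 * r + z'.2.1 * r := by
    rw [Prod.snd_add, Prod.fst_add]; push_cast; ring
  rw [h1, h2]
  exact raw_sigma _ _ _ _ _ _ x

/-- The monoidal structure of `sigma` is given by the multiplication of `ℂ`. -/
noncomputable abbrev sigmaMonoidal (r : ℕ) (hr : 3 ≤ r) : (sigma r hr).Monoidal :=
  Functor.CoreMonoidal.toMonoidal
    { εIso := WtMod.isoOfLinearEquiv (V := 𝟙_ (WtMod (root r hr)))
        (W := (sigma r hr).obj (𝟙_ (Discrete (ℤ × ℤ × ZMod 2)))) (LinearEquiv.refl ℂ ℂ)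
        (fun x => by
          have h1 : WtMod.epsOps (root r hr) 0 0 x =
              WtMod.epsOps (root r hr) (((0 : ℤ) : ℂ) * r) (((0 : ℤ) : ℂ) * r) x := by
            rw [Int.cast_zero, zero_mul]
          exact h1) rfl
      μIso := fun z z' => WtMod.isoOfLinearEquiv (V := (sigma r hr).obj z ⊗ (sigma r hr).obj z')
        (W := (sigma r hr).obj (z ⊗ z')) (TensorProduct.lid ℂ ℂ)
        (fun x => epsOps_sigma_add z.as z'.as x) (by
          have h1 : (TensorProduct.lid ℂ ℂ).toLinearMap ∘ₗ
              map (parSign z.as.2.2 • 1) (parSign z'.as.2.2 • 1) =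
              (parSign (z.as.2.2 + z'.as.2.2) • 1 : Module.End ℂ ℂ) ∘ₗ
                (TensorProduct.lid ℂ ℂ).toLinearMap := by
            ext; simp [parSign_add]
          exact h1)
      μIso_hom_natural_left := fun {z z'} f w => by
        have key : ∀ F F' : ℂ →ₗ[ℂ] ℂ, F = LinearMap.id → F' = LinearMap.id →
            (TensorProduct.lid ℂ ℂ).toLinearMap ∘ₗ map F LinearMap.id =
            F' ∘ₗ (TensorProduct.lid ℂ ℂ).toLinearMap := by
          rintro _ _ rfl rfl
          rw [TensorProduct.map_id]; rfl
        exact WtMod.hom_ext (key _ _ (lin_sigma_map f) (lin_sigma_map (f ▷ w)))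
      μIso_hom_natural_right := fun {z z'} w f => by
        have key : ∀ F F' : ℂ →ₗ[ℂ] ℂ, F = LinearMap.id → F' = LinearMap.id →
            (TensorProduct.lid ℂ ℂ).toLinearMap ∘ₗ map LinearMap.id F =
            F' ∘ₗ (TensorProduct.lid ℂ ℂ).toLinearMap := by
          rintro _ _ rfl rfl
          rw [TensorProduct.map_id]; rfl
        exact WtMod.hom_ext (key _ _ (lin_sigma_map f) (lin_sigma_map (w ◁ f)))
      associativity := fun z z' z'' => by
        have key : ∀ F : ℂ →ₗ[ℂ] ℂ, F = LinearMap.id →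
            (F ∘ₗ (TensorProduct.lid ℂ ℂ).toLinearMap) ∘ₗ
              map (TensorProduct.lid ℂ ℂ).toLinearMap LinearMap.id =
            ((TensorProduct.lid ℂ ℂ).toLinearMap ∘ₗ
              map LinearMap.id (TensorProduct.lid ℂ ℂ).toLinearMap) ∘ₗ
              (TensorProduct.assoc ℂ ℂ ℂ ℂ).toLinearMap := by
          rintro _ rfl
          ext; simp
        exact WtMod.hom_ext (key _ (lin_sigma_map (α_ z z' z'').hom))
      left_unitality := fun z => by
        have key : ∀ F : ℂ →ₗ[ℂ] ℂ, F = LinearMap.id → (TensorProduct.lid ℂ ℂ).toLinearMap =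
            (F ∘ₗ (TensorProduct.lid ℂ ℂ).toLinearMap) ∘ₗ
              map (LinearEquiv.refl ℂ ℂ).toLinearMap LinearMap.id := by
          rintro _ rfl
          ext; simp
        exact WtMod.hom_ext (key _ (lin_sigma_map (λ_ z).hom))
      right_unitality := fun z => by
        have key : ∀ F : ℂ →ₗ[ℂ] ℂ, F = LinearMap.id → (TensorProduct.rid ℂ ℂ).toLinearMap =
            (F ∘ₗ (TensorProduct.lid ℂ ℂ).toLinearMap) ∘ₗ
              map LinearMap.id (LinearEquiv.refl ℂ ℂ).toLinearMap := by
          rintro _ rfl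
          ext; simp
        exact WtMod.hom_ext (key _ (lin_sigma_map (ρ_ z).hom)) }

/-- The character `z ↦ exp (-4 π i z)` of `ℂ / ℤ`. -/
noncomputable def monodromyChar : CmodZ →+ Additive ℂˣ :=
  QuotientAddGroup.lift _
    { toFun := fun z => Additive.ofMul (Units.mk0 (Complex.exp (-2 * (2 * Real.pi * Complex.I) * z))
        (Complex.exp_ne_zero _))
      map_zero' := by
        rw [← ofMul_one]
        congr 1
        ext
        simp
      map_add' := fun x y => by
        rw [← ofMul_mul]
        congr 1
        ext
        simp [mul_add, Complex.exp_add] } (by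
    intro x hx
    obtain ⟨n, rfl⟩ := AddSubgroup.mem_zmultiples_iff.1 hx
    rw [AddMonoidHom.mem_ker, AddMonoidHom.coe_mk, ZeroHom.coe_mk, ← ofMul_one]
    congr 1
    ext
    rw [Units.val_mk0, Units.val_one, Complex.exp_eq_one_iff]
    exact ⟨-2 * n, by simp; ring⟩)

theorem monodromyChar_zsmul (z : ℂ) (n : ℤ) : ((n • monodromyChar (z : CmodZ)).toMul : ℂ) =
    (root r hr).pow (-2 * (z * (n * r))) := by
  have h0 : (r : ℂ) ≠ 0 := by exact_mod_cast (by omega : r ≠ 0)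
  have h1 : ((monodromyChar (z : CmodZ)).toMul : ℂ) =
      Complex.exp (-2 * (2 * Real.pi * Complex.I) * z) := rfl
  rw [toMul_zsmul, Units.val_zpow_eq_zpow_val, h1, ← Complex.exp_int_mul, QParam.pow, root]
  congr 1
  field_simp

/-- The double braiding of `σ(n, n', p)` and a module of degree `(x, y)` is `χ(n' x + n y)`, where
`χ` is the character `z ↦ exp (-4 π i z)`. -/
noncomputable def monodromy : CmodZ × CmodZ →+ ℤ × ℤ × ZMod 2 →+ Additive ℂˣ :=
  AddMonoidHom.mk' (fun g => AddMonoidHom.mk'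
    (fun z => z.2.1 • monodromyChar g.1 + z.1 • monodromyChar g.2) fun z z' => by
      simp only [Prod.fst_add, Prod.snd_add, add_zsmul]
      exact add_add_add_comm _ _ _ _) fun g g' => AddMonoidHom.ext fun z => by
    simp only [Prod.fst_add, Prod.snd_add, map_add, zsmul_add, AddMonoidHom.mk'_apply,
      AddMonoidHom.add_apply]
    exact add_add_add_comm _ _ _ _

theorem compatible_monodromy {g : CmodZ × CmodZ} {V : WtMod (root r hr)}
    (hV : weightDegree (root r hr) g V) (z : ℤ × ℤ × ZMod 2) :
    (β_ V ((sigma r hr).obj ⟨z⟩)).hom ≫ (β_ ((sigma r hr).obj ⟨z⟩) V).hom =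
      ((monodromy g z).toMul : ℂ) • 𝟙 (V ⊗ (sigma r hr).obj ⟨z⟩) := by
  refine WtMod.monodromy_eps _ _ _ _ (by rw [root_pow, one_mul]) fun v e b s hv0 hv => ?_
  obtain ⟨h1, h2⟩ := WtMod.weightDegree_apply hV hv0 hv
  have h3 : monodromy g z = z.2.1 • monodromyChar g.1 + z.1 • monodromyChar g.2 := rfl
  rw [h3, ← h1, ← h2, toMul_add, Units.val_mul, monodromyChar_zsmul (hr := hr),
    monodromyChar_zsmul (hr := hr), ← QParam.pow_add]
  congr 1
  ring

end
namespace WtMod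
variable {h : QParam}

/-! ### Freeness of the realisation -/

theorem trace_eq_of_iso {V W : WtMod h} (φ : V ≅ W) {A : Module.End ℂ V.carrier}
    {B : Module.End ℂ W.carrier} (hAB : lin φ.hom ∘ₗ A = B ∘ₗ lin φ.hom) :
    LinearMap.trace ℂ V.carrier A = LinearMap.trace ℂ W.carrier B := by
  have h1 : lin φ.inv ∘ₗ lin φ.hom = LinearMap.id := congrArg lin φ.hom_inv_id
  have h2 : lin φ.hom ∘ₗ lin φ.inv = LinearMap.id := congrArg lin φ.inv_hom_id
  calc LinearMap.trace ℂ V.carrier A = LinearMap.trace ℂ V.carrier (lin φ.inv ∘ₗ (lin φ.hom ∘ₗ A)) := by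
        rw [← LinearMap.comp_assoc, h1, LinearMap.id_comp]
    _ = LinearMap.trace ℂ W.carrier (B ∘ₗ (lin φ.hom ∘ₗ lin φ.inv)) := by
        rw [hAB, LinearMap.trace_comp_comm', LinearMap.comp_assoc]
    _ = _ := by rw [h2, LinearMap.comp_id]

theorem raw_trace_shift {A : Type} [AddCommGroup A] [Module ℂ A] [FiniteDimensional ℂ A]
    (T : Module.End ℂ A) (c : ℂ) :
    LinearMap.trace ℂ (A ⊗[ℂ] ℂ) (map T 1 + map 1 (c • (1 : Module.End ℂ ℂ))) =
      LinearMap.trace ℂ A T + c * Module.finrank ℂ A := by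
  rw [map_add, LinearMap.trace_tensorProduct', LinearMap.trace_tensorProduct', map_smul,
    LinearMap.trace_one, LinearMap.trace_one]
  simp [mul_comm]

theorem exists_highestWeight {V : WtMod h} (hV : 𝟙 V ≠ 0) : ∃ (v : V.carrier) (e g : ℂ) (p : ZMod 2),
    v ≠ 0 ∧ V.IsWt v e g (parSign p) ∧ V.op .X v = 0 := by
  obtain ⟨v, e, g, s, hv0, hv⟩ : ∃ v e g s, v ≠ 0 ∧ V.IsWt v e g s := by
    by_contra! h0
    refine hV (hom_ext (ext_HW V.isOps fun v e g s hv => ?_))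
    by_contra hne
    exact h0 v e g s hne hv
  by_cases hX : V.op .X v = 0
  · obtain ⟨p, rfl⟩ := exists_parSign_eq hv.sq
    exact ⟨v, e, g, p, hv0, hv, hX⟩
  · have hXv := hv.X V.isOps
    obtain ⟨p, hp⟩ := exists_parSign_eq hXv.sq
    rw [← hp] at hXv
    exact ⟨_, _, _, p, hX, hXv, V.X_X_apply v⟩

/-- Simple modules are quotients of Kac modules. -/
theorem exists_kac_surjective {V : WtMod h} [Simple V] : ∃ (e g : ℂ) (p : ZMod 2)
    (f : kac h e g p ⟶ V), Function.Surjective (lin f) ∧ lin f (kacTop h e g p) ≠ 0 := by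
  obtain ⟨v, e, g, p, hv0, hv, hX⟩ := exists_highestWeight (id_nonzero V)
  have hf : lin (kacLift hv hX) (kacTop h e g p) ≠ 0 := by rwa [lin_kacLift_top]
  refine ⟨e, g, p, kacLift hv hX, ?_, hf⟩
  have hm : Mono (rangeι (kacLift hv hX)) := mono_of_injective _ Subtype.val_injective
  have h0 : rangeι (kacLift hv hX) ≠ 0 := by
    intro h0
    have h1 := rangeπ_ι (kacLift hv hX)
    rw [h0, Limits.comp_zero] at h1
    rw [← h1] at hf
    exact hf rfl
  have hi := isIso_of_mono_of_nonzero h0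
  intro w
  have h2 := LinearMap.congr_fun (congrArg lin (IsIso.inv_hom_id (rangeι (kacLift hv hX)))) w
  rw [lin_comp] at h2
  obtain ⟨u, hu⟩ := (lin (inv (rangeι (kacLift hv hX))) w).2
  exact ⟨u, hu.trans h2⟩

/-- The traces of `E` and `G` show that `e = b = 0`. The parity `p` vanishes because the highest weight
space of a simple module is one-dimensional. -/
theorem eq_zero_of_iso_tensor_eps {V : WtMod h} [Simple V] {e b : ℂ} {p : ZMod 2}
    {he : h.pow e * h.pow e = 1} (φ : V ⊗ eps h e b p he ≅ V) : e = 0 ∧ b = 0 ∧ p = 0 := by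
  have hn : (Module.finrank ℂ V.carrier : ℂ) ≠ 0 := by
    rw [Nat.cast_ne_zero]
    intro h0
    have := Module.finrank_zero_iff.1 h0
    exact id_nonzero V (hom_ext (LinearMap.ext fun v => Subsingleton.elim _ _))
  have hE := (raw_trace_shift (V.op .E) e).symm.trans (trace_eq_of_iso φ (φ.hom.op_comm .E))
  have hG := (raw_trace_shift (V.op .G) b).symm.trans (trace_eq_of_iso φ (φ.hom.op_comm .G))
  have he0 : e = 0 := (mul_eq_zero.1 (show e * (Module.finrank ℂ V.carrier : ℂ) = 0 by
    linear_combination hE)).resolve_right hn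
  have hb0 : b = 0 := (mul_eq_zero.1 (show b * (Module.finrank ℂ V.carrier : ℂ) = 0 by
    linear_combination hG)).resolve_right hn
  subst he0 hb0
  refine ⟨rfl, rfl, ?_⟩
  obtain ⟨α, a, s, f, hf, hft⟩ := exists_kac_surjective (V := V)
  -- the weight space of `V` which contains the highest weight vector is one-dimensional
  have hdim : ∀ w : V.carrier, V.op .G w = a • w → ∃ c : ℂ, w = c • lin f (kacTop h α a s) := by
    intro w hw
    obtain ⟨u, rfl⟩ := hf w
    have hu := kac_eq_add u
    generalize (show ℂ × ℂ from u).1 = x at hu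
    generalize (show ℂ × ℂ from u).2 = y at hu
    have h1 := (isWeightMap_lin f).map_wt (isWt_kacTop h α a s)
    have h2 := (isWeightMap_lin f).map_wt (isWt_kacBot h α a s)
    rw [hu, map_add, map_smul, map_smul, map_add, map_smul, map_smul, h1.G, h2.G] at hw
    refine ⟨x, ?_⟩
    have h3 : y • lin f (kacBot h α a s) = 0 := by
      have h4 : y • lin f (kacBot h α a s) =
        a • (x • lin f (kacTop h α a s) + y • lin f (kacBot h α a s)) -
          (x • a • lin f (kacTop h α a s) + y • (a - 1) • lin f (kacBot h α a s)) := by module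
      rw [h4, hw, sub_self]
    rw [hu, map_add, map_smul, map_smul, h3, add_zero]
  have h1 := (isWeightMap_lin f).map_wt (isWt_kacTop h α a s)
  have h2 : (V ⊗ eps h 0 0 p he).IsWt (lin f (kacTop h α a s) ⊗ₜ[ℂ] (1 : ℂ) : V.carrier ⊗[ℂ] ℂ)
    (α + 0) (a + 0) (parSign s * parSign p) := h1.tmul (isWt_eps 0 0 p he)
  have h3 := (isWeightMap_lin φ.hom).map_wt h2
  have h4 := h3.G
  rw [add_zero] at h4
  obtain ⟨c, hc⟩ := hdim _ h4
  have hne : lin φ.hom (lin f (kacTop h α a s) ⊗ₜ[ℂ] (1 : ℂ) : V.carrier ⊗[ℂ] ℂ) ≠ 0 := by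
    intro h0
    have h5 := LinearMap.congr_fun (congrArg lin φ.hom_inv_id)
      (lin f (kacTop h α a s) ⊗ₜ[ℂ] (1 : ℂ) : V.carrier ⊗[ℂ] ℂ)
    have h6 : (lin f (kacTop h α a s) ⊗ₜ[ℂ] (1 : ℂ) : V.carrier ⊗[ℂ] ℂ) = 0 :=
      h5.symm.trans ((congrArg (lin φ.inv) h0).trans (map_zero _))
    exact hft (by simpa using congrArg (TensorProduct.rid ℂ V.carrier) h6)
  have h5 := h3.Γ
  have h6 : V.Γ (c • lin f (kacTop h α a s)) = parSign s • (c • lin f (kacTop h α a s)) := by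
    rw [map_smul, h1.Γ, smul_comm]
  rw [← hc] at h6
  have h7 : parSign s * parSign p = parSign s := smul_left_injective ℂ hne (h5.symm.trans h6)
  have h8 : parSign p = parSign 0 := by
    rw [parSign_zero]
    exact mul_left_cancel₀ (parSign_ne_zero s) (h7.trans (mul_one _).symm)
  exact parSign_injective h8

theorem eps_congr {e e' b b' : ℂ} (p : ZMod 2) (he : e = e') (hb : b = b')
    (h1 : h.pow e * h.pow e = 1) (h2 : h.pow e' * h.pow e' = 1) :
    eps h e b p h1 = eps h e' b' p h2 := by
  subst he hb
  rfl

end WtMod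

section
variable {r : ℕ} {hr : 3 ≤ r}

theorem sigma_zero : (sigma r hr).obj ⟨0⟩ = 𝟙_ (WtMod (root r hr)) :=
  WtMod.eps_congr 0 (by simp) (by simp) (by rw [root_pow, one_mul])
    (by rw [QParam.pow_zero, one_mul])

theorem isFreeRealisation_sigma : IsFreeRealisation (sigma r hr) where
  obj_zero := sigma_zero
  qdim_obj z := by
    rw [sigma_obj, WtMod.qdim_eps _ _ _ (root_pow r hr z.1)]
    rcases parSign_cases z.2.2 with hs | hs <;> simp [hs]
  twist_obj z := by
    refine WtMod.twist_eps _ _ _ (root_pow r hr z.1) (by rw [root_pow, one_mul]) ?_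
    have h1 : (z.1 * r * (z.2.1 * r) : ℂ) = ((z.1 * r * z.2.1 : ℤ) : ℂ) * r := by
      push_cast; ring
    rw [h1, root_pow]
  free V z hV := by
    constructor
    · rintro ⟨φ⟩
      obtain ⟨h1, h2, h3⟩ := WtMod.eq_zero_of_iso_tensor_eps
        (he := by rw [root_pow, one_mul]) φ
      have hr0 : (r : ℂ) ≠ 0 := by exact_mod_cast (by omega : r ≠ 0)
      have h4 : z.1 = 0 := by exact_mod_cast (mul_eq_zero.1 h1).resolve_right hr0
      have h5 : z.2.1 = 0 := by exact_mod_cast (mul_eq_zero.1 h2).resolve_right hr0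
      exact Prod.ext h4 (Prod.ext h5 h3)
    · rintro rfl
      rw [sigma_zero]
      exact ⟨ρ_ V⟩

theorem weightDegree_sigma (z : ℤ × ℤ × ZMod 2) :
    weightDegree (root r hr) 0 ((sigma r hr).obj ⟨z⟩) := by
  have h1 := WtMod.weightDegree_eps (h := root r hr) (z.1 * r) (z.2.1 * r) z.2.2
    (by rw [root_pow, one_mul])
  have h2 : ∀ n : ℤ, ((n * r : ℂ) : CmodZ) = 0 := fun n =>
    (CmodZ_eq_iff (y := 0)).2 ⟨n * r, by push_cast; ring⟩
  rw [h2, h2] at h1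
  exact h1

end

namespace WtMod
variable {h : QParam}

/-! ### Morphisms between typical Kac modules -/

theorem kac_hom_eq_zero {α α' a a' : ℂ} {p p' : ZMod 2} (hα : h.bracket α' ≠ 0)
    (hne : (α, a, p) ≠ (α', a', p')) (f : kac h α a p ⟶ kac h α' a' p') : f = 0 := by
  refine kac_hom_ext ?_
  have h1 := (isWeightMap_lin f).map_wt (isWt_kacTop h α a p)
  have hX : (kac h α' a' p').op .X (lin f (kacTop h α a p)) = 0 := by
    rw [← f.op_apply, X_kacTop]
    exact map_zero _
  have hc := kac_eq_add (lin f (kacTop h α a p))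
  generalize (show ℂ × ℂ from lin f (kacTop h α a p)).1 = c at hc
  generalize (show ℂ × ℂ from lin f (kacTop h α a p)).2 = d at hc
  have hd : d = 0 := by
    rw [hc, map_add, map_smul, map_smul, X_kacTop, X_kacBot, smul_zero, zero_add, smul_smul] at hX
    exact (mul_eq_zero.1 ((smul_eq_zero.1 hX).resolve_right (kacTop_ne_zero _ _ _))).resolve_right hα
  rw [hd, zero_smul, add_zero] at hc
  rw [hc] at h1
  have h2 := isWt_kacTop h α' a' p'
  have hc0 : c = 0 := by
    by_contra hc0
    have h3 : c • kacTop h α' a' p' ≠ 0 := smul_ne_zero hc0 (kacTop_ne_zero _ _ _)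
    have hE := h1.E
    have hG := h1.G
    have hΓ := h1.Γ
    rw [map_smul, h2.E, smul_comm] at hE
    rw [map_smul, h2.G, smul_comm] at hG
    rw [map_smul, h2.Γ, smul_comm] at hΓ
    refine hne ?_
    rw [smul_left_injective ℂ h3 hE, smul_left_injective ℂ h3 hG,
      parSign_injective (smul_left_injective ℂ h3 hΓ)]
  rw [hc, hc0, zero_smul]
  rfl

theorem rank_hom_eq_one {V : WtMod h} {α a : ℂ} {p : ZMod 2} (φ : V ≅ kac h α a p) :
    Module.rank ℂ (V ⟶ V) = 1 := by
  rw [rank_eq_one_iff]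
  refine ⟨𝟙 V, fun h0 => kac_id_ne_zero (h := h) α a p ?_, fun f => ?_⟩
  · rw [← φ.inv_hom_id, ← Category.id_comp φ.hom, h0, Limits.zero_comp, Limits.comp_zero]
  · obtain ⟨c, hc⟩ := exists_eq_smul_id_kac (φ.inv ≫ f ≫ φ.hom)
    refine ⟨c, ?_⟩
    calc c • 𝟙 V = φ.hom ≫ (c • 𝟙 _) ≫ φ.inv := by simp
      _ = f := by rw [← hc]; simp

theorem rank_hom_eq_zero {V W : WtMod h} {α α' a a' : ℂ} {p p' : ZMod 2} (φ : V ≅ kac h α a p)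
    (ψ : W ≅ kac h α' a' p') (hα : h.bracket α' ≠ 0) (hne : (α, a, p) ≠ (α', a', p')) :
    Module.rank ℂ (V ⟶ W) = 0 := by
  have h0 : ∀ f : V ⟶ W, f = 0 := fun f => by
    calc f = φ.hom ≫ (φ.inv ≫ f ≫ ψ.hom) ≫ ψ.inv := by simp
      _ = 0 := by rw [kac_hom_eq_zero hα hne (φ.inv ≫ f ≫ ψ.hom)]; simp
  have : Subsingleton (V ⟶ W) := ⟨fun f g => (h0 f).trans (h0 g).symm⟩
  exact rank_subsingleton' _ _

theorem kac_iso_of_eq {α α' a a' : ℂ} {p p' : ZMod 2} (hα : α = α') (ha : a = a') (hp : p = p') :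
    Nonempty (kac h α a p ≅ kac h α' a' p') := by
  subst hα ha hp
  exact ⟨Iso.refl _⟩

end WtMod

section
variable {r : ℕ} {hr : 3 ≤ r} {lift : CmodZ × CmodZ → ℂ × ℂ}

/-! ### The generic degrees -/

/-- The shifts of the generic modules are Kac modules. -/
noncomputable def genericShift (g : CmodZ × CmodZ) (i : Fin r × Fin r) (z : ℤ × ℤ × ZMod 2) :
    generic r hr lift g i ⊗ (sigma r hr).obj ⟨z⟩ ≅
      WtMod.kac (root r hr) ((lift g).1 + (i.1 : ℕ) + z.1 * r) ((lift g).2 + (i.2 : ℕ) + z.2.1 * r)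
        (0 + z.2.2) :=
  WtMod.shiftKac (root r hr) _ _ _ _ _ (root_pow r hr z.1) (by rw [root_pow, one_mul])

theorem natCast_add_mul_injective {i j : Fin r} {n m : ℤ}
    (hij : ((i : ℕ) : ℂ) + n * r = (j : ℕ) + m * r) : i = j ∧ n = m := by
  have h1 : ((i : ℕ) : ℤ) + n * r = (j : ℕ) + m * r := by exact_mod_cast hij
  have hij : i = j := by
    by_contra hne
    exact not_dvd_sub hne ⟨m - n, by linear_combination h1⟩
  subst hij
  have hr0 : (r : ℤ) ≠ 0 := by have := i.2; omega
  exact ⟨rfl, mul_right_cancel₀ hr0 (by linear_combination h1)⟩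

theorem exists_natCast_add_mul (hr : 3 ≤ r) (n : ℤ) : ∃ (i : Fin r) (k : ℤ), n = (i : ℕ) + k * r := by
  obtain ⟨i, hi⟩ := exists_unique_dvd hr (-n)
  obtain ⟨k, hk⟩ := (hi i).2 rfl
  exact ⟨i, -k, by linear_combination -hk⟩

theorem isCompletelyReduced_generic
    (hlift : ∀ g, (((lift g).1 : CmodZ), ((lift g).2 : CmodZ)) = g) {g : CmodZ × CmodZ}
    (hg : g ∉ critical) : IsCompletelyReduced ℂ fun p : (Fin r × Fin r) × (ℤ × ℤ × ZMod 2) =>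
      generic r hr lift g p.1 ⊗ (sigma r hr).obj ⟨p.2⟩ := by
  rintro ⟨i, z⟩ ⟨j, w⟩
  constructor
  · rintro h1
    obtain ⟨rfl, rfl⟩ := Prod.mk.inj h1
    exact WtMod.rank_hom_eq_one (genericShift g i z)
  · intro hne
    refine WtMod.rank_hom_eq_zero (genericShift g i z) (genericShift g j w) ?_ fun heq => hne ?_
    · refine typical_of_notMem_critical hg ?_
      have h4 : ((lift g).1 : CmodZ) = g.1 := congrArg Prod.fst (hlift g)
      exact (CmodZ_eq_iff.2 ⟨(j.1 : ℕ) + w.1 * r, by push_cast; ring⟩).trans h4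
    · obtain ⟨h1, h2⟩ := Prod.mk.inj heq
      obtain ⟨h2, h3⟩ := Prod.mk.inj h2
      obtain ⟨a1, a2⟩ := natCast_add_mul_injective (i := i.1) (j := j.1) (n := z.1) (m := w.1)
        (by linear_combination h1)
      obtain ⟨b1, b2⟩ := natCast_add_mul_injective (i := i.2) (j := j.2) (n := z.2.1) (m := w.2.1)
        (by linear_combination h2)
      rw [zero_add, zero_add] at h3
      exact Prod.ext (Prod.ext a1 b1) (Prod.ext a2 (Prod.ext b2 h3))

theorem weightDegree_generic
    (hlift : ∀ g, (((lift g).1 : CmodZ), ((lift g).2 : CmodZ)) = g) (g : CmodZ × CmodZ)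
    (i : Fin r × Fin r) : weightDegree (root r hr) g (generic r hr lift g i) := by
  have h1 := WtMod.weightDegree_kac (h := root r hr) ((lift g).1 + (i.1 : ℕ))
    ((lift g).2 + (i.2 : ℕ)) 0
  have h2 : ∀ (x : ℂ) (n : ℕ), ((x + n : ℂ) : CmodZ) = x := fun x n =>
    CmodZ_eq_iff.2 ⟨n, by push_cast; ring⟩
  rw [h2, h2, hlift] at h1
  exact h1

theorem isDominating_generic
    (hlift : ∀ g, (((lift g).1 : CmodZ), ((lift g).2 : CmodZ)) = g) {g : CmodZ × CmodZ}
    (hg : g ∉ critical) : IsDominating (weightDegree (root r hr) g)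
      fun p : (Fin r × Fin r) × (ℤ × ℤ × ZMod 2) =>
        generic r hr lift g p.1 ⊗ (sigma r hr).obj ⟨p.2⟩ := by
  refine WtMod.IsDominatedBy.isDominating (fun p => ?_) fun V hV => ?_
  · have h1 := WtMod.isGrading.tensor _ _ _ _ (weightDegree_generic (hr := hr) hlift g p.1)
      (weightDegree_sigma (hr := hr) p.2)
    rwa [add_zero] at h1
  · refine (WtMod.isDominatedBy_kac fun v e b s hv0 hv => typical_of_notMem_critical hg
      (WtMod.weightDegree_apply hV hv0 hv).1).trans ?_
    rintro _ ⟨e, b, p, rfl, v, hv0, hv⟩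
    refine ⟨Unit, inferInstance, fun _ => _, fun _ => 𝟙 _, fun _ => 𝟙 _, fun _ => ?_, by simp⟩
    obtain ⟨⟨n, hn⟩, m, hm⟩ := lift_weight hlift hV hv0 hv
    obtain ⟨i, k, hi⟩ := exists_natCast_add_mul hr (-n)
    obtain ⟨j, l, hj⟩ := exists_natCast_add_mul hr m
    refine ⟨((i, j), (k, l, p)), ?_⟩
    have hi' : (-n : ℂ) = (i : ℕ) + k * r := by exact_mod_cast hi
    have hj' : (m : ℂ) = (j : ℕ) + l * r := by exact_mod_cast hj
    obtain ⟨φ⟩ := WtMod.kac_iso_of_eq (h := root r hr) (α := e)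
      (α' := (lift g).1 + (i : ℕ) + k * r) (a := b) (a' := (lift g).2 + (j : ℕ) + l * r)
      (p := p) (p' := 0 + p) (by linear_combination hi' - hn) (by linear_combination hm + hj')
      (zero_add p).symm
    exact ⟨φ ≪≫ (genericShift g (i, j) (k, l, p)).symm⟩

/-! ### Pre-modularity -/

theorem bracket_one_ne_zero : (root r hr).bracket 1 ≠ 0 := by
  rw [QParam.bracket, QParam.pow_neg, QParam.pow, mul_one]
  exact mul_ne_zero (inv_ne_zero (root r hr).diff_ne_zero) (root r hr).diff_ne_zero

theorem isNonzero_modifiedTrace : (WtMod.modifiedTrace (root r hr)).IsNonzero := by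
  have hb := bracket_one_ne_zero (hr := hr)
  refine ⟨WtMod.kac (root r hr) 1 0 0, WtMod.projectives_iff.2 ⟨_, WtMod.isAvgUnit_kac hb 0 0⟩,
    fun h0 => ?_⟩
  have h1 := WtMod.modifiedTrace_dim_kac hb 0 0
  rw [ModifiedTrace.dim, h0, LinearMap.zero_apply, WtMod.parSign_zero, one_mul, eq_comm,
    inv_eq_zero, QParam.pow_neg] at h1
  exact sub_inv_ne_zero_of_bracket hb h1

theorem isPremodular
    (hlift : ∀ g, (((lift g).1 : CmodZ), ((lift g).2 : CmodZ)) = g) :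
    (relData r hr lift (sigmaMonoidal r hr) (WtMod.modifiedTrace (root r hr))).IsPremodular
      critical where
  unit := WtMod.isScalarUnit
  small := isSmall_critical
  symmetric := isSymmetric_critical
  grading := WtMod.isGrading
  realisation := isFreeRealisation_sigma
  realisation_deg := weightDegree_sigma
  ideal := WtMod.isIdeal_projectives
  trace_nonzero := isNonzero_modifiedTrace
  simple g hg i := WtMod.simple_kac (bracket_generic hlift hg _) _ _
  regular g hg i := WtMod.isRegular_kac _ _ _
  projective g hg i := WtMod.projectives_iff.2
    ⟨_, WtMod.isAvgUnit_kac (bracket_generic hlift hg _) _ _⟩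
  dominating g hg := isDominating_generic hlift hg
  completely_reduced g hg := isCompletelyReduced_generic hlift hg
  compatible := ⟨monodromy, fun g V hV z => compatible_monodromy hV z⟩

end

namespace WtMod
variable {h : QParam}

/-! ### Projective indecomposable modules -/

theorem weight_eq_of_isWt_ind {e g : ℂ} {p : ZMod 2} {v : (ind h e g p).carrier} (hv0 : v ≠ 0) {e' b s : ℂ}
    (hv : (ind h e g p).IsWt v e' b s) : e' = e := by
  have h1 : ∀ c : ℂ × ℂ × ℂ × ℂ, indOps h e g .E c = e • c := fun c => by
    simp [indOps_apply h e g p]; rfl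
  exact smul_left_injective ℂ hv0 (hv.E.symm.trans (h1 v))

theorem ind_id_ne_zero (e g : ℂ) (p : ZMod 2) : 𝟙 (ind h e g p) ≠ 0 := fun h0 =>
  one_ne_zero (congrArg Prod.fst (LinearMap.congr_fun (congrArg lin h0) (indGen h e g p)) :
    (1 : ℂ) = 0)

open Classical in
/-- The indecomposable projective module generated by a vector of weight `(e, b)` and parity `p`: the
Kac module if `[e] ≠ 0`, and the induced module if `[e] = 0`. -/
noncomputable def projCover (h : QParam) (e b : ℂ) (p : ZMod 2) : WtMod h :=
  if h.bracket e = 0 then ind h e b p else kac h e b p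

theorem projCover_of_eq {e : ℂ} (he : h.bracket e = 0) (b : ℂ) (p : ZMod 2) :
    projCover h e b p = ind h e b p := if_pos he

theorem projCover_of_ne {e : ℂ} (he : h.bracket e ≠ 0) (b : ℂ) (p : ZMod 2) :
    projCover h e b p = kac h e b p := if_neg he

theorem weightDegree_projCover (e b : ℂ) (p : ZMod 2) :
    weightDegree h ((e : CmodZ), (b : CmodZ)) (projCover h e b p) := by
  by_cases he : h.bracket e = 0
  · rw [projCover_of_eq he]
    exact weightDegree_ind e b p
  · rw [projCover_of_ne he]
    exact weightDegree_kac e b p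

theorem projectives_projCover (e b : ℂ) (p : ZMod 2) :
    projectives (WtMod h) (projCover h e b p) := by
  by_cases he : h.bracket e = 0
  · rw [projCover_of_eq he]
    exact projectives_iff.2 (isAvgUnit_ind h e b p)
  · rw [projCover_of_ne he]
    exact projectives_iff.2 ⟨_, isAvgUnit_kac he b p⟩

theorem isIndecomposable_projCover (e b : ℂ) (p : ZMod 2) :
    IsIndecomposable (projCover h e b p) := by
  by_cases he : h.bracket e = 0
  · rw [projCover_of_eq he]
    exact isIndecomposable_of_idem (ind_id_ne_zero e b p) fun f => idem_ind he f
  · rw [projCover_of_ne he]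
    exact isIndecomposable_of_idem (kac_id_ne_zero e b p) fun f => idem_kac f

/-- An indecomposable projective module is a retract of an induced module. The induced module is
indecomposable if `[e] = 0`, and otherwise it is a direct sum of Kac modules. -/
theorem exists_iso_projCover {Q : WtMod h} {g : CmodZ × CmodZ} (hQ : weightDegree h g Q)
    (hP : projectives (WtMod h) Q) (hi : IsIndecomposable Q) :
    ∃ (e b : ℂ) (p : ZMod 2), ((e : CmodZ), (b : CmodZ)) = g ∧ Nonempty (Q ≅ projCover h e b p) := by
  obtain ⟨φ, hφ⟩ := projectives_iff.1 hP
  have h0 := id_ne_zero_of_isIndecomposable hi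
  have hdom := isDominatedBy_ind hφ
  by_cases hex : ∃ (W : WtMod h) (s : Q ⟶ W) (t : W ⟶ Q) (e b : ℂ) (p : ZMod 2),
      h.bracket e = 0 ∧ W = ind h e b p ∧ ((e : CmodZ), (b : CmodZ)) = g ∧ s ≫ t = 𝟙 Q
  · obtain ⟨_, s, t, e, b, p, he, rfl, hg, hst⟩ := hex
    refine ⟨e, b, p, hg, ?_⟩
    rw [projCover_of_eq he]
    exact iso_of_retract h0 (fun f => idem_ind he f) hst
  · obtain ⟨_, s, t, ⟨e, b, p, rfl, v, hv0, hv⟩, hst⟩ := exists_retract_of_isDominatedBy hi hdom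
    have hg : ((e : CmodZ), (b : CmodZ)) = g :=
      Prod.ext (weightDegree_apply hQ hv0 hv).1 (weightDegree_apply hQ hv0 hv).2
    have he : h.bracket e ≠ 0 := fun he => hex ⟨_, s, t, e, b, p, he, rfl, hg, hst⟩
    have hQ' : ∀ v e' b s, v ≠ 0 → Q.IsWt v e' b s → h.bracket e' ≠ 0 := by
      intro w e' b' s' hw0 hw
      have h1 : lin s w ≠ 0 := fun h1 => hw0 (by
        have h2 := LinearMap.congr_fun (congrArg lin hst) w
        rw [lin_comp, LinearMap.comp_apply, h1, map_zero] at h2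
        exact h2.symm)
      rwa [weight_eq_of_isWt_ind h1 ((isWeightMap_lin s).map_wt hw)]
    obtain ⟨_, s, t, ⟨e, b, p, rfl, v, hv0, hv⟩, hst⟩ :=
      exists_retract_of_isDominatedBy hi (isDominatedBy_kac hQ')
    refine ⟨e, b, p, Prod.ext (weightDegree_apply hQ hv0 hv).1 (weightDegree_apply hQ hv0 hv).2, ?_⟩
    rw [projCover_of_ne (hQ' v e b _ hv0 hv)]
    exact iso_of_retract h0 (fun f => idem_kac f) hst

theorem projCover_tensor_eps (e b : ℂ) {e' : ℂ} (b' : ℂ) (p p' : ZMod 2) (he : h.pow e' = 1)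
    (he' : h.pow e' * h.pow e' = 1) :
    Nonempty (projCover h e b p ⊗ eps h e' b' p' he' ≅ projCover h (e + e') (b + b') (p + p')) := by
  have h1 : h.bracket (e + e') = h.bracket e := by
    simp only [QParam.bracket, h.pow_neg, h.pow_add, he, mul_one]
  by_cases h0 : h.bracket e = 0
  · rw [projCover_of_eq h0, projCover_of_eq (h1.trans h0)]
    exact ⟨shiftInd h _ _ _ _ _ he he'⟩
  · rw [projCover_of_ne h0, projCover_of_ne (h1.trans_ne h0)]
    exact ⟨shiftKac h _ _ _ _ _ he he'⟩

/-! ### Finiteness -/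

theorem finite_hom (V W : WtMod h) : Module.Finite ℂ (V ⟶ W) :=
  Module.Finite.of_injective
    ({ toFun := fun f => lin f, map_add' := fun _ _ => rfl, map_smul' := fun _ _ => rfl } :
      (V ⟶ W) →ₗ[ℂ] V.carrier →ₗ[ℂ] W.carrier) fun _ _ hfg => hom_ext hfg

theorem finite_weights (V : WtMod h) : {w : ℂ × ℂ × ℂ | ∃ v, v ≠ 0 ∧ V.IsWt v w.1 w.2.1 w.2.2}.Finite := by
  obtain ⟨n, B, e, b, s, hB⟩ := V.exists_weightBasis
  refine (Set.finite_range fun i => (e i, b i, s i)).subset ?_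
  rintro ⟨e', b', s'⟩ ⟨v, hv0, hv⟩
  obtain ⟨i, hi⟩ : ∃ i, B.repr v i ≠ 0 := by
    by_contra! h0
    exact hv0 (B.repr.map_eq_zero_iff.1 (Finsupp.ext h0))
  obtain ⟨rfl, rfl, rfl⟩ := weight_eq_of_repr_ne_zero hB hv hi
  exact ⟨i, rfl⟩

theorem exists_isWt_of_hom_eps {e b : ℂ} {p : ZMod 2} {he : h.pow e * h.pow e = 1} {V : WtMod h}
    {f : eps h e b p he ⟶ V} (hf : f ≠ 0) : ∃ v, v ≠ 0 ∧ V.IsWt v e b (parSign p) := by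
  refine ⟨lin f (1 : ℂ), fun h0 => hf (hom_ext ?_), (isWeightMap_lin f).map_wt (isWt_eps e b p he)⟩
  have key : ∀ F : ℂ →ₗ[ℂ] V.carrier, F 1 = 0 → F = 0 := fun F hF => LinearMap.ext_ring hF
  exact key (lin f) h0

end WtMod

section
variable {r : ℕ} {hr : 3 ≤ r} {lift : CmodZ × CmodZ → ℂ × ℂ}

theorem finite_hom_sigma (P : WtMod (root r hr)) :
    {z : ℤ × ℤ × ZMod 2 | ∃ f : (sigma r hr).obj ⟨z⟩ ⟶ P, f ≠ 0}.Finite := by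
  have hr0 : (r : ℂ) ≠ 0 := by exact_mod_cast (by omega : r ≠ 0)
  have hinj : Function.Injective fun z : ℤ × ℤ × ZMod 2 =>
      ((z.1 * r : ℂ), (z.2.1 * r : ℂ), parSign z.2.2) := by
    intro z w hzw
    obtain ⟨h1, h2⟩ := Prod.mk.inj hzw
    obtain ⟨h2, h3⟩ := Prod.mk.inj h2
    exact Prod.ext (Int.cast_injective (mul_right_cancel₀ hr0 h1))
      (Prod.ext (Int.cast_injective (mul_right_cancel₀ hr0 h2)) (parSign_injective h3))
  refine ((P.finite_weights).preimage hinj.injOn).subset ?_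
  rintro z ⟨f, hf⟩
  exact WtMod.exists_isWt_of_hom_eps (he := by rw [root_pow, one_mul]) hf

theorem finite_indecomposables
    (hlift : ∀ g, (((lift g).1 : CmodZ), ((lift g).2 : CmodZ)) = g) (g : CmodZ × CmodZ) :
    ∃ (n : ℕ) (P : Fin n → WtMod (root r hr)), (∀ j, weightDegree (root r hr) g (P j) ∧
        projectives (WtMod (root r hr)) (P j) ∧ IsIndecomposable (P j)) ∧
      ∀ Q, weightDegree (root r hr) g Q → projectives (WtMod (root r hr)) Q → IsIndecomposable Q →
        ∃ (j : Fin n) (z : ℤ × ℤ × ZMod 2), Nonempty (Q ≅ P j ⊗ (sigma r hr).obj ⟨z⟩) := by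
  have hcl : ∀ (x : ℂ) (n : ℕ), ((x + n : ℂ) : CmodZ) = x := fun x n =>
    CmodZ_eq_iff.2 ⟨n, by push_cast; ring⟩
  refine ⟨r * r, fun x => WtMod.projCover (root r hr)
    ((lift g).1 + ((finProdFinEquiv.symm x).1 : ℕ)) ((lift g).2 + ((finProdFinEquiv.symm x).2 : ℕ)) 0,
    fun x => ⟨?_, WtMod.projectives_projCover _ _ _, WtMod.isIndecomposable_projCover _ _ _⟩,
    fun Q hQ hP hi => ?_⟩
  · have h1 := WtMod.weightDegree_projCover (h := root r hr)
      ((lift g).1 + ((finProdFinEquiv.symm x).1 : ℕ))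
      ((lift g).2 + ((finProdFinEquiv.symm x).2 : ℕ)) 0
    rwa [hcl, hcl, hlift] at h1
  · obtain ⟨e, b, p, heb, ⟨φ⟩⟩ := WtMod.exists_iso_projCover hQ hP hi
    have heb' := heb.trans (hlift g).symm
    obtain ⟨n, hn⟩ := CmodZ_eq_iff.1 (congrArg Prod.fst heb')
    obtain ⟨m, hm⟩ := CmodZ_eq_iff.1 (congrArg Prod.snd heb')
    obtain ⟨i, k, hi⟩ := exists_natCast_add_mul hr n
    obtain ⟨j, l, hj⟩ := exists_natCast_add_mul hr m
    have hi' : (n : ℂ) = (i : ℕ) + k * r := by exact_mod_cast hi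
    have hj' : (m : ℂ) = (j : ℕ) + l * r := by exact_mod_cast hj
    refine ⟨finProdFinEquiv (i, j), (k, l, p), ?_⟩
    obtain ⟨ψ⟩ := WtMod.projCover_tensor_eps (h := root r hr) ((lift g).1 + (i : ℕ))
      ((lift g).2 + (j : ℕ)) (l * r) 0 p (root_pow r hr k) (by rw [root_pow, one_mul])
    have h1 : (lift g).1 + (i : ℕ) + k * r = e := by linear_combination -hi' - hn
    have h2 : (lift g).2 + (j : ℕ) + l * r = b := by linear_combination -hj' - hm
    rw [h1, h2, zero_add] at ψ
    simp only [Equiv.symm_apply_apply]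
    exact ⟨φ ≪≫ ψ.symm⟩

theorem isTQFTFinite (hlift : ∀ g, (((lift g).1 : CmodZ), ((lift g).2 : CmodZ)) = g) :
    (relData r hr lift (sigmaMonoidal r hr) (WtMod.modifiedTrace (root r hr))).IsTQFTFinite where
  finite_indecomposables g := finite_indecomposables hlift g
  finite_hom P _ := ⟨fun z => WtMod.finite_hom _ _, finite_hom_sigma P⟩
  dominated := WtMod.IsDominatedBy.isDominating (fun P => P.2.1) fun V hV =>
    (WtMod.isDominatedBy_indecomposable hV).trans fun W hW =>
      ⟨Unit, inferInstance, fun _ => W, fun _ => 𝟙 W, fun _ => 𝟙 W,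
        fun _ => ⟨⟨W, hW⟩, ⟨Iso.refl W⟩⟩, by simp⟩

-- unfolding `relData` in the goal to match the explicit sums takes a deep recursion
set_option maxRecDepth 8000 in
theorem isModular (hodd : Odd r) (hlift : ∀ g, (((lift g).1 : CmodZ), ((lift g).2 : CmodZ)) = g) :
    (relData r hr lift (sigmaMonoidal r hr) (WtMod.modifiedTrace (root r hr))).IsModular
      critical (-(r : ℂ) ^ 2) where
  premodular := isPremodular hlift
  ne_zero := neg_ne_zero.2 (pow_ne_zero 2 (by exact_mod_cast (by omega : r ≠ 0)))
  diag g hg g' hg' i := by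
    have h1 := modularity_diag (hr := hr) hodd hlift hg hg' i
    rw [kirby] at h1
    exact h1
  off_diag g hg g' hg' i j hij := by
    have h1 := (congrArg ((WtMod.modifiedTrace (root r hr)).dim (generic r hr lift g i) • ·)
      (modularity_off_diag (hr := hr) (g := g) hodd hlift hg' hij)).trans (smul_zero _)
    rw [kirby] at h1
    exact h1

theorem isStabilisation (hodd : Odd r)
    (hlift : ∀ g, (((lift g).1 : CmodZ), ((lift g).2 : CmodZ)) = g) :
    (relData r hr lift (sigmaMonoidal r hr) (WtMod.modifiedTrace (root r hr))).IsStabilisation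
      critical (-(r : ℂ)) (r : ℂ) where
  minus g hg V hV := stabilisation_minus hodd hlift hg hV
  plus g hg V hV := stabilisation_plus hodd hlift hg hV

end
end GL11

theorem theorem2p14 (r : ℕ) (hr : 3 ≤ r) (hodd : Odd r)
    (lift : GL11.CmodZ × GL11.CmodZ → ℂ × ℂ)
    (hlift : ∀ g, (((lift g).1 : GL11.CmodZ), ((lift g).2 : GL11.CmodZ)) = g) :
    ∃ (mon : (GL11.sigma r hr).Monoidal)
      (t : RelMod.ModifiedTrace ℂ (RelMod.projectives (GL11.WtMod (GL11.root r hr)))),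
      RelMod.projectives (GL11.WtMod (GL11.root r hr))
        (GL11.WtMod.kac (GL11.root r hr) 1 0 0) ∧
      t.dim (GL11.WtMod.kac (GL11.root r hr) 1 0 0) =
        ((GL11.root r hr).q - (GL11.root r hr).q⁻¹)⁻¹ ∧
      (GL11.relData r hr lift mon t).IsModular GL11.critical (-(r : ℂ) ^ 2) ∧
      (GL11.relData r hr lift mon t).IsStabilisation GL11.critical (-(r : ℂ)) (r : ℂ) ∧
      (GL11.relData r hr lift mon t).IsTQFTFinite := by
  have hb := GL11.bracket_one_ne_zero (hr := hr)
  refine ⟨GL11.sigmaMonoidal r hr, GL11.WtMod.modifiedTrace (GL11.root r hr),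
    GL11.WtMod.projectives_iff.2 ⟨_, GL11.WtMod.isAvgUnit_kac hb 0 0⟩, ?_,
    GL11.isModular hodd hlift, GL11.isStabilisation hodd hlift, GL11.isTQFTFinite hlift⟩
  rw [GL11.WtMod.modifiedTrace_dim_kac hb, GL11.WtMod.parSign_zero, one_mul,
    GL11.QParam.pow_neg, GL11.QParam.pow, mul_one, GL11.QParam.q]
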